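/- All logarithms are to base $2$ unless written $\ln$; $e^{x}$ is the exponential function. **Model.** Let $n,p,Q,R$ be positive integers, $c,\epsilon>0$, $\sigma\ge 0$. Let $X\in\mathbb R^{n\times p}$ have iid entries whose common law has a density bounded by $c$ and satisfies $\mathbb E|X_{11}|\le M<\infty$. Let $W\in\mathbb R^n$ be independent of $X$, with iid entries of mean zero and variance at most $\sigma^2$. Let $\beta^*\in[-R,R]^p$ satisfy $Q\beta^*\in\mathbb Z^p$, and let $Y=X\beta^*+W$. **Algorithm ELO**, for $Y\in\mathbb Z^n$, $X\in\mathbb Z^{n\times p}$ and positive integers $\hat R,\hat W$. Draw $Z$ with iid coordinates uniform on $\{\hat R+1,\dots,2\hat R+\lfloor\log p\rfloor\}$, independent of the data. Put $Y_1=Y+XZ$; obtain $Y_2$ from $Y_1$ by replacing each coordinate of absolute value less than $3$ by $3$. Put $m=2^{n+\lceil p/2\rceil+3}\,p\,(\hat R\lceil\sqrt p\rceil+\hat W\lceil\sqrt n\rceil)$. Run the LLL basis reduction algorithm (parameter $3/4$) on the columns of $$\begin{pmatrix} mX & -m\,\mathrm{Diag}(Y_2) & mI_n\\ I_p&0&0\\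 0&0&I_n\end{pmatrix}$$ and let $\hat z$ be the first vector of the reduced basis. Compute the signed greatest common divisor $g$ of $\hat z_{n+1},\dots,\hat z_{n+p}$ by Euclid's algorithm with remainders truncated towards zero. If $g\ne0$ output $\frac1g(\hat z_{n+1},\dots,\hat z_{n+p})-Z$, otherwise output $0$. **Algorithm LBR**, for $Y\in\mathbb R^n$, $X\in\mathbb R^{n\times p}$ and positive integers $N,\hat Q,\hat R,\hat W$. With $x_N=\mathrm{sign}(x)\,2^{-N}\lfloor 2^N|x|\rfloor$ applied entrywise, output $\frac1{\hat Q}$ times the output of ELO on $\bigl(2^N\hat QY_N,\;2^NX_N,\;\hat Q\hat R,\;2\hat Q(2^N\hat W+\hat Rp)\bigr)$. Its running time is the number of bit operations. **Proposition.** There are an absolute constant $\kappa>0$, an absolute polynomial $T$, and for all $c>0$ and $M$ a constant $K=K(c,M)$ such that the following holds for all $\epsilon$, $n$, $p$, $Q$, $R$, $N$, $\sigma$ and all $X,W,\beta^*$ as above. Suppose $p\ge\frac{300}{\epsilon}\log\frac{300}{(1+c)\epsilon}$ and $$\sigma\le 2^{-(1+\epsilon)\left[\frac{(p+2n)^2}{2n}+\left(2+\frac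 pn\right)\log(RQ)\right]},$$ and that the positive integer $N$ satisfies $$\log\tfrac1\sigma\;\ge\;N\;\ge\;(1+\epsilon)\left[\frac{(p+2n)^2}{2n}+\left(2+\frac pn\right)\log(RQ)\right]$$ (the upper bound is void if $\sigma=0$). Then, with probability at least $$1-K\left(\frac1{np}+e^{-\kappa p}\right),$$ LBR with input $Y,X$, truncation level $N$, $\hat Q=Q$, $\hat R=R$, $\hat W=1$ terminates with output exactly $\beta^*$ and within $T(n,p,N,\log R,\log Q)$ bit operations. In particular this holds with high probability as $p\to\infty$, uniformly in $n$, and with probability $1-O\left(\frac1{np}\right)$ as long as $np\le e^{\kappa p}$. -/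

import Mathlib

namespace LatticeRegression

/-! Step counting. A value of type `Step α` is the result of a computation together with the number
of elementary bit operations that were spent on it. -/

/-- A computed value together with the number of bit operations spent. -/
structure Step (α : Type*) where
  /-- the computed value -/
  val : α
  /-- the number of bit operations spent -/
  cost : ℕ

instance : Monad Step where
  pure a := ⟨a, 0⟩
  bind x f := ⟨(f x.val).val, x.cost + (f x.val).cost⟩

/-- Number of bits of a signed integer (with one bit for the sign). -/
def bits (z : ℤ) : ℕ := Nat.size z.natAbs + 1

/-- Number of bits of a rational number, stored as a fraction in lowest terms. -/
def ratBits (q : ℚ) : ℕ := bits q.num + bits q.den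

/-- An elementary operation on numbers with `s` bits in total costs `s ^ 3` bit operations. This is
an upper bound for the schoolbook algorithms, including the reduction of fractions. -/
def charge {α : Type*} (s : ℕ) (a : α) : Step α := ⟨a, s ^ 3⟩

def iadd (a b : ℤ) : Step ℤ := charge (bits a + bits b) (a + b)

def isub (a b : ℤ) : Step ℤ := charge (bits a + bits b) (a - b)

def imul (a b : ℤ) : Step ℤ := charge (bits a + bits b) (a * b)

/-- Quotient of integers, used only when the division is exact. -/
def idiv (a b : ℤ) : Step ℤ := charge (bits a + bits b) (a / b)

def radd (a b : ℚ) : Step ℚ := charge (ratBits a + ratBits b) (a + b)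

def rsub (a b : ℚ) : Step ℚ := charge (ratBits a + ratBits b) (a - b)

def rmul (a b : ℚ) : Step ℚ := charge (ratBits a + ratBits b) (a * b)

def rdiv (a b : ℚ) : Step ℚ := charge (ratBits a + ratBits b) (a / b)

def rle (a b : ℚ) : Step Bool := charge (ratBits a + ratBits b) (decide (a ≤ b))

/-- Rounding to a nearest integer. -/
def rround (a : ℚ) : Step ℤ := charge (ratBits a) (round a)

/-- Fill a vector entry by entry: the costs of all entries add up, plus one for each store. -/
def fill {α : Type*} {d : ℕ} (f : Fin d → Step α) : Step (Fin d → α) :=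
  ⟨fun a => (f a).val, d + ∑ a, (f a).cost⟩

/-- Run the loop with body `body` from the state `s`. The body either continues with a new state or
stops with a result. The value is `none` if the loop has not stopped within `fuel` rounds, and
does not depend on `fuel` otherwise. -/
def loop {σ β : Type} (body : σ → Step (σ ⊕ β)) : (fuel : ℕ) → σ → Step (Option β)
  | 0, _ => pure none
  | fuel + 1, s => do
    charge 1 ()
    match ← body s with
    | Sum.inl t => loop body fuel t
    | Sum.inr r => pure (some r)

/-! The LLL basis reduction algorithm in exact rational arithmetic. -/

/-- The inner product. -/
def dot {d : ℕ} (u v : Fin d → ℚ) : Step ℚ :=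
  (List.finRange d).foldlM (fun s a => do radd s (← rmul (u a) (v a))) 0

/-- The coefficient `⟨v, w⟩ / ⟨w, w⟩`. -/
def coeff {d : ℕ} (v w : Fin d → ℚ) : Step ℚ := do
  rdiv (← dot v w) (← dot w w)

/-- The Gram-Schmidt orthogonalisation (without normalisation) of `b 0, …, b (i - 1)`. -/
def gso {d : ℕ} (b : ℕ → Fin d → ℤ) : (i : ℕ) → Step (ℕ → Fin d → ℚ)
  | 0 => pure 0
  | i + 1 => do
    let s ← gso b i
    let v ← (List.range i).foldlM
      (fun v j => do
        let μ ← coeff v (s j)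
        fill fun a => do rsub (v a) (← rmul μ (s j a)))
      (fun a => (b i a : ℚ))
    pure (Function.update s i v)

/-- Size reduction of `b i` against `b (i - 1), …, b 0`, in this order, where `s` is the Gram-Schmidt
orthogonalisation of `b`. -/
def sizeReduce {d : ℕ} (b : ℕ → Fin d → ℤ) (s : ℕ → Fin d → ℚ) (i : ℕ) : Step (Fin d → ℤ) :=
  (List.range i).reverse.foldlM
    (fun v j => do
      let r ← rround (← coeff (fun a => (v a : ℚ)) (s j))
      fill fun a => do isub (v a) (← imul r (b j a)))
    (b i)

/-- One round of LLL with parameter `3/4` on the basis `b 0, …, b (k - 1)` with working index `i`: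
size reduction of `b i`, then the Lovász test, then either `i` is increased, or `b i` and
`b (i - 1)` are swapped and `i` is decreased. It stops with `b 0` when `i` has passed the end. -/
def lllRound {d : ℕ} (k : ℕ) (st : (ℕ → Fin d → ℤ) × ℕ) :
    Step (((ℕ → Fin d → ℤ) × ℕ) ⊕ (Fin d → ℤ)) := do
  let b := st.1
  let i := st.2
  if i < k then
    let s ← gso b (i + 1)
    let v ← sizeReduce b s i
    let c := Function.update b i v
    let μ ← coeff (fun a => (v a : ℚ)) (s (i - 1))
    let x ← dot (s i) (s i)
    let y ← dot (s (i - 1)) (s (i - 1))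
    let t ← rmul (← rsub (3 / 4) (← rmul μ μ)) y
    if ← rle t x then
      pure (Sum.inl (c, i + 1))
    else
      pure (Sum.inl (fun j => c (Equiv.swap (i - 1) i j), max (i - 1) 1))
  else
    pure (Sum.inr (b 0))

/-- The first vector of the basis which LLL computes from the basis `B`. -/
def lll {k d : ℕ} (fuel : ℕ) (B : Fin k → Fin d → ℤ) : Step (Option (Fin d → ℤ)) :=
  loop (lllRound k) fuel (fun c => if h : c < k then B ⟨c, h⟩ else 0, 1)

/-! The extended Lagarias-Odlyzko algorithm. -/

/-- Euclid's algorithm on signed integers, with remainders truncated towards zero. The result is a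
greatest common divisor; changing the sign of both arguments changes its sign. -/
def euclid (a b : ℤ) : Step ℤ :=
  if _h : b = 0 then pure a
  else do
    charge (bits a + bits b) ()
    euclid b (a.tmod b)
termination_by b.natAbs
decreasing_by
  have h1 : (a.tmod b).natAbs = a.natAbs % b.natAbs := Int.natAbs_tmod a b
  rw [h1]
  exact Nat.mod_lt _ (Int.natAbs_pos.mpr _h)

/-- The integer `⌈√k⌉`. -/
def ceilSqrt (k : ℕ) : ℕ := if k = 0 then 0 else Nat.sqrt (k - 1) + 1

theorem ceilSqrt_eq (k : ℕ) : ceilSqrt k = ⌈Real.sqrt k⌉₊ := by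
  unfold ceilSqrt
  rcases k with _ | k
  · simp
  · simp only [Nat.add_sub_cancel]
    symm
    rw [if_neg (by omega), Nat.ceil_eq_iff (by omega)]
    constructor
    · simp only [Nat.add_sub_cancel]
      apply Real.lt_sqrt_of_sq_lt
      exact_mod_cast Nat.lt_succ_of_le (by simpa [sq] using Nat.sqrt_le k)
    · rw [Real.sqrt_le_left (by positivity)]
      exact_mod_cast (by simpa [sq] using Nat.succ_le_of_lt (Nat.lt_succ_sqrt k))

/-- The scale `m = 2 ^ (n + ⌈p / 2⌉ + 3) * p * (Rhat * ⌈√p⌉ + What * ⌈√n⌉)`. -/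
def scale (n p Rhat What : ℕ) : Step ℤ := do
  let u ← charge (n + p + 4) ((2 : ℤ) ^ (n + (p + 1) / 2 + 3))
  let sp ← charge (p + 1) (ceilSqrt p : ℤ)
  let sn ← charge (n + 1) (ceilSqrt n : ℤ)
  let v ← iadd (← imul Rhat sp) (← imul What sn)
  imul (← imul u p) v

/-- The matrix with block rows `(m X, -m Diag Y, m I)`, `(I, 0, 0)`, `(0, 0, I)`. -/
def latticeMatrix {n p : ℕ} (m : ℤ) (X : Matrix (Fin n) (Fin p) ℤ) (Y : Fin n → ℤ) :
    Matrix (Fin (n + p + n)) (Fin (p + n + n)) ℤ :=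
  Matrix.reindex
    ((Equiv.sumCongr finSumFinEquiv (Equiv.refl (Fin n))).trans finSumFinEquiv)
    ((Equiv.sumCongr finSumFinEquiv (Equiv.refl (Fin n))).trans finSumFinEquiv)
    (Matrix.fromBlocks
      (Matrix.fromBlocks (m • X) (-(m • Matrix.diagonal Y)) 1 0)
      (Matrix.fromRows (m • (1 : Matrix (Fin n) (Fin n) ℤ)) 0)
      0 1)

/-- The range `{Rhat + 1, …, 2 Rhat + ⌊log₂ p⌋}` of the random shift. -/
noncomputable def shiftRange (p Rhat : ℕ) : Finset ℤ := Finset.Icc (Rhat + 1 : ℤ) (2 * Rhat + Nat.log 2 p)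

/-- The extended Lagarias-Odlyzko algorithm with random shift `Z`. -/
def elo {n p : ℕ} (fuel : ℕ) (Y : Fin n → ℤ) (X : Matrix (Fin n) (Fin p) ℤ) (Rhat What : ℕ)
    (Z : Fin p → ℤ) : Step (Option (Fin p → ℤ)) := do
  let _ ← fill fun j => charge (bits (Z j)) ()
  let Y1 ← fill fun i =>
    (List.finRange p).foldlM (fun s j => do iadd s (← imul (X i j) (Z j))) (Y i)
  let Y2 ← fill fun i => charge (bits (Y1 i)) (if (Y1 i).natAbs < 3 then 3 else Y1 i)
  let m ← scale n p Rhat What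
  let A := latticeMatrix m X Y2
  let B ← fill fun c => fill fun r => charge (bits m + bits (A r c)) (A r c)
  match ← lll fuel B with
  | none => pure none
  | some z => do
    let x : Fin p → ℤ := fun j => z (Fin.castAdd n (Fin.natAdd n j))
    let g ← (List.finRange p).foldlM (fun g j => euclid g (x j)) 0
    if g = 0 then
      pure (some 0)
    else do
      let out ← fill fun j => do isub (← idiv (x j) g) (Z j)
      pure (some out)

/-! The lattice based regression algorithm. -/

/-- The integer `2 ^ N * x_N = sign(x) * ⌊2 ^ N * |x|⌋`, where `x_N` keeps the first `N` bits of `x`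
after the binary point. -/
noncomputable def truncInt (N : ℕ) (x : ℝ) : ℤ := (SignType.sign x : ℤ) * ⌊(2 : ℝ) ^ N * |x|⌋

/-- Read a real number up to its first `N` bits after the binary point. -/
noncomputable def readReal (N : ℕ) (x : ℝ) : Step ℤ :=
  charge (N + bits (truncInt N x)) (truncInt N x)

/-- The LBR algorithm with random shift `Z`. -/
noncomputable def lbr {n p : ℕ} (fuel : ℕ) (Y : Fin n → ℝ) (X : Matrix (Fin n) (Fin p) ℝ)
    (N Qhat Rhat What : ℕ) (Z : Fin p → ℤ) : Step (Option (Fin p → ℚ)) := do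
  let YN ← fill fun i => do imul Qhat (← readReal N (Y i))
  let XN ← fill fun i => fill fun j => readReal N (X i j)
  let R1 ← charge (bits Qhat + bits Rhat) (Qhat * Rhat)
  let W1 ← charge (N + p + bits Qhat + bits Rhat + bits What)
    (2 * Qhat * (2 ^ N * What + Rhat * p))
  match ← elo fuel YN XN R1 W1 Z with
  | none => pure none
  | some β1 => do
    let out ← fill fun j => rdiv (β1 j) Qhat
    pure (some out)

/-- The LBR algorithm terminates on the given input and random shift with the output `out`, after
`t` bit operations in total. -/
def LBRTerminates {n p : ℕ} (Y : Fin n → ℝ) (X : Matrix (Fin n) (Fin p) ℝ)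
    (N Qhat Rhat What : ℕ) (Z : Fin p → ℤ) (out : Fin p → ℚ) (t : ℕ) : Prop :=
  ∃ fuel : ℕ, lbr fuel Y X N Qhat Rhat What Z = ⟨some out, t⟩

end LatticeRegression

open MeasureTheory ProbabilityTheory LatticeRegression

/-!
# Recovery of a rational regression vector by lattice basis reduction

Write `B = Q β`, `k = p + 2 n`, and let `b = B + Z` be the shifted solution. The columns of the lattice
matrix generate a lattice of rank `k` in which the coefficient vector `(b, 1, residual)` gives a vector
of length about `Q R k ^ 3`. The errors of the linear equations are multiplied by a number `m` that
exceeds every vector LLL can return, so the vector found by LLL solves the equations exactly. It is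
therefore enough that, with high probability, all solutions `(z1, z2, z3)` of the equations that are
bounded by `D = 2 ^ (k / 2) Q R k ^ 3` have `z1` proportional to `b`. Then the coordinates that are
read off are `r b` with an integer `r ≠ 0`. If `b` is positive with coprime coordinates, the signed
greatest common divisor is exactly `r`, and dividing by it and subtracting `Z` gives `B`
(`exists_spec_elo`, `Good.exists_lbrTerminates`).

*Probability.* Rounding turns the equations into inequalities
`|2 ^ N X (z1 - z2 b) - z2 2 ^ N Q W| ≤ error` in every row. If `z1` is not a multiple of `b`, the
coefficient vectors `z1 - z2 b` are nonzero, and since the entries of `X` have density at most `c` each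
row satisfies its inequality with probability at most `2 c k ^ 4 D / 2 ^ N`
(`measure_pi_abs_sum_sub_le`, `exists_le_abs_sub_mul`). For this bound `b` must have a coordinate of
the order `Q R`, which the shift provides. The rows are independent, so the union bound over the at
most `(3 D) ^ p (3 k ^ 10 D) ^ n` pairs `(z1, z2)` is small once `2 ^ (N n)` exceeds `D ^ k` times the
`k`-th power of a polynomial in `k`. The lower bound for `N` gives
`2 ^ (N n) ≥ 2 ^ ((1 + ε) (k ^ 2 / 2 + k log (R Q)))`, and the gain `2 ^ (ε k ^ 2 / 2)` beats the
polynomial factors by the lower bound for `p`, once `k` is larger than a constant that depends on `c`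
(`pow_mul_le_two_rpow`, `union_bound_le`). Smaller `k` are covered by the choice of the constant `K`.
The remaining events are that an entry of `X` or the noise is large (Markov and Chebyshev), that an
observation is close to zero, and that the coordinates of `b` have a common divisor or are all small.
The last two have probability `O((2 / 3) ^ p)`. In the case of common divisors this holds as a number
`q ≥ 2` below the number of shifts divides each coordinate with probability at most `2 / (q + 1)`
(`measure_exists_dvd_le`).

*Running time.* Costs and values are tracked together by `Spec`. For LLL the invariant `LLLInv` bounds
the basis and its Gram-Schmidt vectors. The Gram determinants are integers and common denominators of
all projections, so all rational numbers have polynomial size (`LLLInv.small_proj`). The product of the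
Gram determinants decreases by the factor `3 / 4` with every swap, which bounds the number of rounds
(`potential_swap_le`, `Spec.lllLoop`, `exists_spec_lll`).
-/

namespace LatticeRegression

/-! ### Reasoning about values and costs of computations -/

/-- `Spec x C post`: the computation `x` spends at most `C` bit operations and its value satisfies
`post`. -/
def Spec {α : Type*} (x : Step α) (C : ℕ) (post : α → Prop) : Prop := x.cost ≤ C ∧ post x.val

namespace Spec

variable {α β : Type*}

theorem mono {x : Step α} {C C' : ℕ} {P P' : α → Prop} (h : Spec x C P) (hC : C ≤ C')
    (hP : ∀ a, P a → P' a) : Spec x C' P' := ⟨h.1.trans hC, hP _ h.2⟩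

theorem pure {a : α} {C : ℕ} {P : α → Prop} (h : P a) : Spec (Pure.pure a : Step α) C P :=
  ⟨Nat.zero_le _, h⟩

theorem bind {α β : Type _} {x : Step α} {f : α → Step β} {C D : ℕ} {P : α → Prop} {Q : β → Prop}
    (h : Spec x C P) (hf : ∀ a, P a → Spec (f a) D Q) : Spec (x >>= f) (C + D) Q :=
  ⟨Nat.add_le_add h.1 (hf _ h.2).1, (hf _ h.2).2⟩

theorem charge {a : α} {s C : ℕ} {P : α → Prop} (hs : s ^ 3 ≤ C) (h : P a) :
    Spec (LatticeRegression.charge s a) C P := ⟨hs, h⟩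

theorem fill {d : ℕ} {f : Fin d → Step α} {C : ℕ} {P : Fin d → α → Prop}
    (h : ∀ a, Spec (f a) C (P a)) : Spec (fill f) (d + d * C) fun v => ∀ a, P a (v a) := by
  refine ⟨Nat.add_le_add_left ?_ d, fun a => (h a).2⟩
  simpa using Finset.sum_le_card_nsmul Finset.univ (fun a => (f a).cost) C fun a _ => (h a).1

/-- The rule for a counted loop with the invariant `I j` before the round `j`. -/
theorem foldlM_range {β : Type} {f : β → ℕ → Step β} {C : ℕ} (I : ℕ → β → Prop) (n : ℕ) (s : β)
    (h0 : I 0 s) (h : ∀ j s, j < n → I j s → Spec (f s j) C (I (j + 1))) :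
    Spec ((List.range n).foldlM f s) (n * C) (I n) := by
  have key : ∀ (m k : ℕ) (s : β), k + m = n → I k s →
      Spec ((List.range' k m).foldlM f s) (m * C) (I n) := by
    intro m
    induction m with
    | zero => intro k s hk hs; simp only [Nat.add_zero] at hk; subst hk; exact pure hs
    | succ m ih =>
      intro k s hk hs
      rw [List.range'_succ, List.foldlM_cons, Nat.succ_mul, Nat.add_comm (m * C)]
      exact (h k s (by omega) hs).bind fun s' hs' => ih (k + 1) s' (by omega) hs'
  rw [List.range_eq_range']
  exact key n 0 s (by omega) h0

/-- The rule for a loop that counts down, with the invariant `I j` after the round `j`. -/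
theorem foldlM_range_reverse {β : Type} {f : β → ℕ → Step β} {C : ℕ} (I : ℕ → β → Prop) (n : ℕ)
    (s : β) (h0 : I n s) (h : ∀ j s, j < n → I (j + 1) s → Spec (f s j) C (I j)) :
    Spec ((List.range n).reverse.foldlM f s) (n * C) (I 0) := by
  induction n generalizing s with
  | zero => exact pure h0
  | succ n ih =>
    rw [List.range_succ, List.reverse_append, List.reverse_singleton, List.singleton_append,
      List.foldlM_cons, Nat.succ_mul, Nat.add_comm]
    exact (h n s (by omega) h0).bind fun s' hs' => ih s' hs' fun j t hj => h j t (by omega)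

theorem foldlM_finRange {β : Type} {d : ℕ} {f : β → Fin d → Step β} {C : ℕ} (I : ℕ → β → Prop)
    (s : β) (h0 : I 0 s) (h : ∀ (j : Fin d) s, I j s → Spec (f s j) C (I (j + 1))) :
    Spec ((List.finRange d).foldlM f s) (d * C) (I d) := by
  induction d generalizing s I with
  | zero => exact pure h0
  | succ d ih =>
    rw [List.finRange_succ, List.foldlM_cons, Nat.succ_mul, Nat.add_comm (d * C)]
    refine (h 0 s h0).bind fun s' hs' => ?_
    rw [List.foldlM_map]
    exact ih (fun j => I (j + 1)) s' hs' fun j t ht => h j.succ t ht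

end Spec

/-! ### Sizes of numbers -/

theorem bits_le {z : ℤ} {t : ℕ} (h : z.natAbs ≤ 2 ^ t) : bits z ≤ t + 2 := by
  have : Nat.size z.natAbs ≤ t + 1 :=
    Nat.size_le.2 (lt_of_le_of_lt h (Nat.pow_lt_pow_right (by norm_num) (Nat.lt_succ_self t)))
  unfold bits; omega

/-- Numerator and denominator of `q` are at most `2 ^ t`. -/
def Small (t : ℕ) (q : ℚ) : Prop := q.num.natAbs ≤ 2 ^ t ∧ q.den ≤ 2 ^ t

namespace Small

variable {s t : ℕ} {a b q : ℚ}

theorem ratBits_le (h : Small t q) : ratBits q ≤ 2 * t + 4 := by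
  have h1 := bits_le h.1
  have h2 : bits (q.den : ℤ) ≤ t + 2 := bits_le (by simpa using h.2)
  unfold ratBits; omega

theorem mono (h : Small s q) (hst : s ≤ t) : Small t q :=
  ⟨h.1.trans (Nat.pow_le_pow_right (by norm_num) hst),
    h.2.trans (Nat.pow_le_pow_right (by norm_num) hst)⟩

theorem zero : Small t 0 := ⟨by simp, by simpa using Nat.one_le_two_pow⟩

/-- A fraction, not necessarily in lowest terms, with small numerator and denominator is small. -/
theorem of_div {x : ℤ} {y : ℤ} (hq : q = x / y) (hy : y ≠ 0) (hx : x.natAbs ≤ 2 ^ t)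
    (hy' : y.natAbs ≤ 2 ^ t) : Small t q := by
  have hd : (q.den : ℤ) ∣ y := by rw [hq, ← Rat.divInt_eq_div]; exact Rat.den_dvd x y
  have hn : q.num * y = x * q.den := by
    have h1 : q * y = x := by rw [hq]; field_simp
    have h2 : q * q.den = q.num := Rat.mul_den_eq_num q
    have h3 : (q.num : ℚ) * y = x * q.den := by rw [← h2, ← h1]; ring
    exact_mod_cast h3
  have hyd : q.den ≤ y.natAbs := by
    have := Int.natAbs_dvd_natAbs.2 hd
    exact Nat.le_of_dvd (Int.natAbs_pos.2 hy) (by simpa using this)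
  refine ⟨?_, hyd.trans hy'⟩
  have h4 : q.num.natAbs * y.natAbs = x.natAbs * q.den := by
    have := congrArg Int.natAbs hn
    simpa [Int.natAbs_mul] using this
  have h5 : q.num.natAbs * y.natAbs ≤ x.natAbs * y.natAbs := by
    rw [h4]; exact Nat.mul_le_mul_left _ hyd
  exact (Nat.le_of_mul_le_mul_right h5 (Int.natAbs_pos.2 hy)).trans hx

theorem intCast {z : ℤ} (h : z.natAbs ≤ 2 ^ t) : Small t (z : ℚ) :=
  ⟨by simpa using h, by simpa using Nat.one_le_two_pow⟩

theorem add (ha : Small s a) (hb : Small t b) : Small (s + t + 1) (a + b) := by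
  refine of_div (x := a.num * b.den + b.num * a.den) (y := a.den * b.den) ?_ ?_ ?_ ?_
  · conv_lhs => rw [← Rat.num_div_den a, ← Rat.num_div_den b]
    have := a.den_ne_zero; have := b.den_ne_zero
    push_cast; field_simp
  · exact mul_ne_zero (by exact_mod_cast a.den_ne_zero) (by exact_mod_cast b.den_ne_zero)
  · refine (Int.natAbs_add_le _ _).trans ?_
    rw [Int.natAbs_mul, Int.natAbs_mul, Int.natAbs_natCast, Int.natAbs_natCast, pow_succ, pow_add]
    nlinarith [Nat.mul_le_mul ha.1 hb.2, Nat.mul_le_mul hb.1 ha.2]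
  · rw [Int.natAbs_mul, Int.natAbs_natCast, Int.natAbs_natCast, pow_succ, pow_add]
    nlinarith [Nat.mul_le_mul ha.2 hb.2]

theorem neg (ha : Small s a) : Small s (-a) := ⟨by simpa using ha.1, by simpa using ha.2⟩

theorem sub (ha : Small s a) (hb : Small t b) : Small (s + t + 1) (a - b) := by
  rw [sub_eq_add_neg]; exact ha.add hb.neg

theorem mul (ha : Small s a) (hb : Small t b) : Small (s + t) (a * b) := by
  refine of_div (x := a.num * b.num) (y := a.den * b.den) ?_ ?_ ?_ ?_
  · conv_lhs => rw [← Rat.num_div_den a, ← Rat.num_div_den b]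
    have := a.den_ne_zero; have := b.den_ne_zero
    push_cast; field_simp
  · exact mul_ne_zero (by exact_mod_cast a.den_ne_zero) (by exact_mod_cast b.den_ne_zero)
  · rw [Int.natAbs_mul, pow_add]; exact Nat.mul_le_mul ha.1 hb.1
  · rw [Int.natAbs_mul, Int.natAbs_natCast, Int.natAbs_natCast, pow_add]
    exact Nat.mul_le_mul ha.2 hb.2

theorem inv (ha : Small s a) : Small s a⁻¹ := by
  rcases eq_or_ne a 0 with rfl | h
  · simpa using zero
  refine of_div (x := a.den) (y := a.num) ?_ (Rat.num_ne_zero.2 h) (by simpa using ha.2) ha.1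
  conv_lhs => rw [← Rat.num_div_den a]
  rw [inv_div]; rfl

theorem div (ha : Small s a) (hb : Small t b) : Small (s + t) (a / b) := by
  rw [div_eq_mul_inv]; exact ha.mul hb.inv

end Small

/-- The cost of a Gram-Schmidt coefficient of vectors with entries of size `t` is at most
`coeffCost d t`. -/
def coeffCost (d t : ℕ) : ℕ :=
  (2 * d + 1) * (2 * (4 * ((d + 1) * (2 * t + 1)) + 8) ^ 3)

/-- Partial sums over `Fin d`, as they arise in a loop over all indices. -/
theorem sum_ite_lt_succ {d : ℕ} {M : Type*} [AddCommMonoid M] (f : Fin d → M) (j : Fin d) :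
    ∑ a : Fin d, (if (a : ℕ) < j + 1 then f a else 0) =
      ∑ a : Fin d, (if (a : ℕ) < j then f a else 0) + f j := by
  have : ∀ a : Fin d, (if (a : ℕ) < j + 1 then f a else 0) =
      (if (a : ℕ) < j then f a else 0) + if a = j then f a else 0 := by
    intro a
    rcases lt_trichotomy (a : ℕ) j with h | h | h
    · rw [if_pos (by omega), if_pos h, if_neg (by rintro rfl; omega), add_zero]
    · rw [if_pos (by omega), if_neg (by omega), if_pos (Fin.ext h), zero_add]
    · rw [if_neg (by omega), if_neg (by omega), if_neg (by rintro rfl; omega), add_zero]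
  simp_rw [this, Finset.sum_add_distrib]
  simp

namespace Spec

theorem radd {a b : ℚ} {s t : ℕ} (ha : Small s a) (hb : Small t b) :
    Spec (radd a b) ((2 * (s + t) + 8) ^ 3) fun q => q = a + b :=
  charge (Nat.pow_le_pow_left (by have := ha.ratBits_le; have := hb.ratBits_le; omega) 3) rfl

theorem rsub {a b : ℚ} {s t : ℕ} (ha : Small s a) (hb : Small t b) :
    Spec (rsub a b) ((2 * (s + t) + 8) ^ 3) fun q => q = a - b :=
  charge (Nat.pow_le_pow_left (by have := ha.ratBits_le; have := hb.ratBits_le; omega) 3) rfl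

theorem rmul {a b : ℚ} {s t : ℕ} (ha : Small s a) (hb : Small t b) :
    Spec (rmul a b) ((2 * (s + t) + 8) ^ 3) fun q => q = a * b :=
  charge (Nat.pow_le_pow_left (by have := ha.ratBits_le; have := hb.ratBits_le; omega) 3) rfl

theorem rdiv {a b : ℚ} {s t : ℕ} (ha : Small s a) (hb : Small t b) :
    Spec (rdiv a b) ((2 * (s + t) + 8) ^ 3) fun q => q = a / b :=
  charge (Nat.pow_le_pow_left (by have := ha.ratBits_le; have := hb.ratBits_le; omega) 3) rfl

theorem rle {a b : ℚ} {s t : ℕ} (ha : Small s a) (hb : Small t b) :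
    Spec (rle a b) ((2 * (s + t) + 8) ^ 3) fun q => q = decide (a ≤ b) :=
  charge (Nat.pow_le_pow_left (by have := ha.ratBits_le; have := hb.ratBits_le; omega) 3) rfl

theorem rround {a : ℚ} {s : ℕ} (ha : Small s a) :
    Spec (rround a) ((2 * s + 4) ^ 3) fun q => q = round a :=
  charge (Nat.pow_le_pow_left ha.ratBits_le 3) rfl

theorem iadd {a b : ℤ} {s t : ℕ} (ha : a.natAbs ≤ 2 ^ s) (hb : b.natAbs ≤ 2 ^ t) :
    Spec (iadd a b) ((s + t + 4) ^ 3) fun q => q = a + b :=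
  charge (Nat.pow_le_pow_left (by have := bits_le ha; have := bits_le hb; omega) 3) rfl

theorem isub {a b : ℤ} {s t : ℕ} (ha : a.natAbs ≤ 2 ^ s) (hb : b.natAbs ≤ 2 ^ t) :
    Spec (isub a b) ((s + t + 4) ^ 3) fun q => q = a - b :=
  charge (Nat.pow_le_pow_left (by have := bits_le ha; have := bits_le hb; omega) 3) rfl

theorem imul {a b : ℤ} {s t : ℕ} (ha : a.natAbs ≤ 2 ^ s) (hb : b.natAbs ≤ 2 ^ t) :
    Spec (imul a b) ((s + t + 4) ^ 3) fun q => q = a * b :=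
  charge (Nat.pow_le_pow_left (by have := bits_le ha; have := bits_le hb; omega) 3) rfl

theorem idiv {a b : ℤ} {s t : ℕ} (ha : a.natAbs ≤ 2 ^ s) (hb : b.natAbs ≤ 2 ^ t) :
    Spec (idiv a b) ((s + t + 4) ^ 3) fun q => q = a / b :=
  charge (Nat.pow_le_pow_left (by have := bits_le ha; have := bits_le hb; omega) 3) rfl

/-- Inner products of vectors with entries of size `s` and `t`. All partial sums have size at most
`d * (s + t + 1)`. -/
theorem dot {d s t : ℕ} {u v : Fin d → ℚ} (hu : ∀ a, Small s (u a)) (hv : ∀ a, Small t (v a)) :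
    Spec (dot u v) (d * (2 * (2 * ((d + 1) * (s + t + 1)) + 8) ^ 3))
      fun q => q = u ⬝ᵥ v ∧ Small (d * (s + t + 1)) q := by
  have key := foldlM_finRange (d := d)
    (f := fun s a => do LatticeRegression.radd s (← LatticeRegression.rmul (u a) (v a)))
    (C := 2 * (2 * ((d + 1) * (s + t + 1)) + 8) ^ 3)
    (fun j q => q = ∑ a : Fin d, (if (a : ℕ) < j then u a * v a else 0) ∧ Small (j * (s + t + 1)) q)
    0 ⟨by simp, Small.zero⟩ ?_
  · refine key.mono le_rfl fun q hq => ⟨?_, hq.2⟩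
    rw [hq.1, dotProduct]
    exact Finset.sum_congr rfl fun a _ => if_pos a.2
  · rintro j q ⟨hq, hs⟩
    have hm := (hu j).mul (hv j)
    have hj : (j : ℕ) ≤ d := j.2.le
    rw [two_mul]
    refine ((rmul (hu j) (hv j)).mono (Nat.pow_le_pow_left (by nlinarith) 3) fun _ h => h).bind ?_
    rintro _ rfl
    refine (radd hs hm).mono (Nat.pow_le_pow_left (by nlinarith) 3) ?_
    rintro _ rfl
    refine ⟨?_, (hs.add hm).mono (by rw [Nat.succ_mul]; omega)⟩
    rw [hq]
    exact (sum_ite_lt_succ _ j).symm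

theorem coeff {d t : ℕ} {v w : Fin d → ℚ} (hv : ∀ a, Small t (v a)) (hw : ∀ a, Small t (w a)) :
    Spec (coeff v w) (coeffCost d t)
      fun q => q = v ⬝ᵥ w / w ⬝ᵥ w ∧ Small (2 * d * (2 * t + 1)) q := by
  have e : t + t + 1 = 2 * t + 1 := by ring
  have hC : 2 * (2 * ((d + 1) * (2 * t + 1)) + 8) ^ 3 ≤ 2 * (4 * ((d + 1) * (2 * t + 1)) + 8) ^ 3 :=
    Nat.mul_le_mul_left _ (Nat.pow_le_pow_left (by omega) 3)
  have h1 := dot hv hw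
  have h2 := dot hw hw
  rw [e] at h1 h2
  have hc : coeffCost d t = d * (2 * (4 * ((d + 1) * (2 * t + 1)) + 8) ^ 3) +
      (d * (2 * (4 * ((d + 1) * (2 * t + 1)) + 8) ^ 3) +
        2 * (4 * ((d + 1) * (2 * t + 1)) + 8) ^ 3) := by
    unfold coeffCost; ring
  rw [hc]
  refine (h1.mono (Nat.mul_le_mul_left _ hC) fun _ h => h).bind ?_
  rintro _ ⟨rfl, s1⟩
  refine (h2.mono (Nat.mul_le_mul_left _ hC) fun _ h => h).bind ?_
  rintro _ ⟨rfl, s2⟩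
  refine (rdiv s1 s2).mono ?_ ?_
  · refine le_trans (Nat.pow_le_pow_left ?_ 3) (Nat.le_mul_of_pos_left _ (by norm_num))
    nlinarith
  · rintro _ rfl
    exact ⟨rfl, (s1.div s2).mono (by ring_nf; omega)⟩

end Spec

end LatticeRegression

namespace LatticeRegression

/-! ### Gram-Schmidt orthogonalisation over the rationals -/

section GramSchmidt

open Finset

variable {d : ℕ}

/-- The Gram-Schmidt orthogonalisation (without normalisation) of a sequence of vectors. -/
noncomputable def gs (b : ℕ → Fin d → ℚ) (i : ℕ) : Fin d → ℚ :=
  b i - ∑ j : Fin i, (b i ⬝ᵥ gs b j / gs b j ⬝ᵥ gs b j) • gs b j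
termination_by i
decreasing_by exact j.2

/-- The Gram-Schmidt coefficients. -/
noncomputable def mu (b : ℕ → Fin d → ℚ) (i j : ℕ) : ℚ := b i ⬝ᵥ gs b j / gs b j ⬝ᵥ gs b j

/-- The projection of `b i` orthogonally to the first `j` Gram-Schmidt vectors. -/
noncomputable def proj (b : ℕ → Fin d → ℚ) (i j : ℕ) : Fin d → ℚ :=
  b i - ∑ l ∈ range j, mu b i l • gs b l

theorem gs_eq_proj (b : ℕ → Fin d → ℚ) (i : ℕ) : gs b i = proj b i i := by
  rw [gs, proj, Finset.sum_range]; rfl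

theorem dotProduct_self_nonneg' (v : Fin d → ℚ) : 0 ≤ v ⬝ᵥ v :=
  Finset.sum_nonneg fun a _ => mul_self_nonneg (v a)

theorem mu_mul (b : ℕ → Fin d → ℚ) (i j : ℕ) :
    mu b i j * (gs b j ⬝ᵥ gs b j) = b i ⬝ᵥ gs b j := by
  rcases eq_or_ne (gs b j ⬝ᵥ gs b j) 0 with h | h
  · rw [h, mul_zero, dotProduct_self_eq_zero.1 h, dotProduct_zero]
  · exact div_mul_cancel₀ _ h

theorem gs_orth_of_lt (b : ℕ → Fin d → ℚ) {i j : ℕ} (h : j < i) : gs b i ⬝ᵥ gs b j = 0 := by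
  induction i using Nat.strong_induction_on generalizing j with
  | _ i ih =>
    rw [gs_eq_proj b i, proj, sub_dotProduct, sum_dotProduct, Finset.sum_eq_single_of_mem j]
    · rw [smul_dotProduct, smul_eq_mul, mu_mul, sub_self]
    · exact mem_range.2 h
    · intro l hl hlj
      have hl := mem_range.1 hl
      rw [smul_dotProduct, smul_eq_mul]
      rcases lt_or_gt_of_ne hlj with h' | h'
      · rw [dotProduct_comm, ih j h h', mul_zero]
      · rw [ih l hl h', mul_zero]

theorem gs_orth (b : ℕ → Fin d → ℚ) {i j : ℕ} (h : i ≠ j) : gs b i ⬝ᵥ gs b j = 0 := by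
  rcases lt_or_gt_of_ne h with h | h
  · rw [dotProduct_comm]; exact gs_orth_of_lt b h
  · exact gs_orth_of_lt b h

theorem proj_dotProduct_of_lt (b : ℕ → Fin d → ℚ) {i j l : ℕ} (h : l < j) :
    proj b i j ⬝ᵥ gs b l = 0 := by
  rw [proj, sub_dotProduct, sum_dotProduct, Finset.sum_eq_single_of_mem l (mem_range.2 h)]
  · rw [smul_dotProduct, smul_eq_mul, mu_mul, sub_self]
  · intro l' _ hl
    rw [smul_dotProduct, gs_orth b hl, smul_zero]

theorem proj_dotProduct_of_le (b : ℕ → Fin d → ℚ) {i j l : ℕ} (h : j ≤ l) :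
    proj b i j ⬝ᵥ gs b l = b i ⬝ᵥ gs b l := by
  rw [proj, sub_dotProduct, sum_dotProduct, Finset.sum_eq_zero, sub_zero]
  intro l' hl
  have := mem_range.1 hl
  rw [smul_dotProduct, gs_orth b (by omega), smul_zero]

theorem proj_zero (b : ℕ → Fin d → ℚ) (i : ℕ) : proj b i 0 = b i := by simp [proj]

theorem proj_succ (b : ℕ → Fin d → ℚ) (i j : ℕ) :
    proj b i (j + 1) = proj b i j - (proj b i j ⬝ᵥ gs b j / gs b j ⬝ᵥ gs b j) • gs b j := by
  rw [proj_dotProduct_of_le b le_rfl, proj, sum_range_succ, ← sub_sub]; rfl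

/-- The intermediate vectors of the orthogonalisation do not grow. -/
theorem proj_norm_le (b : ℕ → Fin d → ℚ) (i j : ℕ) : proj b i j ⬝ᵥ proj b i j ≤ b i ⬝ᵥ b i := by
  induction j with
  | zero => rw [proj_zero]
  | succ j ih =>
    refine le_trans ?_ ih
    have h0 := proj_dotProduct_of_lt b (i := i) (Nat.lt_succ_self j)
    have h1 : proj b i j = proj b i (j + 1) +
        (proj b i j ⬝ᵥ gs b j / gs b j ⬝ᵥ gs b j) • gs b j := by
      rw [proj_succ]; simp
    set r := proj b i j ⬝ᵥ gs b j / gs b j ⬝ᵥ gs b j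
    rw [h1]
    simp only [add_dotProduct, dotProduct_add, smul_dotProduct, dotProduct_smul, smul_eq_mul,
      dotProduct_comm (gs b j) (proj b i _), h0]
    have := mul_nonneg (mul_self_nonneg r) (dotProduct_self_nonneg' (gs b j))
    nlinarith

theorem gs_norm_le (b : ℕ → Fin d → ℚ) (i : ℕ) : gs b i ⬝ᵥ gs b i ≤ b i ⬝ᵥ b i := by
  rw [gs_eq_proj]; exact proj_norm_le b i i

theorem dotProduct_gs_self (b : ℕ → Fin d → ℚ) (i : ℕ) :
    b i ⬝ᵥ gs b i = gs b i ⬝ᵥ gs b i := by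
  nth_rewrite 2 [gs_eq_proj]
  rw [proj_dotProduct_of_le b le_rfl]

theorem eq_gs_add (b : ℕ → Fin d → ℚ) (i : ℕ) :
    b i = gs b i + ∑ l ∈ range i, mu b i l • gs b l := by
  rw [gs_eq_proj, proj]; simp

theorem dotProduct_gs_of_lt (b : ℕ → Fin d → ℚ) {i j : ℕ} (h : i < j) : b i ⬝ᵥ gs b j = 0 := by
  rw [eq_gs_add b i, add_dotProduct, gs_orth b h.ne, zero_add, sum_dotProduct]
  refine sum_eq_zero fun l hl => ?_
  have := mem_range.1 hl
  rw [smul_dotProduct, gs_orth b (by omega), smul_zero]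

/-- A vector of the form of a size-reduced basis vector is short. -/
theorem norm_add_sum_le (b : ℕ → Fin d → ℚ) (i : ℕ) (c : ℕ → ℚ) {G : ℚ}
    (hG : ∀ l ≤ i, gs b l ⬝ᵥ gs b l ≤ G) (hc : ∀ l < i, |c l| ≤ 1 / 2) :
    (gs b i + ∑ l ∈ range i, c l • gs b l) ⬝ᵥ (gs b i + ∑ l ∈ range i, c l • gs b l)
      ≤ (i + 1) * G := by
  have hG0 : 0 ≤ G := (dotProduct_self_nonneg' _).trans (hG i le_rfl)
  have key : ∀ m ≤ i, (gs b i + ∑ l ∈ range m, c l • gs b l) ⬝ᵥ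
      (gs b i + ∑ l ∈ range m, c l • gs b l) ≤ (m + 1) * G := by
    intro m
    induction m with
    | zero => intro _; simpa using hG i le_rfl
    | succ m ih =>
      intro hm
      have h1 := ih (by omega)
      rw [sum_range_succ, ← add_assoc]
      set x := gs b i + ∑ l ∈ range m, c l • gs b l with hx
      have h0 : x ⬝ᵥ gs b m = 0 := by
        rw [hx, add_dotProduct, gs_orth b (by omega), zero_add, sum_dotProduct]
        refine sum_eq_zero fun l hl => ?_
        have := mem_range.1 hl
        rw [smul_dotProduct, gs_orth b (by omega), smul_zero]
      simp only [add_dotProduct, dotProduct_add, smul_dotProduct, dotProduct_smul, smul_eq_mul,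
        dotProduct_comm (gs b m) x, h0]
      have h2 := hG m (by omega)
      have h3 := dotProduct_self_nonneg' (gs b m)
      have h4 := hc m (by omega)
      have h5 : c m * c m ≤ 1 := by
        rw [← abs_mul_abs_self]; nlinarith [abs_nonneg (c m)]
      push_cast
      nlinarith [mul_self_nonneg (c m)]
  exact key i le_rfl

theorem eq_zero_of_mem_span_of_orth {T : Set (Fin d → ℚ)} {x : Fin d → ℚ}
    (hx : x ∈ Submodule.span ℚ T) (h : ∀ t ∈ T, x ⬝ᵥ t = 0) : x = 0 := by
  have : ∀ y ∈ Submodule.span ℚ T, x ⬝ᵥ y = 0 := by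
    intro y hy
    induction hy using Submodule.span_induction with
    | mem y hy => exact h y hy
    | zero => simp
    | add y z _ _ hy hz => rw [dotProduct_add, hy, hz, add_zero]
    | smul a y _ hy => rw [dotProduct_smul, hy, smul_zero]
  exact dotProduct_self_eq_zero.1 (this x hx)

theorem sub_gs_mem_span (b : ℕ → Fin d → ℚ) (i : ℕ) :
    b i - gs b i ∈ Submodule.span ℚ (gs b '' Set.Iio i) := by
  have : b i - gs b i = ∑ l ∈ range i, mu b i l • gs b l := by
    nth_rewrite 1 [eq_gs_add b i]; simp
  rw [this]
  exact Submodule.sum_mem _ fun l hl => Submodule.smul_mem _ _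
    (Submodule.subset_span ⟨l, mem_range.1 hl, rfl⟩)

theorem mem_span_gs (b : ℕ → Fin d → ℚ) {i j : ℕ} (h : i < j) :
    b i ∈ Submodule.span ℚ (gs b '' Set.Iio j) := by
  rw [← sub_add_cancel (b i) (gs b i)]
  exact Submodule.add_mem _
    (Submodule.span_mono (Set.image_mono (Set.Iio_subset_Iio h.le)) (sub_gs_mem_span b i))
    (Submodule.subset_span ⟨i, h, rfl⟩)

/-- Gram-Schmidt vectors are characterised by orthogonality and triangularity. -/
theorem gs_unique {b s : ℕ → Fin d → ℚ} (hs : ∀ i j, j < i → s i ⬝ᵥ s j = 0)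
    (hb : ∀ i, b i - s i ∈ Submodule.span ℚ (s '' Set.Iio i)) : gs b = s := by
  funext i
  induction i using Nat.strong_induction_on with
  | _ i ih =>
    have him : gs b '' Set.Iio i = s '' Set.Iio i := Set.image_congr fun j hj => ih j hj
    rw [← sub_eq_zero]
    refine eq_zero_of_mem_span_of_orth (T := s '' Set.Iio i) ?_ ?_
    · have h1 := sub_gs_mem_span b i
      rw [him] at h1
      have h2 := Submodule.sub_mem _ (hb i) h1
      rwa [sub_sub_sub_cancel_left] at h2
    · rintro _ ⟨j, hj, rfl⟩
      rw [sub_dotProduct, hs i j hj, sub_zero, ← ih j hj]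
      exact gs_orth_of_lt b hj

theorem gs_mem_span (b : ℕ → Fin d → ℚ) {i j : ℕ} (h : i < j) :
    gs b i ∈ Submodule.span ℚ (b '' Set.Iio j) := by
  induction i using Nat.strong_induction_on with
  | _ i ih =>
    rw [gs_eq_proj, proj]
    refine Submodule.sub_mem _ (Submodule.subset_span ⟨i, h, rfl⟩) (Submodule.sum_mem _ ?_)
    intro l hl
    have := mem_range.1 hl
    exact Submodule.smul_mem _ _ (ih l this (this.trans h))

/-- Adding to `b i` a combination of the previous vectors does not change the orthogonalisation. -/
theorem gs_update (b : ℕ → Fin d → ℚ) (i : ℕ) (v : Fin d → ℚ)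
    (hv : v - b i ∈ Submodule.span ℚ (b '' Set.Iio i)) : gs (Function.update b i v) = gs b := by
  refine gs_unique (fun i j h => gs_orth_of_lt b h) fun l => ?_
  rcases eq_or_ne l i with rfl | h
  · rw [Function.update_self, ← sub_add_sub_cancel v (b l)]
    refine Submodule.add_mem _ ?_ (sub_gs_mem_span b l)
    refine (Submodule.span_le.2 ?_) hv
    rintro _ ⟨j, hj, rfl⟩
    exact mem_span_gs b hj
  · rw [Function.update_of_ne h]
    exact sub_gs_mem_span b l

/-- A vector of the lattice is at least as long as the shortest Gram-Schmidt vector. -/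
theorem exists_gs_norm_le (b : ℕ → Fin d → ℚ) (k : ℕ) (c : ℕ → ℤ)
    (hc : ∑ l ∈ range k, (c l : ℚ) • b l ≠ 0) :
    ∃ l < k, gs b l ⬝ᵥ gs b l ≤
      (∑ l ∈ range k, (c l : ℚ) • b l) ⬝ᵥ (∑ l ∈ range k, (c l : ℚ) • b l) := by
  induction k with
  | zero => simp at hc
  | succ k ih =>
    rcases eq_or_ne (c k) 0 with h | h
    · rw [sum_range_succ, h] at hc ⊢
      simp only [Int.cast_zero, zero_smul, add_zero] at hc ⊢
      obtain ⟨l, hl, h⟩ := ih hc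
      exact ⟨l, hl.trans (Nat.lt_succ_self k), h⟩
    · refine ⟨k, Nat.lt_succ_self k, ?_⟩
      set x := ∑ l ∈ range (k + 1), (c l : ℚ) • b l with hx
      have h1 : x ⬝ᵥ gs b k = c k * (gs b k ⬝ᵥ gs b k) := by
        rw [hx, sum_range_succ, add_dotProduct, sum_dotProduct, Finset.sum_eq_zero, zero_add,
          smul_dotProduct, dotProduct_gs_self, smul_eq_mul]
        intro l hl
        rw [smul_dotProduct, dotProduct_gs_of_lt b (mem_range.1 hl), smul_zero]
      have h2 : (x ⬝ᵥ gs b k) ^ 2 ≤ (x ⬝ᵥ x) * (gs b k ⬝ᵥ gs b k) := by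
        have := Finset.sum_mul_sq_le_sq_mul_sq univ x (gs b k)
        simpa [dotProduct, sq] using this
      have h3 : (1 : ℚ) ≤ (c k : ℚ) ^ 2 := by
        have : 0 < (c k) ^ 2 := by positivity
        exact_mod_cast this
      rw [h1] at h2
      have h4 := dotProduct_self_nonneg' (gs b k)
      rcases h4.eq_or_lt with h5 | h5
      · rw [← h5]; exact dotProduct_self_nonneg' x
      · refine le_of_mul_le_mul_right ?_ h5
        nlinarith [mul_self_nonneg (gs b k ⬝ᵥ gs b k)]

/-! ### Gram determinants -/

/-- The matrix of the first `j` vectors. -/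
def rows {R : Type*} (b : ℕ → Fin d → R) (j : ℕ) : Matrix (Fin j) (Fin d) R := fun l => b l

/-- The determinant of the Gram matrix of the first `j` vectors. -/
def gramDet {R : Type*} [CommRing R] (b : ℕ → Fin d → R) (j : ℕ) : R :=
  (rows b j * (rows b j).transpose).det

/-- The lower unitriangular matrix of Gram-Schmidt coefficients. -/
noncomputable def muMatrix (b : ℕ → Fin d → ℚ) (j : ℕ) : Matrix (Fin j) (Fin j) ℚ :=
  fun l l' => if l' < l then mu b l l' else if l' = l then 1 else 0

theorem muMatrix_mul (b : ℕ → Fin d → ℚ) (j : ℕ) : muMatrix b j * rows (gs b) j = rows b j := by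
  ext l a
  rw [Matrix.mul_apply]
  have h1 : ∀ x : Fin j, muMatrix b j l x * rows (gs b) j x a =
      (if (x : ℕ) < l then mu b l x * gs b x a else 0) + if x = l then gs b x a else 0 := by
    intro x
    unfold muMatrix rows
    rcases lt_trichotomy x l with h | h | h
    · have h' : (x : ℕ) < l := h
      simp [h, h', h.ne]
    · simp [h]
    · have h' : ¬ (x : ℕ) < l := not_lt.2 (le_of_lt h)
      simp [h.not_gt, h', h.ne']
  rw [Finset.sum_congr rfl fun x _ => h1 x, Finset.sum_add_distrib, Finset.sum_ite_eq' univ l]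
  simp only [mem_univ, if_true]
  change _ = b l a
  rw [eq_gs_add b l, Pi.add_apply, Finset.sum_apply, add_comm]
  congr 1
  rw [Finset.sum_fin_eq_sum_range, ← Finset.sum_subset (s₁ := range l) (s₂ := range j)]
  · refine Finset.sum_congr rfl fun x hx => ?_
    have := mem_range.1 hx
    rw [dif_pos (this.trans l.2), if_pos this]; rfl
  · exact range_subset_range.2 l.2.le
  · intro x hx hx'
    have h1 := mem_range.1 hx
    rw [dif_pos h1, if_neg (fun h => hx' (mem_range.2 h))]

theorem det_muMatrix (b : ℕ → Fin d → ℚ) (j : ℕ) : (muMatrix b j).det = 1 := by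
  rw [Matrix.det_of_isLowerTriangular]
  · exact Finset.prod_eq_one fun l _ => by simp [muMatrix]
  · intro l l' h
    have h : l < l' := h
    simp [muMatrix, h.not_gt, h.ne']

theorem rows_gs_mul_transpose (b : ℕ → Fin d → ℚ) (j : ℕ) :
    rows (gs b) j * (rows (gs b) j).transpose =
      Matrix.diagonal fun l : Fin j => gs b l ⬝ᵥ gs b l := by
  ext l l'
  rw [Matrix.mul_apply', Matrix.diagonal_apply]
  split_ifs with h
  · subst h; rfl
  · exact gs_orth b fun h' => h (Fin.ext h')

/-- The Gram matrix of the vectors is the Gram matrix of their orthogonalisation, transformed by a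
unitriangular matrix. -/
theorem gramDet_eq_prod (b : ℕ → Fin d → ℚ) (j : ℕ) :
    gramDet b j = ∏ l ∈ range j, gs b l ⬝ᵥ gs b l := by
  rw [gramDet, ← muMatrix_mul, Matrix.transpose_mul, Matrix.mul_assoc,
    ← Matrix.mul_assoc (rows (gs b) j), rows_gs_mul_transpose, Matrix.det_mul, Matrix.det_mul,
    Matrix.det_transpose, det_muMatrix, Matrix.det_diagonal, one_mul, mul_one,
    Finset.prod_range]

/-- By Cramer's rule the Gram determinant is a common denominator of the orthogonal projection. -/
theorem gramDet_smul_proj (b : ℕ → Fin d → ℚ) (i j : ℕ) :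
    gramDet b j • proj b i j = gramDet b j • b i -
      Matrix.vecMul (Matrix.mulVec ((rows b j * (rows b j).transpose).adjugate)
        (Matrix.mulVec (rows b j) (b i))) (rows b j) := by
  have hU : IsUnit (muMatrix b j).det := by rw [det_muMatrix]; exact isUnit_one
  set B := rows b j with hB
  set S := rows (gs b) j with hS
  set x := Matrix.vecMul (fun l : Fin j => mu b i l) (muMatrix b j)⁻¹ with hx
  have hSB : S = (muMatrix b j)⁻¹ * B := by
    rw [hB, ← muMatrix_mul, ← Matrix.mul_assoc, Matrix.nonsing_inv_mul _ hU, Matrix.one_mul]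
  have hp : proj b i j = b i - Matrix.vecMul x B := by
    rw [hx, Matrix.vecMul_vecMul, ← hSB, proj, Finset.sum_range]
    congr 1
    ext a
    simp [Matrix.vecMul, dotProduct, hS, rows]
  have h0 : Matrix.mulVec B (proj b i j) = 0 := by
    rw [hB, ← muMatrix_mul, ← Matrix.mulVec_mulVec]
    have : Matrix.mulVec (rows (gs b) j) (proj b i j) = 0 := by
      ext l
      change gs b l ⬝ᵥ proj b i j = 0
      rw [dotProduct_comm]
      exact proj_dotProduct_of_lt b l.2
    rw [this, Matrix.mulVec_zero]
  have h1 : Matrix.mulVec B (b i) = Matrix.mulVec (B * B.transpose) x := by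
    rw [hp, Matrix.mulVec_sub, sub_eq_zero] at h0
    rw [h0, ← Matrix.mulVec_mulVec, Matrix.mulVec_transpose]
  have h2 : Matrix.mulVec (B * B.transpose).adjugate (Matrix.mulVec B (b i)) = gramDet b j • x := by
    rw [h1, Matrix.mulVec_mulVec, Matrix.adjugate_mul, Matrix.smul_mulVec, Matrix.one_mulVec]
    rfl
  rw [h2, Matrix.smul_vecMul, hp, smul_sub]

/-- The rational vectors of an integral basis. -/
def toRat (b : ℕ → Fin d → ℤ) : ℕ → Fin d → ℚ := fun i a => b i a

theorem gramDet_toRat (b : ℕ → Fin d → ℤ) (j : ℕ) : gramDet (toRat b) j = ((gramDet b j : ℤ) : ℚ) := by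
  have h : rows (toRat b) j = (rows b j).map (Int.castRingHom ℚ) := rfl
  rw [gramDet, gramDet, h, ← Matrix.transpose_map, ← Matrix.map_mul]
  exact (RingHom.map_det (Int.castRingHom ℚ) _).symm

/-- For an integral basis the Gram determinant is a common denominator of the entries of the
projections. This keeps the rational numbers in the orthogonalisation small. -/
theorem exists_int_gramDet_mul_proj (b : ℕ → Fin d → ℤ) (i j : ℕ) (a : Fin d) :
    ∃ z : ℤ, ((gramDet b j : ℤ) : ℚ) * proj (toRat b) i j a = z := by
  have h := congrFun (gramDet_smul_proj (toRat b) i j) a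
  rw [gramDet_toRat, Pi.smul_apply, smul_eq_mul] at h
  have e : rows (toRat b) j = (rows b j).map (Int.castRingHom ℚ) := rfl
  have e2 : toRat b i = (Int.castRingHom ℚ) ∘ (b i) := rfl
  refine ⟨(gramDet b j • b i -
      Matrix.vecMul (Matrix.mulVec ((rows b j * (rows b j).transpose).adjugate)
        (Matrix.mulVec (rows b j) (b i))) (rows b j)) a, ?_⟩
  rw [h, e, e2, ← Matrix.transpose_map, ← Matrix.map_mul, ← RingHom.mapMatrix_apply,
    ← RingHom.map_adjugate, RingHom.mapMatrix_apply]
  have e3 : Matrix.mulVec ((rows b j).map (Int.castRingHom ℚ)) ((Int.castRingHom ℚ) ∘ (b i)) =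
      (Int.castRingHom ℚ) ∘ (Matrix.mulVec (rows b j) (b i)) := by
    ext l; exact (RingHom.map_mulVec (Int.castRingHom ℚ) (rows b j) (b i) l).symm
  rw [e3]
  have e4 : Matrix.mulVec ((rows b j * (rows b j).transpose).adjugate.map (Int.castRingHom ℚ))
      ((Int.castRingHom ℚ) ∘ (Matrix.mulVec (rows b j) (b i))) =
      (Int.castRingHom ℚ) ∘ (Matrix.mulVec (rows b j * (rows b j).transpose).adjugate
        (Matrix.mulVec (rows b j) (b i))) := by
    ext l; exact (RingHom.map_mulVec (Int.castRingHom ℚ) _ _ l).symm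
  rw [e4]
  have e5 := RingHom.map_vecMul (Int.castRingHom ℚ) (rows b j)
    (Matrix.mulVec (rows b j * (rows b j).transpose).adjugate (Matrix.mulVec (rows b j) (b i))) a
  rw [Pi.sub_apply, ← e5]
  simp

end GramSchmidt

end LatticeRegression

namespace LatticeRegression

/-! ### The invariant and the potential of the LLL algorithm -/

section LLLInvariant

open Finset

variable {d : ℕ}

/-- The squared length of a Gram-Schmidt vector. -/
noncomputable def gsSq (b : ℕ → Fin d → ℚ) (l : ℕ) : ℚ := gs b l ⬝ᵥ gs b l

/-- Swapping neighbours changes only two Gram-Schmidt vectors: the first becomes the projection of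
`b (j + 1)` orthogonally to the vectors before `b j`, the second the component of the old `gs b j`
orthogonal to it. The condition `hz` says that this projection is not zero. -/
theorem gs_swap (b : ℕ → Fin d → ℚ) (j : ℕ)
    (hz : gsSq b (j + 1) + mu b (j + 1) j ^ 2 * gsSq b j ≠ 0) :
    gs (fun l => b (Equiv.swap j (j + 1) l)) =
      Function.update (Function.update (gs b) j (gs b (j + 1) + mu b (j + 1) j • gs b j)) (j + 1)
        (gs b j - (mu b (j + 1) j * gsSq b j / (gsSq b (j + 1) + mu b (j + 1) j ^ 2 * gsSq b j)) •
          (gs b (j + 1) + mu b (j + 1) j • gs b j)) := by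
  set m := mu b (j + 1) j with hm
  set z := gsSq b (j + 1) + m ^ 2 * gsSq b j with hzd
  set u := gs b (j + 1) + m • gs b j with hu
  set w := gs b j - (m * gsSq b j / z) • u with hw
  set s := Function.update (Function.update (gs b) j u) (j + 1) w with hs
  have hsj : s j = u := by
    rw [hs, Function.update_of_ne (by omega), Function.update_self]
  have hsj1 : s (j + 1) = w := by rw [hs, Function.update_self]
  have hso : ∀ l, l ≠ j → l ≠ j + 1 → s l = gs b l := fun l h1 h2 => by
    rw [hs, Function.update_of_ne h2, Function.update_of_ne h1]
  have ho1 : gs b (j + 1) ⬝ᵥ gs b j = 0 := gs_orth b (by omega)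
  have ho2 : gs b j ⬝ᵥ gs b (j + 1) = 0 := gs_orth b (by omega)
  have huo : ∀ l, l ≠ j → l ≠ j + 1 → u ⬝ᵥ gs b l = 0 := fun l h1 h2 => by
    rw [hu, add_dotProduct, smul_dotProduct, gs_orth b h2.symm, gs_orth b h1.symm]; simp
  have hwo : ∀ l, l ≠ j → l ≠ j + 1 → w ⬝ᵥ gs b l = 0 := fun l h1 h2 => by
    rw [hw, sub_dotProduct, smul_dotProduct, huo l h1 h2, gs_orth b h1.symm]; simp
  have huu : u ⬝ᵥ u = z := by
    rw [hu]
    simp only [add_dotProduct, dotProduct_add, smul_dotProduct, dotProduct_smul, smul_eq_mul, ho1,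
      ho2, hzd, gsSq]
    ring
  have hju : gs b j ⬝ᵥ u = m * gsSq b j := by
    rw [hu, dotProduct_add, dotProduct_smul, ho2, gsSq]; simp
  have hwu : w ⬝ᵥ u = 0 := by
    rw [hw, sub_dotProduct, smul_dotProduct, huu, hju, smul_eq_mul, div_mul_cancel₀ _ hz, sub_self]
  have hmem : ∀ i, j + 1 < i → ∀ l < i, gs b l ∈ Submodule.span ℚ (s '' Set.Iio i) := by
    intro i hi l hl
    have mj : u ∈ Submodule.span ℚ (s '' Set.Iio i) :=
      Submodule.subset_span ⟨j, Set.mem_Iio.2 (by omega), hsj⟩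
    have mj1 : w ∈ Submodule.span ℚ (s '' Set.Iio i) := Submodule.subset_span ⟨j + 1, hi, hsj1⟩
    have mg : gs b j ∈ Submodule.span ℚ (s '' Set.Iio i) := by
      have : gs b j = w + (m * gsSq b j / z) • u := by rw [hw]; simp
      rw [this]
      exact Submodule.add_mem _ mj1 (Submodule.smul_mem _ _ mj)
    by_cases h1 : l = j
    · rw [h1]; exact mg
    by_cases h2 : l = j + 1
    · have : gs b (j + 1) = u - m • gs b j := by rw [hu]; simp
      rw [h2, this]
      exact Submodule.sub_mem _ mj (Submodule.smul_mem _ _ mg)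
    · exact Submodule.subset_span ⟨l, hl, hso l h1 h2⟩
  have hlow : ∀ i ≤ j, s '' Set.Iio i = gs b '' Set.Iio i := fun i hi =>
    Set.image_congr fun l hl => by
      have : l < i := hl
      exact hso l (by omega) (by omega)
  refine gs_unique ?_ ?_
  · intro i l hl
    by_cases hi1 : i = j
    · subst hi1
      rw [hsj, hso l (by omega) (by omega)]
      exact huo l (by omega) (by omega)
    by_cases hi2 : i = j + 1
    · subst hi2
      rw [hsj1]
      by_cases hl1 : l = j
      · rw [hl1, hsj, hwu]
      · rw [hso l hl1 (by omega)]
        exact hwo l hl1 (by omega)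
    · rw [hso i hi1 hi2]
      by_cases hl1 : l = j
      · rw [hl1, hsj, dotProduct_comm]; exact huo i hi1 hi2
      by_cases hl2 : l = j + 1
      · rw [hl2, hsj1, dotProduct_comm]; exact hwo i hi1 hi2
      · rw [hso l hl1 hl2]; exact gs_orth b (by omega)
  · intro i
    by_cases hi1 : i = j
    · subst hi1
      simp only [Equiv.swap_apply_left]
      rw [hsj, hlow i le_rfl, eq_gs_add b (i + 1), sum_range_succ, hu, ← hm]
      have : gs b (i + 1) + (∑ l ∈ range i, mu b (i + 1) l • gs b l + m • gs b i) -
          (gs b (i + 1) + m • gs b i) = ∑ l ∈ range i, mu b (i + 1) l • gs b l := by abel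
      rw [this]
      exact Submodule.sum_mem _ fun l hl => Submodule.smul_mem _ _
        (Submodule.subset_span ⟨l, mem_range.1 hl, rfl⟩)
    by_cases hi2 : i = j + 1
    · subst hi2
      simp only [Equiv.swap_apply_right]
      have : b j - w = (b j - gs b j) + (m * gsSq b j / z) • u := by rw [hw]; abel
      rw [hsj1, this]
      refine Submodule.add_mem _ ?_ (Submodule.smul_mem _ _
        (Submodule.subset_span ⟨j, Set.mem_Iio.2 (by omega), hsj⟩))
      have h := sub_gs_mem_span b j
      rw [← hlow j le_rfl] at h
      exact Submodule.span_mono (Set.image_mono (Set.Iio_subset_Iio (by omega))) h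
    · simp only [Equiv.swap_apply_of_ne_of_ne hi1 hi2]
      rw [hso i hi1 hi2]
      by_cases hi3 : i < j
      · rw [hlow i hi3.le]; exact sub_gs_mem_span b i
      · refine Submodule.span_le.2 ?_ (sub_gs_mem_span b i)
        rintro _ ⟨l, hl, rfl⟩
        exact hmem i (by omega) l hl

/-- The lengths of the Gram-Schmidt vectors after a swap. -/
theorem gsSq_swap (b : ℕ → Fin d → ℚ) (j : ℕ)
    (hz : gsSq b (j + 1) + mu b (j + 1) j ^ 2 * gsSq b j ≠ 0) :
    gsSq (fun l => b (Equiv.swap j (j + 1) l)) j =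
        gsSq b (j + 1) + mu b (j + 1) j ^ 2 * gsSq b j ∧
      gsSq (fun l => b (Equiv.swap j (j + 1) l)) (j + 1) =
        gsSq b j * gsSq b (j + 1) / (gsSq b (j + 1) + mu b (j + 1) j ^ 2 * gsSq b j) ∧
      ∀ l, l ≠ j → l ≠ j + 1 → gsSq (fun l => b (Equiv.swap j (j + 1) l)) l = gsSq b l := by
  have ho1 : gs b (j + 1) ⬝ᵥ gs b j = 0 := gs_orth b (by omega)
  have ho2 : gs b j ⬝ᵥ gs b (j + 1) = 0 := gs_orth b (by omega)
  refine ⟨?_, ?_, ?_⟩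
  · rw [gsSq, gs_swap b j hz, Function.update_of_ne (by omega), Function.update_self]
    simp only [add_dotProduct, dotProduct_add, smul_dotProduct, dotProduct_smul, smul_eq_mul, ho1,
      ho2, gsSq]
    ring
  · rw [gsSq, gs_swap b j hz, Function.update_self]
    simp only [sub_dotProduct, dotProduct_sub, add_dotProduct, dotProduct_add, smul_dotProduct,
      dotProduct_smul, smul_eq_mul, ho1, ho2]
    have e : ∀ l, gs b l ⬝ᵥ gs b l = gsSq b l := fun _ => rfl
    simp only [e]
    generalize gsSq b (j + 1) = x at hz ⊢
    generalize gsSq b j = y at hz ⊢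
    generalize mu b (j + 1) j = m at hz ⊢
    generalize hw : x + m ^ 2 * y = z at hz ⊢
    field_simp
    rw [← hw]
    ring
  · intro l h1 h2
    rw [gsSq, gs_swap b j hz, Function.update_of_ne h2, Function.update_of_ne h1]; rfl

/-- The potential: the product of all leading Gram determinants, written as products of squared
Gram-Schmidt lengths. A swap of `b j` and `b (j + 1)` changes only the determinant of the first
`j + 1` vectors. -/
noncomputable def potential (b : ℕ → Fin d → ℚ) (k : ℕ) : ℚ :=
  ∏ m ∈ range (k + 1), ∏ l ∈ range m, gsSq b l

/-- If the Lovász condition fails, swapping decreases the potential by a constant factor. -/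
theorem potential_swap_le (b : ℕ → Fin d → ℚ) (j k : ℕ) (hj : j + 1 < k)
    (hpos : ∀ l < k, 0 < gsSq b l)
    (hL : gsSq b (j + 1) + mu b (j + 1) j ^ 2 * gsSq b j ≤ 3 / 4 * gsSq b j) :
    potential (fun l => b (Equiv.swap j (j + 1) l)) k ≤ 3 / 4 * potential b k := by
  have p1 := hpos (j + 1) hj
  have p0 := hpos j (by omega)
  have hz : 0 < gsSq b (j + 1) + mu b (j + 1) j ^ 2 * gsSq b j := by positivity
  obtain ⟨h1, h2, h3⟩ := gsSq_swap b j hz.ne'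
  set b' := fun l => b (Equiv.swap j (j + 1) l)
  have low : ∀ m ≤ j, ∏ l ∈ range m, gsSq b' l = ∏ l ∈ range m, gsSq b l := fun m hm =>
    Finset.prod_congr rfl fun l hl => by
      have := mem_range.1 hl
      exact h3 l (by omega) (by omega)
  have high : ∀ m, j + 2 ≤ m → ∏ l ∈ range m, gsSq b' l = ∏ l ∈ range m, gsSq b l := by
    intro m hm
    induction m, hm using Nat.le_induction with
    | base =>
      rw [prod_range_succ, prod_range_succ, prod_range_succ, prod_range_succ, low j le_rfl, h1, h2]
      field_simp
    | succ m hm ih => rw [prod_range_succ, prod_range_succ, ih, h3 m (by omega) (by omega)]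
  have hmem : j + 1 ∈ range (k + 1) := mem_range.2 (by omega)
  have hP : ∀ m ≤ k, 0 < ∏ l ∈ range m, gsSq b l := fun m hm =>
    Finset.prod_pos fun l hl => hpos l ((mem_range.1 hl).trans_le hm)
  unfold potential
  rw [← Finset.mul_prod_erase _ _ hmem, ← Finset.mul_prod_erase _ _ hmem, ← mul_assoc]
  have e : ∏ m ∈ (range (k + 1)).erase (j + 1), ∏ l ∈ range m, gsSq b' l =
      ∏ m ∈ (range (k + 1)).erase (j + 1), ∏ l ∈ range m, gsSq b l := by
    refine Finset.prod_congr rfl fun m hm => ?_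
    have hne := (mem_erase.1 hm).1
    rcases Nat.lt_or_ge j m with h | h
    · exact high m (by omega)
    · exact low m h
  rw [e]
  refine mul_le_mul_of_nonneg_right ?_ (Finset.prod_nonneg fun m hm => ?_)
  · rw [prod_range_succ, prod_range_succ, low j le_rfl, h1]
    nlinarith [hP j (by omega)]
  · have := mem_range.1 (mem_erase.1 hm).2
    exact (hP m (by omega)).le

/-- The invariant of the LLL algorithm at the working index `i` for a basis of `k` vectors of the
lattice `L`. The bound `G` on the Gram-Schmidt vectors is kept throughout, and `k * G` bounds the
basis vectors since each of them is size-reduced whenever it is changed. The condition `lovasz` is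
the consequence of size reduction and of the Lovász test that bounds the first vector in the end. -/
structure LLLInv (k G : ℕ) (L : Submodule ℤ (Fin d → ℤ)) (b : ℕ → Fin d → ℤ) (i : ℕ) : Prop where
  one_le : 1 ≤ i
  le : i ≤ k
  pos : ∀ l < k, 0 < gsSq (toRat b) l
  gs_le : ∀ l < k, gsSq (toRat b) l ≤ G
  norm_le : ∀ l < k, toRat b l ⬝ᵥ toRat b l ≤ k * G
  lovasz : ∀ l, l + 1 < i → gsSq (toRat b) l ≤ 2 * gsSq (toRat b) (l + 1)
  span : Submodule.span ℤ (b '' (range k : Set ℕ)) = L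

namespace LLLInv

variable {k G i : ℕ} {L : Submodule ℤ (Fin d → ℤ)} {b : ℕ → Fin d → ℤ}

theorem toRat_update (b : ℕ → Fin d → ℤ) (i : ℕ) (v : Fin d → ℤ) :
    toRat (Function.update b i v) = Function.update (toRat b) i fun a => (v a : ℚ) := by
  funext l
  rcases eq_or_ne l i with rfl | h
  · funext a
    rw [Function.update_self]
    change ((Function.update b l v l a : ℤ) : ℚ) = _
    rw [Function.update_self]
  · funext a
    rw [Function.update_of_ne h]
    change ((Function.update b i v l a : ℤ) : ℚ) = _
    rw [Function.update_of_ne h]; rfl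

theorem gs_toRat_update {v : Fin d → ℤ} {r : ℕ → ℤ} (hv : v = b i - ∑ l ∈ range i, r l • b l) :
    gs (toRat (Function.update b i v)) = gs (toRat b) := by
  rw [toRat_update]
  refine gs_update _ _ _ ?_
  have : (fun a => (v a : ℚ)) - toRat b i = -∑ l ∈ range i, (r l : ℚ) • toRat b l := by
    ext a
    simp [hv, toRat]
  rw [this]
  exact Submodule.neg_mem _ (Submodule.sum_mem _ fun l hl => Submodule.smul_mem _ _
    (Submodule.subset_span ⟨l, mem_range.1 hl, rfl⟩))

/-- Size reduction keeps the invariant. -/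
theorem update (h : LLLInv k G L b i) (hi : i < k) {v : Fin d → ℤ} {r : ℕ → ℤ}
    (hv : v = b i - ∑ l ∈ range i, r l • b l)
    (hred : ∀ l < i, |(fun a => (v a : ℚ)) ⬝ᵥ gs (toRat b) l| ≤ 1 / 2 * gsSq (toRat b) l) :
    LLLInv k G L (Function.update b i v) i := by
  have hg := gs_toRat_update hv
  have hq : gsSq (toRat (Function.update b i v)) = gsSq (toRat b) := by
    funext l; unfold gsSq; rw [hg]
  refine ⟨h.one_le, h.le, by rw [hq]; exact h.pos, by rw [hq]; exact h.gs_le, ?_,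
    by rw [hq]; exact h.lovasz, ?_⟩
  · intro l hl
    rcases eq_or_ne l i with rfl | hli
    · rw [eq_gs_add (toRat (Function.update b l v)) l]
      refine (norm_add_sum_le _ l _ (G := G) ?_ ?_).trans ?_
      · intro m hm
        rw [hg]
        exact h.gs_le m (by omega)
      · intro m hm
        have h1 := h.pos m (by omega)
        have h2 := hred m hm
        rw [mu, hg, toRat_update, Function.update_self, abs_div]
        change _ / |gsSq (toRat b) m| ≤ _
        rwa [abs_of_pos h1, div_le_iff₀ h1]
      · have : (l : ℚ) + 1 ≤ k := by exact_mod_cast hl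
        exact mul_le_mul_of_nonneg_right this (Nat.cast_nonneg G)
    · rw [toRat_update, Function.update_of_ne hli]
      exact h.norm_le l hl
  · rw [← h.span]
    have hm : ∀ l < k, b l ∈ Submodule.span ℤ (b '' (range k : Set ℕ)) := fun l hl =>
      Submodule.subset_span ⟨l, by simpa using hl, rfl⟩
    have hm' : ∀ l < k, l ≠ i →
        b l ∈ Submodule.span ℤ (Function.update b i v '' (range k : Set ℕ)) := fun l hl hli =>
      Submodule.subset_span ⟨l, by simpa using hl, Function.update_of_ne hli _ _⟩
    apply le_antisymm
    · refine Submodule.span_le.2 ?_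
      rintro _ ⟨l, hl, rfl⟩
      have hl : l < k := by simpa using hl
      rcases eq_or_ne l i with rfl | hli
      · rw [Function.update_self, hv]
        refine Submodule.sub_mem _ (hm l hl) (Submodule.sum_mem _ fun m hm' => ?_)
        have := mem_range.1 hm'
        exact Submodule.smul_mem _ _ (hm m (by omega))
      · rw [Function.update_of_ne hli]; exact hm l hl
    · refine Submodule.span_le.2 ?_
      rintro _ ⟨l, hl, rfl⟩
      have hl : l < k := by simpa using hl
      rcases eq_or_ne l i with rfl | hli
      · have : b l = v + ∑ m ∈ range l, r m • b m := by rw [hv]; simp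
        rw [this]
        refine Submodule.add_mem _
          (Submodule.subset_span ⟨l, by simpa using hl, Function.update_self _ _ _⟩)
          (Submodule.sum_mem _ fun m hm => ?_)
        have := mem_range.1 hm
        exact Submodule.smul_mem _ _ (hm' m (by omega) (by omega))
      · exact hm' l hl hli

/-- If the Lovász test succeeds, the working index can be increased. -/
theorem succ (h : LLLInv k G L b i) (hi : i < k) (hmu : |mu (toRat b) i (i - 1)| ≤ 1 / 2)
    (hL : (3 / 4 - mu (toRat b) i (i - 1) ^ 2) * gsSq (toRat b) (i - 1) ≤ gsSq (toRat b) i) :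
    LLLInv k G L b (i + 1) := by
  refine ⟨by omega, hi, h.pos, h.gs_le, h.norm_le, fun l hl => ?_, h.span⟩
  rcases Nat.lt_or_ge (l + 1) i with h1 | h1
  · exact h.lovasz l h1
  · obtain rfl : i = l + 1 := by omega
    rw [Nat.add_sub_cancel] at hmu hL
    have h2 : mu (toRat b) (l + 1) l ^ 2 ≤ 1 / 4 := by
      rw [← sq_abs]; nlinarith [abs_nonneg (mu (toRat b) (l + 1) l)]
    nlinarith [h.pos l (by omega)]

/-- If the Lovász test fails, a swap keeps the invariant and decreases the potential. In particular
the maximum of the Gram-Schmidt lengths does not increase. -/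
theorem swap (h : LLLInv k G L b i) (hi : i < k)
    (hL : gsSq (toRat b) i < (3 / 4 - mu (toRat b) i (i - 1) ^ 2) * gsSq (toRat b) (i - 1)) :
    LLLInv k G L (fun l => b (Equiv.swap (i - 1) i l)) (max (i - 1) 1) ∧
      potential (toRat fun l => b (Equiv.swap (i - 1) i l)) k ≤ 3 / 4 * potential (toRat b) k := by
  obtain ⟨j, rfl⟩ : ∃ j, i = j + 1 := ⟨i - 1, by have := h.one_le; omega⟩
  rw [Nat.add_sub_cancel] at hL ⊢
  have p1 := h.pos (j + 1) hi
  have p0 := h.pos j (by omega)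
  have hz : 0 < gsSq (toRat b) (j + 1) + mu (toRat b) (j + 1) j ^ 2 * gsSq (toRat b) j := by
    positivity
  have hL' : gsSq (toRat b) (j + 1) + mu (toRat b) (j + 1) j ^ 2 * gsSq (toRat b) j ≤
    3 / 4 * gsSq (toRat b) j := by linarith
  obtain ⟨h1, h2, h3⟩ := gsSq_swap (toRat b) j hz.ne'
  have hc : (toRat fun l => b (Equiv.swap j (j + 1) l)) =
    fun l => toRat b (Equiv.swap j (j + 1) l) := rfl
  have hsw : ∀ l < k, Equiv.swap j (j + 1) l < k := by
    intro l hl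
    rw [Equiv.swap_apply_def]
    split_ifs <;> omega
  refine ⟨⟨by omega, by omega, ?_, ?_, ?_, ?_, ?_⟩, ?_⟩
  · intro l hl
    rw [hc]
    by_cases e1 : l = j
    · rw [e1, h1]; exact hz
    by_cases e2 : l = j + 1
    · rw [e2, h2]; positivity
    · rw [h3 l e1 e2]; exact h.pos l hl
  · intro l hl
    rw [hc]
    by_cases e1 : l = j
    · rw [e1, h1]
      have := h.gs_le j (by omega)
      linarith
    by_cases e2 : l = j + 1
    · rw [e2, h2]
      refine le_trans ?_ (h.gs_le j (by omega))
      rw [div_le_iff₀ hz]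
      have : 0 ≤ mu (toRat b) (j + 1) j ^ 2 * gsSq (toRat b) j := by positivity
      nlinarith
    · rw [h3 l e1 e2]; exact h.gs_le l hl
  · intro l hl
    exact h.norm_le _ (hsw l hl)
  · intro l hl
    rw [hc, h3 l (by omega) (by omega), h3 (l + 1) (by omega) (by omega)]
    exact h.lovasz l (by omega)
  · rw [← h.span]
    congr 1
    ext x
    constructor
    · rintro ⟨l, hl, rfl⟩
      exact ⟨_, by simpa using hsw l (by simpa using hl), rfl⟩
    · rintro ⟨l, hl, rfl⟩
      exact ⟨Equiv.swap j (j + 1) l, by simpa using hsw l (by simpa using hl), by simp⟩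
  · exact potential_swap_le (toRat b) j k hi h.pos hL'

theorem prod_eq_gramDet (b : ℕ → Fin d → ℤ) (m : ℕ) :
    ∏ l ∈ range m, gsSq (toRat b) l = ((gramDet b m : ℤ) : ℚ) := by
  rw [← gramDet_toRat, gramDet_eq_prod]; rfl

/-- The Gram determinants of an integral basis are positive integers. -/
theorem one_le_prod (h : LLLInv k G L b i) {m : ℕ} (hm : m ≤ k) :
    1 ≤ ∏ l ∈ range m, gsSq (toRat b) l := by
  have h1 : 0 < ∏ l ∈ range m, gsSq (toRat b) l :=
    Finset.prod_pos fun l hl => h.pos l ((mem_range.1 hl).trans_le hm)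
  rw [prod_eq_gramDet] at h1 ⊢
  have h2 : 0 < gramDet b m := by exact_mod_cast h1
  exact_mod_cast h2

theorem prod_le (h : LLLInv k G L b i) {m : ℕ} (hm : m ≤ k) :
    ∏ l ∈ range m, gsSq (toRat b) l ≤ (G : ℚ) ^ m := by
  refine (Finset.prod_le_prod (fun l hl => ?_) fun l hl => ?_).trans_eq (by
    rw [Finset.prod_const, card_range])
  · exact (h.pos l ((mem_range.1 hl).trans_le hm)).le
  · exact h.gs_le l ((mem_range.1 hl).trans_le hm)

/-- The potential is a positive integer. -/
theorem one_le_potential (h : LLLInv k G L b i) : 1 ≤ potential (toRat b) k := by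
  unfold potential
  refine Finset.prod_induction _ (fun x => 1 ≤ x) (fun _ _ => one_le_mul_of_one_le_of_one_le)
    le_rfl fun m hm => h.one_le_prod ?_
  have := mem_range.1 hm
  omega

theorem one_le_G (h : LLLInv k G L b i) : 1 ≤ G := by
  have h1 := h.pos 0 (by have := h.one_le; have := h.le; omega)
  have h2 := h.gs_le 0 (by have := h.one_le; have := h.le; omega)
  have h3 : (0 : ℚ) < G := h1.trans_le h2
  exact_mod_cast h3

theorem potential_le (h : LLLInv k G L b i) : potential (toRat b) k ≤ (G : ℚ) ^ (k * (k + 1)) := by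
  unfold potential
  have hG : (1 : ℚ) ≤ G := by exact_mod_cast h.one_le_G
  refine (Finset.prod_le_prod (g := fun _ => (G : ℚ) ^ k) (fun m hm => ?_) fun m hm => ?_).trans_eq
    (by rw [Finset.prod_const, card_range, ← pow_mul])
  · have := mem_range.1 hm
    exact zero_le_one.trans (h.one_le_prod (by omega))
  · have := mem_range.1 hm
    exact (h.prod_le (by omega)).trans (pow_le_pow_right₀ hG (by omega))

theorem gsSq_zero (b : ℕ → Fin d → ℚ) : gsSq b 0 = b 0 ⬝ᵥ b 0 := by
  rw [gsSq, gs_eq_proj, proj_zero]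

/-- When LLL stops, the first basis vector is a nearly shortest nonzero vector of the lattice. -/
theorem norm_zero_le (h : LLLInv k G L b k) {x : Fin d → ℤ} (hx : x ∈ L) (hx0 : x ≠ 0) :
    b 0 ⬝ᵥ b 0 ≤ 2 ^ (k - 1) * (x ⬝ᵥ x) := by
  rw [← h.span, Submodule.mem_span_image_finset_iff_exists_fun'] at hx
  obtain ⟨c, hc⟩ := hx
  have hxq : (fun a => (x a : ℚ)) = ∑ l ∈ range k, (c l : ℚ) • toRat b l := by
    ext a; rw [← hc]; simp [toRat]
  have hx0' : ∑ l ∈ range k, (c l : ℚ) • toRat b l ≠ 0 := by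
    rw [← hxq]
    intro h0
    exact hx0 (funext fun a => by have := congrFun h0 a; simpa using this)
  -- `x` is at least as long as some `gs l`, and `gs 0 = b 0` exceeds `gs l` by at most `2 ^ l`
  obtain ⟨l, hl, hle⟩ := exists_gs_norm_le _ k c hx0'
  rw [← hxq] at hle
  have h1 : ∀ m < k, gsSq (toRat b) 0 ≤ 2 ^ m * gsSq (toRat b) m := by
    intro m
    induction m with
    | zero => intro _; simp
    | succ m ih =>
      intro hm
      refine (ih (by omega)).trans ?_
      rw [pow_succ, mul_assoc]
      exact mul_le_mul_of_nonneg_left (h.lovasz m hm) (by positivity)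
  have hz : (fun a => (b 0 a : ℚ)) ⬝ᵥ (fun a => (b 0 a : ℚ)) ≤
      2 ^ (k - 1) * ((fun a => (x a : ℚ)) ⬝ᵥ fun a => (x a : ℚ)) := by
    have h2 := h1 l hl
    rw [gsSq_zero] at h2
    refine h2.trans (mul_le_mul (pow_le_pow_right₀ (by norm_num) (by omega)) hle
      (dotProduct_self_nonneg' _) (by positivity))
  simp only [dotProduct] at hz ⊢
  exact_mod_cast hz

theorem zero_mem (h : LLLInv k G L b i) : b 0 ∈ L := by
  rw [← h.span]
  refine Submodule.subset_span ⟨0, ?_, rfl⟩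
  have := h.one_le; have := h.le
  simp; omega

theorem zero_ne (h : LLLInv k G L b i) : b 0 ≠ 0 := by
  intro h0
  have h1 := h.pos 0 (by have := h.one_le; have := h.le; omega)
  rw [gsSq_zero] at h1
  simp [toRat, h0, dotProduct] at h1

end LLLInv

end LLLInvariant

end LatticeRegression

namespace LatticeRegression

/-! ### Bit complexity of the LLL algorithm -/

section LLLCost

open Finset

variable {d k G i : ℕ} {L : Submodule ℤ (Fin d → ℤ)} {b : ℕ → Fin d → ℤ} {T : ℕ}

theorem abs_le_of_dotProduct_self_le {v : Fin d → ℚ} {K : ℕ} (h : v ⬝ᵥ v ≤ K) (a : Fin d) :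
    |v a| ≤ K := by
  have h1 : v a * v a ≤ K :=
    (Finset.single_le_sum (f := fun a => v a * v a) (fun a _ => mul_self_nonneg _)
      (mem_univ a)).trans h
  have h2 : (K : ℚ) ≤ K ^ 2 := by
    have : K ≤ K ^ 2 := by nlinarith [Nat.zero_le K, Nat.pos_of_ne_zero (n := K)]
    exact_mod_cast this
  refine abs_le_of_sq_le_sq (by nlinarith) (Nat.cast_nonneg K)

theorem natAbs_le_of_abs_cast_le {z : ℤ} {n : ℕ} (h : |(z : ℚ)| ≤ n) : z.natAbs ≤ n := by
  rw [← Int.cast_abs, Int.abs_eq_natAbs] at h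
  exact_mod_cast h

namespace LLLInv

theorem kG_le (h : LLLInv k G L b i) (hT : k * G ^ (k + 1) ≤ 2 ^ T) : k * G ≤ 2 ^ T :=
  (Nat.mul_le_mul_left k (by
    simpa using Nat.pow_le_pow_right h.one_le_G (show 1 ≤ k + 1 by omega))).trans hT

/-- `T` bounds the bit size of the entries of the basis and of the Gram determinants. -/
theorem natAbs_le (h : LLLInv k G L b i) (hT : k * G ^ (k + 1) ≤ 2 ^ T) {l : ℕ} (hl : l < k)
    (a : Fin d) : (b l a).natAbs ≤ 2 ^ T := by
  have h1 := abs_le_of_dotProduct_self_le (K := k * G) (by exact_mod_cast h.norm_le l hl) a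
  exact (natAbs_le_of_abs_cast_le h1).trans (h.kG_le hT)

/-- All intermediate vectors of the orthogonalisation have small entries, as they are orthogonal
projections of the basis vectors whose common denominator is a Gram determinant. -/
theorem small_proj (h : LLLInv k G L b i) (hT : k * G ^ (k + 1) ≤ 2 ^ T) {l j : ℕ} (hl : l < k)
    (hj : j ≤ k) (a : Fin d) : Small T (proj (toRat b) l j a) := by
  obtain ⟨z, hz⟩ := exists_int_gramDet_mul_proj b l j a
  have hG := h.one_le_G
  have h1 := h.one_le_prod hj
  have h2 := h.prod_le hj
  rw [prod_eq_gramDet] at h1 h2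
  have h3 : |proj (toRat b) l j a| ≤ (k * G : ℕ) := abs_le_of_dotProduct_self_le (by
    push_cast
    exact (proj_norm_le _ l j).trans (h.norm_le l hl)) a
  set D := gramDet b j with hD
  have h1' : 1 ≤ D := by exact_mod_cast h1
  have h2' : D ≤ (G : ℤ) ^ k := by
    have : (G : ℤ) ^ j ≤ (G : ℤ) ^ k := pow_le_pow_right₀ (by exact_mod_cast hG) hj
    refine le_trans ?_ this
    exact_mod_cast h2
  have hDn : D.natAbs ≤ G ^ k := by
    have : (D.natAbs : ℤ) = D := by omega
    exact_mod_cast this.trans_le h2'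
  have hk : 1 ≤ k := by omega
  refine Small.of_div (x := z) (y := D) ?_ (by omega) ?_ ?_
  · rw [← hz, mul_div_cancel_left₀]
    have : D ≠ 0 := by omega
    exact_mod_cast this
  · have h4 : |(z : ℚ)| ≤ (D.natAbs * (k * G) : ℕ) := by
      rw [← hz, abs_mul]
      push_cast
      refine mul_le_mul ?_ (by exact_mod_cast h3) (abs_nonneg _) ?_
      · rw [Nat.cast_natAbs, Int.cast_abs]
      · positivity
    have h5 := natAbs_le_of_abs_cast_le h4
    have h6 : D.natAbs * (k * G) ≤ k * G ^ (k + 1) := by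
      calc D.natAbs * (k * G) ≤ G ^ k * (k * G) := Nat.mul_le_mul_right _ hDn
        _ = _ := by ring
    exact h5.trans (h6.trans hT)
  · refine hDn.trans (le_trans ?_ hT)
    calc G ^ k = 1 * G ^ k := (one_mul _).symm
      _ ≤ k * G ^ (k + 1) := Nat.mul_le_mul hk (Nat.pow_le_pow_right hG (by omega))

theorem small_gs (h : LLLInv k G L b i) (hT : k * G ^ (k + 1) ≤ 2 ^ T) {l : ℕ} (hl : l < k)
    (a : Fin d) : Small T (gs (toRat b) l a) := by
  rw [gs_eq_proj]; exact h.small_proj hT hl hl.le a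

end LLLInv

/-- Bound for the cost of one projection step of `gso`. -/
def projCost (d T : ℕ) : ℕ :=
  coeffCost d T + (d + d * ((2 * (2 * d * (2 * T + 1) + T) + 8) ^ 3 +
    (2 * (T + (2 * d * (2 * T + 1) + T)) + 8) ^ 3))

/-- The orthogonalisation subtracts the components one after the other, so after `j` rounds the
current vector is the projection orthogonal to the first `j` vectors. -/
theorem Spec.gso (h : LLLInv k G L b i) (hT : k * G ^ (k + 1) ≤ 2 ^ T) {m : ℕ} (hm : m ≤ k) :
    Spec (gso b m) (m * (k * projCost d T)) fun s => ∀ l < m, s l = gs (toRat b) l := by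
  induction m with
  | zero => exact Spec.pure fun l hl => absurd hl (Nat.not_lt_zero l)
  | succ m ih =>
    rw [Nat.succ_mul]
    refine (ih (by omega)).bind fun s hs => ?_
    refine (Spec.bind (C := m * projCost d T) (D := 0) (P := fun v => v = proj (toRat b) m m)
      (Spec.foldlM_range (fun j v => v = proj (toRat b) m j) m _ (proj_zero _ m).symm ?_) ?_).mono
        (Nat.mul_le_mul_right _ (by omega)) fun _ h => h
    · rintro j v hj rfl
      rw [hs j hj]
      have sv := fun a => h.small_proj hT (show m < k by omega) (show j ≤ k by omega) a
      have ss := fun a => h.small_gs hT (show j < k by omega) a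
      refine (Spec.coeff sv ss).bind ?_
      rintro r ⟨hr, hrs⟩
      refine (Spec.fill (P := fun a x => x = proj (toRat b) m j a - r * gs (toRat b) j a)
        fun a => ?_).mono le_rfl ?_
      · refine (Spec.rmul hrs (ss a)).bind ?_
        rintro _ rfl
        exact Spec.rsub (sv a) (hrs.mul (ss a))
      · intro v hv
        rw [proj_succ, ← hr]
        funext a
        exact hv a
    · rintro v rfl
      refine Spec.pure fun l hl => ?_
      rcases eq_or_ne l m with rfl | hlm
      · rw [Function.update_self, gs_eq_proj]
      · rw [Function.update_of_ne hlm]; exact hs l (by omega)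

/-- Bound for the number of bits of the entries that occur during size reduction: each of the at most
`k` steps adds at most `3 T + d + 2` bits. -/
def sizeBits (d k T : ℕ) : ℕ := T + k * (3 * T + d + 2)

/-- Bound for the cost of one step of `sizeReduce`. -/
def reduceCost (d V : ℕ) : ℕ :=
  coeffCost d V + ((2 * (2 * d * (2 * V + 1)) + 4) ^ 3 +
    (d + d * ((V + V + 4) ^ 3 + (V + (V + V) + 4) ^ 3)))

/-- Subtracting the rounded multiple of a shorter vector increases the entries by a bounded number
of bits. -/
theorem reduce_step_bound {v : Fin d → ℤ} {w : Fin d → ℤ} {s : Fin d → ℚ} {t : ℕ}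
    (hv : ∀ a, (v a).natAbs ≤ 2 ^ t) (hs : ∀ a, |s a| ≤ 2 ^ T) (hw : ∀ a, (w a).natAbs ≤ 2 ^ T)
    (hq : 1 ≤ 2 ^ T * (s ⬝ᵥ s)) :
    (round ((fun a => (v a : ℚ)) ⬝ᵥ s / s ⬝ᵥ s)).natAbs ≤ 2 ^ (t + (2 * T + d + 1)) ∧
    ∀ a, (v a - round ((fun a => (v a : ℚ)) ⬝ᵥ s / s ⬝ᵥ s) * w a).natAbs ≤
      2 ^ (t + (3 * T + d + 2)) := by
  set x := (fun a => (v a : ℚ)) ⬝ᵥ s / s ⬝ᵥ s with hx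
  have hq0 : 0 < s ⬝ᵥ s := by
    rcases (dotProduct_self_nonneg' s).eq_or_lt with h | h
    · rw [← h] at hq; norm_num at hq
    · exact h
  have h1 : |(fun a => (v a : ℚ)) ⬝ᵥ s| ≤ d * (2 ^ t * 2 ^ T) := by
    refine (Finset.abs_sum_le_sum_abs _ _).trans ?_
    refine (Finset.sum_le_card_nsmul _ _ (2 ^ t * 2 ^ T) fun a _ => ?_).trans_eq (by simp)
    rw [abs_mul]
    refine mul_le_mul ?_ (hs a) (abs_nonneg _) (by positivity)
    have h2 : |v a| ≤ 2 ^ t := by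
      rw [Int.abs_eq_natAbs]; exact_mod_cast hv a
    change |(v a : ℚ)| ≤ 2 ^ t
    exact_mod_cast h2
  have h2 : |x| ≤ d * 2 ^ (t + 2 * T) := by
    rw [hx, abs_div, abs_of_pos hq0, div_le_iff₀ hq0]
    refine h1.trans ?_
    have : (d : ℚ) * 2 ^ (t + 2 * T) * (s ⬝ᵥ s) = d * (2 ^ t * 2 ^ T) * (2 ^ T * (s ⬝ᵥ s)) := by
      rw [pow_add, two_mul, pow_add]; ring
    rw [this]
    exact le_mul_of_one_le_right (by positivity) hq
  have h3 : |(round x : ℚ)| ≤ d * 2 ^ (t + 2 * T) + 1 := by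
    have h4 := abs_sub_round x
    have h5 := abs_sub_abs_le_abs_sub (round x : ℚ) x
    rw [abs_sub_comm] at h5
    linarith
  have h4 : (round x).natAbs ≤ d * 2 ^ (t + 2 * T) + 1 := by
    refine natAbs_le_of_abs_cast_le ?_
    exact_mod_cast h3
  have hd : d < 2 ^ d := Nat.lt_two_pow_self
  have h5 : (round x).natAbs ≤ 2 ^ (t + (2 * T + d)) := by
    refine h4.trans ?_
    have : 2 ^ (t + (2 * T + d)) = 2 ^ d * 2 ^ (t + 2 * T) := by rw [← pow_add]; ring_nf
    rw [this]
    have : 1 ≤ 2 ^ (t + 2 * T) := Nat.one_le_two_pow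
    nlinarith
  refine ⟨h5.trans (Nat.pow_le_pow_right (by norm_num) (by omega)), fun a => ?_⟩
  refine (Int.natAbs_sub_le _ _).trans ?_
  rw [Int.natAbs_mul]
  have h6 := Nat.mul_le_mul h5 (hw a)
  rw [← pow_add] at h6
  have h7 : 2 ^ t ≤ 2 ^ (t + (3 * T + d)) := Nat.pow_le_pow_right (by norm_num) (by omega)
  have h8 : 2 ^ (t + (2 * T + d) + T) = 2 ^ (t + (3 * T + d)) := by ring_nf
  have h9 : 2 ^ (t + (3 * T + d + 2)) = 4 * 2 ^ (t + (3 * T + d)) := by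
    rw [← add_assoc, pow_add]; ring
  have := hv a
  omega

/-- After the steps `i - 1, …, j` of size reduction the components along the Gram-Schmidt vectors
`j, …, i - 1` are reduced: the step `j` rounds the component along the vector `j` and does not change
the components along later vectors. -/
theorem Spec.sizeReduce (h : LLLInv k G L b i) (hT : k * G ^ (k + 1) ≤ 2 ^ T) (hi : i < k)
    {s : ℕ → Fin d → ℚ} (hs : ∀ l < i, s l = gs (toRat b) l) :
    Spec (sizeReduce b s i) (k * reduceCost d (sizeBits d k T)) fun v =>
      (∃ r : ℕ → ℤ, v = b i - ∑ l ∈ range i, r l • b l) ∧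
      (∀ a, (v a).natAbs ≤ 2 ^ sizeBits d k T) ∧
      ∀ l < i, |(fun a => (v a : ℚ)) ⬝ᵥ gs (toRat b) l| ≤ 1 / 2 * gsSq (toRat b) l := by
  set V := sizeBits d k T with hV
  have key := Spec.foldlM_range_reverse
    (f := fun (v : Fin d → ℤ) j => do
      let r ← LatticeRegression.rround (← LatticeRegression.coeff (fun a => (v a : ℚ)) (s j))
      LatticeRegression.fill fun a => do
        LatticeRegression.isub (v a) (← LatticeRegression.imul r (b j a)))
    (C := reduceCost d V)
    (fun j v => (∃ r : ℕ → ℤ, v = b i - ∑ l ∈ range i, r l • b l) ∧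
      (∀ a, (v a).natAbs ≤ 2 ^ (T + (i - j) * (3 * T + d + 2))) ∧
      ∀ l, j ≤ l → l < i → |(fun a => (v a : ℚ)) ⬝ᵥ gs (toRat b) l| ≤ 1 / 2 * gsSq (toRat b) l)
    i (b i) ⟨⟨0, by simp⟩, fun a => by simpa using h.natAbs_le hT hi a, by omega⟩ ?_
  · refine key.mono (Nat.mul_le_mul_right _ hi.le) ?_
    rintro v ⟨h1, h2, h3⟩
    refine ⟨h1, fun a => (h2 a).trans (Nat.pow_le_pow_right (by norm_num) ?_),
      fun l hl => h3 l (Nat.zero_le l) hl⟩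
    rw [hV, sizeBits]
    exact Nat.add_le_add_left (Nat.mul_le_mul_right _ (by omega)) _
  · rintro j v hj ⟨⟨r, hr⟩, hvs, hred⟩
    have hjk : j < k := by omega
    have hTV : T ≤ V := by rw [hV, sizeBits]; omega
    have htV : T + (i - (j + 1)) * (3 * T + d + 2) + (3 * T + d + 2) ≤ V := by
      have e : T + (i - (j + 1)) * (3 * T + d + 2) + (3 * T + d + 2) =
        T + (i - (j + 1) + 1) * (3 * T + d + 2) := by ring
      rw [e, hV, sizeBits]
      exact Nat.add_le_add_left (Nat.mul_le_mul_right _ (by omega)) _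
    rw [hs j hj]
    have ss : ∀ a, Small T (gs (toRat b) j a) := fun a => h.small_gs hT hjk a
    have sv : ∀ a, (v a).natAbs ≤ 2 ^ V := fun a =>
      (hvs a).trans (Nat.pow_le_pow_right (by norm_num) (by omega))
    have sb : ∀ a, (b j a).natAbs ≤ 2 ^ T := fun a => h.natAbs_le hT hjk a
    have hG := h.one_le_G
    -- a Gram-Schmidt vector is not too short since the Gram determinants are positive integers
    have hq : 1 ≤ 2 ^ T * (gs (toRat b) j ⬝ᵥ gs (toRat b) j) := by
      have h1 := h.one_le_prod (m := j + 1) (by omega)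
      have h2 := h.prod_le (m := j) (by omega)
      rw [prod_range_succ] at h1
      have h3 : (G : ℚ) ^ j ≤ 2 ^ T := by
        have : G ^ j ≤ 2 ^ T := by
          refine le_trans ?_ hT
          calc G ^ j = 1 * G ^ j := (one_mul _).symm
            _ ≤ k * G ^ (k + 1) :=
              Nat.mul_le_mul (by omega) (Nat.pow_le_pow_right hG (by omega))
        exact_mod_cast this
      exact h1.trans (mul_le_mul_of_nonneg_right (h2.trans h3) (h.pos j hjk).le)
    have hsa : ∀ a, |gs (toRat b) j a| ≤ 2 ^ T := fun a => by
      have h1 := abs_le_of_dotProduct_self_le (K := k * G) (v := gs (toRat b) j) (by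
        push_cast
        exact (gs_norm_le _ j).trans (h.norm_le j hjk)) a
      refine h1.trans ?_
      exact_mod_cast h.kG_le hT
    obtain ⟨hrs, hvs'⟩ := reduce_step_bound hvs hsa sb hq
    refine (Spec.coeff (fun a => Small.intCast (sv a)) fun a => (ss a).mono hTV).bind ?_
    rintro x ⟨rfl, hx⟩
    refine (Spec.rround hx).bind ?_
    rintro _ rfl
    set ρ := round ((fun a => (v a : ℚ)) ⬝ᵥ gs (toRat b) j / gs (toRat b) j ⬝ᵥ gs (toRat b) j)
      with hρ
    have hrV : ρ.natAbs ≤ 2 ^ V := hrs.trans (Nat.pow_le_pow_right (by norm_num) (by omega))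
    have sbV : ∀ a, (b j a).natAbs ≤ 2 ^ V := fun a =>
      (sb a).trans (Nat.pow_le_pow_right (by norm_num) hTV)
    refine (Spec.fill (P := fun a x => x = v a - ρ * b j a) fun a => ?_).mono le_rfl ?_
    · refine (Spec.imul hrV (sbV a)).bind ?_
      rintro _ rfl
      exact Spec.isub (sv a) (by
        rw [Int.natAbs_mul, pow_add]; exact Nat.mul_le_mul hrV (sbV a))
    · intro v' hv'
      have hvv : v' = v - ρ • b j := funext fun a => by rw [hv' a]; simp
      have hvq : (fun a => (v' a : ℚ)) = (fun a => (v a : ℚ)) - (ρ : ℚ) • toRat b j := by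
        ext a; simp [hv', toRat]
      refine ⟨⟨fun l => if l = j then r l + ρ else r l, ?_⟩, fun a => ?_, ?_⟩
      · rw [hvv, hr, sub_sub]
        congr 1
        have e : ∀ l, (if l = j then r l + ρ else r l) • b l =
            r l • b l + if l = j then ρ • b l else 0 := by
          intro l; split_ifs <;> simp [add_smul]
        rw [Finset.sum_congr rfl fun l _ => e l, Finset.sum_add_distrib, Finset.sum_ite_eq',
          if_pos (mem_range.2 hj)]
      · rw [hv' a]
        have e : T + (i - (j + 1)) * (3 * T + d + 2) + (3 * T + d + 2) =
            T + (i - j) * (3 * T + d + 2) := by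
          have : i - j = i - (j + 1) + 1 := by omega
          rw [this]; ring
        rw [← e]
        exact hvs' a
      · intro l hjl hli
        rw [hvq, sub_dotProduct, smul_dotProduct, smul_eq_mul]
        rcases hjl.eq_or_lt with rfl | hjl
        · have hp := h.pos j hjk
          rw [dotProduct_gs_self]
          change |_ - _ * gsSq (toRat b) j| ≤ _
          have e : (fun a => (v a : ℚ)) ⬝ᵥ gs (toRat b) j - ρ * gsSq (toRat b) j =
              ((fun a => (v a : ℚ)) ⬝ᵥ gs (toRat b) j / gs (toRat b) j ⬝ᵥ gs (toRat b) j - ρ) *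
                gsSq (toRat b) j := by
            rw [sub_mul]
            congr 1
            exact (div_mul_cancel₀ _ hp.ne').symm
          rw [e, abs_mul, abs_of_pos hp]
          exact mul_le_mul_of_nonneg_right (abs_sub_round _) hp.le
        · rw [dotProduct_gs_of_lt _ hjl, mul_zero, sub_zero]
          exact hred l hjl hli

/-- Bound for the cost of one round of LLL. -/
def roundCost (d k T : ℕ) : ℕ :=
  let V := sizeBits d k T
  let W := 2 * d * (2 * V + 1)
  k * (k * projCost d T) + (k * reduceCost d V + (coeffCost d V +
    (d * (2 * (2 * ((d + 1) * (2 * T + 1)) + 8) ^ 3) +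
    (d * (2 * (2 * ((d + 1) * (2 * T + 1)) + 8) ^ 3) +
    ((2 * (W + W) + 8) ^ 3 + ((2 * (2 + (W + W)) + 8) ^ 3 +
    ((2 * (2 + (W + W) + 1 + d * (2 * T + 1)) + 8) ^ 3 +
    (2 * (2 + (W + W) + 1 + d * (2 * T + 1) + d * (2 * T + 1)) + 8) ^ 3)))))))

/-- Each round of LLL keeps the invariant. Either the working index increases and the potential does
not change, or the index decreases by at most one and the potential decreases. -/
theorem Spec.lllRound (h : LLLInv k G L b i) (hT : k * G ^ (k + 1) ≤ 2 ^ T) (hi : i < k) :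
    Spec (lllRound k (b, i)) (roundCost d k T) fun r => ∃ b' i', r = Sum.inl (b', i') ∧
      LLLInv k G L b' i' ∧
      ((i' = i + 1 ∧ potential (toRat b') k = potential (toRat b) k) ∨
        (i ≤ i' + 1 ∧ potential (toRat b') k ≤ 3 / 4 * potential (toRat b) k)) := by
  unfold LatticeRegression.lllRound
  simp only [if_pos hi]
  set V := sizeBits d k T with hV
  have hTV : T ≤ V := by rw [hV, sizeBits]; omega
  have h1i := h.one_le
  have e2 : T + T + 1 = 2 * T + 1 := by ring
  refine ((Spec.gso h hT (m := i + 1) (by omega)).mono (Nat.mul_le_mul_right _ (by omega))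
    fun _ h => h).bind fun s hs => ?_
  refine (Spec.sizeReduce h hT hi fun l hl => hs l (by omega)).bind ?_
  rintro v ⟨⟨r, hr⟩, hvs, hred⟩
  have hc := h.update hi hr hred
  have hg := LLLInv.gs_toRat_update hr
  set c := Function.update b i v with hcdef
  have hq : gsSq (toRat c) = gsSq (toRat b) := by funext l; unfold gsSq; rw [hg]
  have hpot : potential (toRat c) k = potential (toRat b) k := by unfold potential; rw [hq]
  rw [hs i (by omega), hs (i - 1) (by omega)]
  have hmu : mu (toRat c) i (i - 1) =
      (fun a => (v a : ℚ)) ⬝ᵥ gs (toRat b) (i - 1) / gs (toRat b) (i - 1) ⬝ᵥ gs (toRat b) (i - 1)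
      := by
    rw [mu, hg, hcdef, LLLInv.toRat_update, Function.update_self]
  have ss := fun a => h.small_gs hT hi a
  have ss1 := fun a => h.small_gs hT (show i - 1 < k by omega) a
  refine (Spec.coeff (fun a => Small.intCast (hvs a)) fun a => (ss1 a).mono hTV).bind ?_
  rintro m ⟨hm, hms⟩
  rw [← hmu] at hm
  have hx := Spec.dot ss ss
  have hy := Spec.dot ss1 ss1
  rw [e2] at hx hy
  refine hx.bind ?_
  rintro x ⟨hx, hxs⟩
  refine hy.bind ?_
  rintro y ⟨hy, hys⟩
  have hx' : x = gsSq (toRat c) i := by rw [hq]; exact hx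
  have hy' : y = gsSq (toRat c) (i - 1) := by rw [hq]; exact hy
  have s34 : Small 2 (3 / 4 : ℚ) := Small.of_div (x := 3) (y := 4) (by norm_num) (by norm_num)
    (by norm_num) (by norm_num)
  refine (Spec.rmul hms hms).bind ?_
  rintro _ rfl
  refine (Spec.rsub s34 (hms.mul hms)).bind ?_
  rintro _ rfl
  have st := s34.sub (hms.mul hms)
  refine (Spec.rmul st hys).bind ?_
  rintro _ rfl
  refine (Spec.bind (D := 0) (Spec.rle (st.mul hys) hxs) ?_).mono le_rfl fun _ h => h
  rintro _ rfl
  have hmuc : |mu (toRat c) i (i - 1)| ≤ 1 / 2 := by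
    have hp := h.pos (i - 1) (by omega)
    rw [hmu, abs_div]
    change _ / |gsSq (toRat b) (i - 1)| ≤ _
    rw [abs_of_pos hp, div_le_iff₀ hp]
    exact hred (i - 1) (by omega)
  by_cases hL : (3 / 4 - m * m) * y ≤ x
  · simp only [hL, decide_true, if_true]
    refine Spec.pure ⟨c, i + 1, rfl, hc.succ hi hmuc ?_, Or.inl ⟨rfl, hpot⟩⟩
    rwa [← hx', ← hy', ← hm, sq]
  · simp only [hL, decide_false, Bool.false_eq_true, if_false]
    have hsw := hc.swap hi (by rw [← hx', ← hy', ← hm, sq]; exact not_le.1 hL)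
    rw [hpot] at hsw
    exact Spec.pure ⟨_, _, rfl, hsw.1, Or.inr ⟨by omega, hsw.2⟩⟩

/-- The loop of LLL stops, since the potential decreases by the factor `3 / 4` whenever the working
index decreases. Here `e` bounds the number of swaps that are still possible, and `2 e + (k - i)`
decreases in every round. -/
theorem Spec.lllLoop (hT : k * G ^ (k + 1) ≤ 2 ^ T) (fuel : ℕ) :
    ∀ (b : ℕ → Fin d → ℤ) (i e : ℕ), LLLInv k G L b i →
      potential (toRat b) k ≤ (4 / 3) ^ e → 2 * e + (k - i) + 1 ≤ fuel →
      Spec (loop (LatticeRegression.lllRound k) fuel (b, i)) (fuel * (1 + roundCost d k T)) fun o =>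
        ∃ b', o = some (b' 0) ∧ LLLInv k G L b' k := by
  induction fuel with
  | zero => intro b i e _ _ h; omega
  | succ fuel ih =>
    intro b i e h hpot hfuel
    unfold LatticeRegression.loop
    have e0 : (fuel + 1) * (1 + roundCost d k T) =
      1 + (roundCost d k T + fuel * (1 + roundCost d k T)) := by ring
    rw [e0]
    refine (Spec.charge (P := fun _ => True) (by norm_num) trivial).bind fun _ _ => ?_
    rcases Nat.lt_or_ge i k with hi | hi
    · refine (Spec.lllRound h hT hi).bind ?_
      rintro _ ⟨b', i', rfl, hinv, hcase⟩
      rcases hcase with ⟨rfl, hp⟩ | ⟨hii, hp⟩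
      · exact ih b' (i + 1) e hinv (hp ▸ hpot) (by omega)
      · rcases Nat.eq_zero_or_pos e with rfl | he
        · have := hinv.one_le_potential
          rw [pow_zero] at hpot
          linarith
        · refine ih b' i' (e - 1) hinv ?_ (by omega)
          obtain ⟨e, rfl⟩ : ∃ e', e = e' + 1 := ⟨e - 1, by omega⟩
          rw [Nat.add_sub_cancel]
          rw [pow_succ] at hpot
          linarith
    · have hik : i = k := le_antisymm h.le hi
      subst hik
      have hr : LatticeRegression.lllRound i (b, i) = (Pure.pure (Sum.inr (b 0)) : Step _) := by
        unfold LatticeRegression.lllRound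
        simp
      rw [hr]
      exact (Spec.pure (P := fun r => r = Sum.inr (b 0)) rfl).bind (by
        rintro _ rfl
        exact Spec.pure ⟨b, rfl, h⟩)

end LLLCost

end LatticeRegression

namespace LatticeRegression

section LLLPolynomial

open Finset

variable {d k G : ℕ}

/-- The initial basis of the LLL algorithm. -/
def extend (B : Fin k → Fin d → ℤ) (c : ℕ) : Fin d → ℤ := if h : c < k then B ⟨c, h⟩ else 0

theorem extend_of_lt (B : Fin k → Fin d → ℤ) (c : Fin k) : extend B c = B c := by
  simp [extend]

theorem toRat_extend (B : Fin k → Fin d → ℤ) (c : Fin k) :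
    toRat (extend B) c = fun a => (B c a : ℚ) := by
  funext a
  change ((extend B c a : ℤ) : ℚ) = _
  rw [extend_of_lt]

/-- For the initial basis the Lovász condition is void, as the working index is `1`. -/
theorem LLLInv.init (B : Fin k → Fin d → ℤ) (hk : 1 ≤ k)
    (hB : LinearIndependent ℚ fun c a => (B c a : ℚ)) (hG : ∀ c, B c ⬝ᵥ B c ≤ G) :
    LLLInv k G (Submodule.span ℤ (Set.range B)) (extend B) 1 := by
  have hn : ∀ l < k, toRat (extend B) l ⬝ᵥ toRat (extend B) l ≤ G := by
    intro l hl
    have h1 := hG ⟨l, hl⟩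
    rw [← extend_of_lt B ⟨l, hl⟩] at h1
    have h2 : toRat (extend B) l ⬝ᵥ toRat (extend B) l =
        ((extend B l ⬝ᵥ extend B l : ℤ) : ℚ) := by simp [dotProduct, toRat]
    rw [h2]
    exact_mod_cast h1
  have hk' : (1 : ℚ) ≤ k := by exact_mod_cast hk
  refine ⟨le_rfl, hk, fun l hl => ?_, fun l hl => (gs_norm_le _ l).trans (hn l hl),
    fun l hl => (hn l hl).trans (le_mul_of_one_le_left (Nat.cast_nonneg G) hk'),
    fun l hl => by omega, ?_⟩
  · refine lt_of_le_of_ne (dotProduct_self_nonneg' _) fun h0 => ?_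
    have h0 : gs (toRat (extend B)) l = 0 := dotProduct_self_eq_zero.1 h0.symm
    have h1 : toRat (extend B) l ∈ Submodule.span ℚ (toRat (extend B) '' Set.Iio l) := by
      have h2 := sub_gs_mem_span (toRat (extend B)) l
      rw [h0, sub_zero] at h2
      refine (Submodule.span_le.2 ?_) h2
      rintro _ ⟨j, hj, rfl⟩
      exact gs_mem_span _ hj
    have h3 : toRat (extend B) '' Set.Iio l =
        (fun (c : Fin k) a => (B c a : ℚ)) '' Set.Iio ⟨l, hl⟩ := by
      ext x
      constructor
      · rintro ⟨j, hj, rfl⟩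
        have hj : j < l := hj
        exact ⟨⟨j, hj.trans hl⟩, hj, (toRat_extend B ⟨j, hj.trans hl⟩).symm⟩
      · rintro ⟨j, hj, rfl⟩
        exact ⟨j, hj, toRat_extend B j⟩
    rw [h3] at h1
    refine hB.notMem_span_image (s := Set.Iio ⟨l, hl⟩) (x := ⟨l, hl⟩) (by simp) ?_
    rwa [← toRat_extend B ⟨l, hl⟩]
  · congr 1
    ext x
    constructor
    · rintro ⟨l, hl, rfl⟩
      have hl : l < k := by simpa using hl
      exact ⟨⟨l, hl⟩, (extend_of_lt B ⟨l, hl⟩).symm⟩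
    · rintro ⟨c, rfl⟩
      exact ⟨c, by simp, extend_of_lt B c⟩

theorem coeffCost_le {S V a : ℕ} (hS : 100 ≤ S) (hd : d ≤ S) (hV : V ≤ S ^ a) :
    coeffCost d V ≤ S ^ (3 * a + 8) := by
  have h1 : 1 ≤ S ^ a := Nat.one_le_pow _ _ (by omega)
  have e1 : 4 * ((d + 1) * (2 * V + 1)) + 8 ≤ S ^ (a + 2) := by
    calc 4 * ((d + 1) * (2 * V + 1)) + 8 ≤ 4 * ((S + S) * (2 * S ^ a + S ^ a)) + 8 * S ^ a := by
          gcongr <;> omega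
      _ = (24 * S + 8) * S ^ a := by ring
      _ ≤ S ^ 2 * S ^ a := by gcongr; nlinarith
      _ = S ^ (a + 2) := by ring
  calc coeffCost d V ≤ (2 * S + S) * (2 * (S ^ (a + 2)) ^ 3) := by
        unfold coeffCost; gcongr; omega
    _ = 6 * S * S ^ (3 * a + 6) := by ring
    _ ≤ S ^ 2 * S ^ (3 * a + 6) := by gcongr; nlinarith
    _ = S ^ (3 * a + 8) := by ring

/-- An arithmetic operation on numbers whose size is polynomial in `S` has polynomial cost. -/
theorem opCost_le {S x a : ℕ} (hS : 100 ≤ S) (hx : x ≤ 90 * S ^ a) : (x + 8) ^ 3 ≤ S ^ (3 * a + 3) := by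
  have h1 : 1 ≤ S ^ a := Nat.one_le_pow _ _ (by omega)
  have h2 : x + 8 ≤ S ^ (a + 1) := by rw [pow_succ]; nlinarith
  calc (x + 8) ^ 3 ≤ (S ^ (a + 1)) ^ 3 := by gcongr
    _ = _ := by ring

theorem roundCost_le {S T : ℕ} (hS : 100 ≤ S) (hd : d ≤ S) (hk : k ≤ S) (hT : T ≤ S ^ 4) :
    roundCost d k T ≤ S ^ 39 := by
  have p : ∀ a, 100 * S ^ a ≤ S ^ (a + 1) := fun a => by
    rw [pow_succ, mul_comm]; exact Nat.mul_le_mul_left _ hS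
  have hV : sizeBits d k T ≤ S ^ 6 := by
    calc sizeBits d k T ≤ S ^ 4 + S * (3 * S ^ 4 + S + S) := by unfold sizeBits; gcongr; omega
      _ = S ^ 4 + 3 * S ^ 5 + 2 * S ^ 2 := by ring
      _ ≤ S ^ 6 := by have := p 2; have := p 3; have := p 4; have := p 5; norm_num at *; omega
  have hT6 : T ≤ S ^ 6 := hT.trans (Nat.pow_le_pow_right (by omega) (by norm_num))
  unfold roundCost
  set V := sizeBits d k T
  have w : ∀ V, V ≤ S ^ 6 → 2 * d * (2 * V + 1) ≤ S ^ 8 := fun V hV => by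
    have : 1 ≤ S ^ 6 := Nat.one_le_pow _ _ (by omega)
    calc 2 * d * (2 * V + 1) ≤ 2 * S * (2 * S ^ 6 + S ^ 6) := by gcongr
      _ = 6 * S ^ 7 := by ring
      _ ≤ S ^ 8 := by have := p 7; norm_num at *; omega
  have hW := w V hV
  have hW' := w T hT6
  have hdT : d * (2 * T + 1) ≤ S ^ 8 := by nlinarith
  set W := 2 * d * (2 * V + 1)
  have h68 : S ^ 6 ≤ S ^ 8 := Nat.pow_le_pow_right (by omega) (by norm_num)
  have op : ∀ x, x ≤ 90 * S ^ 8 → (x + 8) ^ 3 ≤ S ^ 27 := fun x hx => opCost_le hS hx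
  have op4 : ∀ x, x ≤ 90 * S ^ 8 → (x + 4) ^ 3 ≤ S ^ 27 := fun x hx =>
    (Nat.pow_le_pow_left (by omega) 3).trans (op x hx)
  have cV := coeffCost_le hS hd hV
  have cT := coeffCost_le hS hd hT6
  norm_num at cV cT
  have h27 : 1 ≤ S ^ 27 := Nat.one_le_pow _ _ (by omega)
  have h28 : S ^ 28 = S * S ^ 27 := by ring
  have h2628 : S ^ 26 ≤ S ^ 28 := Nat.pow_le_pow_right (by omega) (by norm_num)
  have hpr : projCost d T ≤ S ^ 29 := by
    unfold projCost
    have h1 := op (2 * (2 * d * (2 * T + 1) + T)) (by omega)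
    have h2 := op (2 * (T + (2 * d * (2 * T + 1) + T))) (by omega)
    have : d * ((2 * (2 * d * (2 * T + 1) + T) + 8) ^ 3 +
      (2 * (T + (2 * d * (2 * T + 1) + T)) + 8) ^ 3) ≤ S * (S ^ 27 + S ^ 27) := by gcongr
    have h3 : S ≤ S * S ^ 27 := Nat.le_mul_of_pos_right _ h27
    have := p 28
    norm_num at this
    nlinarith
  have hre : reduceCost d V ≤ S ^ 29 := by
    unfold reduceCost
    have h1 := op4 (2 * W) (by omega)
    have h2 := op4 (V + V) (by omega)
    have h3 := op4 (V + (V + V)) (by omega)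
    have : d * ((V + V + 4) ^ 3 + (V + (V + V) + 4) ^ 3) ≤ S * (S ^ 27 + S ^ 27) := by gcongr
    have h3 : S ≤ S * S ^ 27 := Nat.le_mul_of_pos_right _ h27
    have := p 28
    norm_num at this
    have h4 : S ^ 27 ≤ S * S ^ 27 := Nat.le_mul_of_pos_left _ (by omega)
    change coeffCost d V + ((2 * W + 4) ^ 3 + _) ≤ _
    nlinarith
  have hdot : d * (2 * (2 * ((d + 1) * (2 * T + 1)) + 8) ^ 3) ≤ S ^ 29 := by
    have h1 : (d + 1) * (2 * T + 1) ≤ 4 * S ^ 8 := by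
      have : (d + 1) * (2 * T + 1) = d * (2 * T + 1) + 2 * T + 1 := by ring
      have : 1 ≤ S ^ 8 := Nat.one_le_pow _ _ (by omega)
      omega
    have h2 := op (2 * ((d + 1) * (2 * T + 1))) (by omega)
    calc _ ≤ S * (2 * S ^ 27) := by gcongr
      _ ≤ S ^ 29 := by have := p 28; norm_num at this; nlinarith
  have hgso : k * (k * projCost d T) ≤ S ^ 31 := by
    calc _ ≤ S * (S * S ^ 29) := by gcongr
      _ = _ := by ring
  have hred : k * reduceCost d V ≤ S ^ 30 := by
    calc _ ≤ S * S ^ 29 := by gcongr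
      _ = _ := by ring
  have h8 : 2 ≤ S ^ 8 := by
    calc 2 ≤ S := by omega
      _ ≤ S ^ 8 := Nat.le_self_pow (by norm_num) S
  have o1 := op (2 * (W + W)) (by omega)
  have o2 := op (2 * (2 + (W + W))) (by omega)
  have o3 := op (2 * (2 + (W + W) + 1 + d * (2 * T + 1))) (by omega)
  have o4 := op (2 * (2 + (W + W) + 1 + d * (2 * T + 1) + d * (2 * T + 1))) (by omega)
  have m : ∀ a ≤ 31, S ^ a ≤ S ^ 31 := fun a ha => Nat.pow_le_pow_right (by omega) ha
  have m26 := m 26 (by norm_num)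
  have m27 := m 27 (by norm_num)
  have m29 := m 29 (by norm_num)
  have m30 := m 30 (by norm_num)
  have m32 : S ^ 32 ≤ S ^ 39 := Nat.pow_le_pow_right (by omega) (by norm_num)
  have := p 31
  norm_num at this
  change k * (k * projCost d T) + (k * reduceCost d V + (coeffCost d V +
    (d * (2 * (2 * ((d + 1) * (2 * T + 1)) + 8) ^ 3) +
    (d * (2 * (2 * ((d + 1) * (2 * T + 1)) + 8) ^ 3) +
    ((2 * (W + W) + 8) ^ 3 + ((2 * (2 + (W + W)) + 8) ^ 3 +
    ((2 * (2 + (W + W) + 1 + d * (2 * T + 1)) + 8) ^ 3 +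
    (2 * (2 + (W + W) + 1 + d * (2 * T + 1) + d * (2 * T + 1)) + 8) ^ 3))))))) ≤ _
  omega

/-- LLL finds a nearly shortest nonzero vector of a lattice in polynomial time. The parameter `S` bounds
the dimension and the square root of the bit size of the entries; the exponents here and below are
chosen generously. -/
theorem exists_spec_lll {S : ℕ} (hS : 100 ≤ S) (hd : d ≤ S) (hk1 : 1 ≤ k) (hk : k ≤ S)
    (B : Fin k → Fin d → ℤ) (hB : LinearIndependent ℚ fun c a => (B c a : ℚ))
    (hG : ∀ c, B c ⬝ᵥ B c ≤ 2 ^ (S ^ 2)) :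
    ∃ fuel, Spec (lll fuel B) (S ^ 46) fun o => ∃ z, o = some z ∧
      z ∈ Submodule.span ℤ (Set.range B) ∧ z ≠ 0 ∧
      ∀ x ∈ Submodule.span ℤ (Set.range B), x ≠ 0 → z ⬝ᵥ z ≤ 2 ^ (k - 1) * (x ⬝ᵥ x) := by
  have hinv := LLLInv.init (G := 2 ^ (S ^ 2)) B hk1 hB (by exact_mod_cast hG)
  have p : ∀ a, 100 * S ^ a ≤ S ^ (a + 1) := fun a => by
    rw [pow_succ, mul_comm]; exact Nat.mul_le_mul_left _ hS
  -- `T` bounds the bit size of `k * G ^ (k + 1)` for `G = 2 ^ (S ^ 2)`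
  set T := k + S ^ 2 * (k + 1) with hT
  have hTS : T ≤ S ^ 4 := by
    calc T ≤ S + S ^ 2 * (S + S) := by rw [hT]; gcongr; omega
      _ = S + 2 * S ^ 3 := by ring
      _ ≤ S ^ 4 := by have := p 1; have := p 2; have := p 3; norm_num at *; omega
  -- the potential is at most `G ^ (k * (k + 1))`, and `2 ≤ (4 / 3) ^ 3`
  set e := 3 * (S ^ 2 * (k * (k + 1))) with he
  have heS : 2 * e + (k - 1) + 1 ≤ S ^ 6 := by
    have : 2 * e + (k - 1) + 1 = 2 * e + k := by omega
    rw [this]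
    calc 2 * e + k ≤ 2 * (3 * (S ^ 2 * (S * (S + S)))) + S := by rw [he]; gcongr; omega
      _ = 12 * S ^ 4 + S := by ring
      _ ≤ S ^ 6 := by
        have := p 1; have := p 2; have := p 3; have := p 4; have := p 5; norm_num at *; omega
  have hpot : potential (toRat (extend B)) k ≤ (4 / 3) ^ e := by
    refine hinv.potential_le.trans ?_
    rw [he, pow_mul (4 / 3 : ℚ)]
    push_cast
    rw [← pow_mul]
    exact pow_le_pow_left₀ (by norm_num) (by norm_num) _
  have hkT : k * (2 ^ S ^ 2) ^ (k + 1) ≤ 2 ^ T := by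
    rw [← pow_mul, hT, pow_add]
    exact Nat.mul_le_mul_right _ Nat.lt_two_pow_self.le
  refine ⟨2 * e + (k - 1) + 1,
    (Spec.lllLoop hkT _ (extend B) 1 e hinv hpot le_rfl).mono ?_ ?_⟩
  · calc _ ≤ S ^ 6 * (S ^ 39 + S ^ 39) := by
          gcongr
          · exact Nat.one_le_pow _ _ (by omega)
          · exact roundCost_le hS hd hk hTS
      _ = 2 * S ^ 45 := by ring
      _ ≤ S ^ 46 := by have := p 45; norm_num at this; omega
  · rintro _ ⟨b', rfl, h⟩
    exact ⟨b' 0, rfl, h.zero_mem, h.zero_ne, fun x hx hx0 => h.norm_zero_le hx hx0⟩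

end LLLPolynomial

end LatticeRegression

namespace LatticeRegression

/-! ### Euclid's algorithm -/

section Euclid

/-- Truncated remainders commute with multiplication by integers of either sign. Hence the algorithm
scales, and the sign of the result is known. -/
theorem euclid_mul (t a b : ℤ) : (euclid (t * a) (t * b)).val = t * (euclid a b).val := by
  rcases eq_or_ne t 0 with rfl | ht
  · simp only [zero_mul]
    rw [euclid]; rfl
  induction h : b.natAbs using Nat.strong_induction_on generalizing a b with
  | _ n ih =>
    subst h
    by_cases hb : b = 0
    · rw [euclid, dif_pos (by rw [hb, mul_zero]), euclid, dif_pos hb]; rfl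
    · rw [euclid, dif_neg (mul_ne_zero ht hb), euclid.eq_1 a b, dif_neg hb]
      change (euclid (t * b) ((t * a).tmod (t * b))).val = t * (euclid b (a.tmod b)).val
      have hm : (t * a).tmod (t * b) = t * a.tmod b := by
        rcases lt_or_gt_of_ne ht with h | h
        · have e := Int.mul_tmod_mul_of_pos (a := -t) a b (by omega)
          rwa [neg_mul, neg_mul, neg_mul, Int.neg_tmod, Int.tmod_neg, neg_inj] at e
        · exact Int.mul_tmod_mul_of_pos a b h
      rw [hm]
      refine ih _ ?_ b _ rfl
      rw [Int.natAbs_tmod]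
      exact Nat.mod_lt _ (Int.natAbs_pos.2 hb)

theorem euclid_dvd (a b : ℤ) : (euclid a b).val ∣ a ∧ (euclid a b).val ∣ b := by
  induction h : b.natAbs using Nat.strong_induction_on generalizing a b with
  | _ n ih =>
    subst h
    rw [euclid]
    by_cases hb : b = 0
    · rw [dif_pos hb, hb]
      exact ⟨dvd_refl a, dvd_zero _⟩
    · rw [dif_neg hb]
      change (euclid b (a.tmod b)).val ∣ a ∧ (euclid b (a.tmod b)).val ∣ b
      have hlt : (a.tmod b).natAbs < b.natAbs := by
        rw [Int.natAbs_tmod]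
        exact Nat.mod_lt _ (Int.natAbs_pos.2 hb)
      obtain ⟨h1, h2⟩ := ih _ hlt b (a.tmod b) rfl
      refine ⟨?_, h1⟩
      have h3 := dvd_add h2 (h1.mul_right (a.tdiv b))
      rwa [Int.tmod_add_mul_tdiv a b] at h3

theorem euclid_nonneg {a b : ℤ} (ha : 0 ≤ a) (hb : 0 ≤ b) : 0 ≤ (euclid a b).val := by
  induction h : b.natAbs using Nat.strong_induction_on generalizing a b with
  | _ n ih =>
    subst h
    rw [euclid]
    by_cases h0 : b = 0
    · rw [dif_pos h0]; exact ha
    · rw [dif_neg h0]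
      change 0 ≤ (euclid b (a.tmod b)).val
      refine ih _ ?_ hb (Int.tmod_nonneg b ha) rfl
      rw [Int.natAbs_tmod]
      exact Nat.mod_lt _ (Int.natAbs_pos.2 h0)

/-- The product of the two numbers at least halves in each step. -/
theorem euclid_spec_of_le {t : ℕ} (m : ℕ) (a b : ℤ) (hba : b.natAbs ≤ a.natAbs)
    (ha : a.natAbs ≤ 2 ^ t) (hm : a.natAbs * b.natAbs < 2 ^ m) :
    Spec (euclid a b) (m * (2 * t + 4) ^ 3) fun g => g.natAbs ≤ 2 ^ t := by
  induction m generalizing a b with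
  | zero =>
    have h0 : b = 0 := by
      by_contra h
      have := Int.natAbs_pos.2 h
      have : 0 < a.natAbs * b.natAbs := Nat.mul_pos (by omega) this
      omega
    rw [euclid, dif_pos h0]
    exact Spec.pure ha
  | succ m ih =>
    rw [euclid]
    by_cases hb : b = 0
    · rw [dif_pos hb]; exact Spec.pure ha
    · rw [dif_neg hb, Nat.succ_mul, Nat.add_comm (m * _)]
      have hbp := Int.natAbs_pos.2 hb
      have hb2 : b.natAbs ≤ 2 ^ t := hba.trans ha
      refine (Spec.charge (P := fun _ => True) (Nat.pow_le_pow_left ?_ 3) trivial).bind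
        fun _ _ => ?_
      · have := bits_le ha; have := bits_le hb2; omega
      have hlt : (a.tmod b).natAbs < b.natAbs := by
        rw [Int.natAbs_tmod]; exact Nat.mod_lt _ hbp
      refine ih b _ hlt.le hb2 ?_
      have h2 : 2 * (a.tmod b).natAbs ≤ a.natAbs := by
        rw [Int.natAbs_tmod] at hlt ⊢
        have h3 := Nat.mod_add_div a.natAbs b.natAbs
        have h4 : b.natAbs * 1 ≤ b.natAbs * (a.natAbs / b.natAbs) :=
          Nat.mul_le_mul_left _ (Nat.div_pos hba hbp)
        omega
      rw [pow_succ] at hm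
      nlinarith

theorem euclid_spec {t : ℕ} {a b : ℤ} (ha : a.natAbs ≤ 2 ^ t) (hb2 : b.natAbs ≤ 2 ^ t) :
    Spec (euclid a b) ((2 * t + 2) * (2 * t + 4) ^ 3) fun g => g.natAbs ≤ 2 ^ t := by
  rw [euclid]
  by_cases hb : b = 0
  · rw [dif_pos hb]; exact Spec.pure ha
  · have e : (2 * t + 2) * (2 * t + 4) ^ 3 = (2 * t + 4) ^ 3 + (2 * t + 1) * (2 * t + 4) ^ 3 := by
      ring
    rw [dif_neg hb, e]
    refine (Spec.charge (P := fun _ => True) (Nat.pow_le_pow_left ?_ 3) trivial).bind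
      fun _ _ => ?_
    · have := bits_le ha; have := bits_le hb2; omega
    have hlt : (a.tmod b).natAbs < b.natAbs := by
      rw [Int.natAbs_tmod]; exact Nat.mod_lt _ (Int.natAbs_pos.2 hb)
    refine euclid_spec_of_le _ b _ hlt.le hb2 ?_
    calc b.natAbs * (a.tmod b).natAbs ≤ 2 ^ t * 2 ^ t := Nat.mul_le_mul hb2 (hlt.le.trans hb2)
      _ < 2 ^ (2 * t + 1) := by
        rw [← pow_add]; exact Nat.pow_lt_pow_right (by norm_num) (by omega)

/-- The signed greatest common divisor of a multiple `r * b` of a vector of nonnegative coprime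
integers is `r`, including the sign. -/
theorem Spec.foldlM_euclid {p t : ℕ} {x b : Fin p → ℤ} {r : ℤ}
    (hx : ∀ j, x j = r * b j) (hb : ∀ j, 0 ≤ b j)
    (hgcd : ∀ g : ℤ, (∀ j, g ∣ b j) → g.natAbs = 1) (hxs : ∀ j, (x j).natAbs ≤ 2 ^ t) :
    Spec ((List.finRange p).foldlM (fun g j => euclid g (x j)) 0)
      (p * ((2 * t + 2) * (2 * t + 4) ^ 3)) fun g => g = r := by
  refine (Spec.foldlM_finRange
    (fun m g => g.natAbs ≤ 2 ^ t ∧ ∃ g0 : ℤ, 0 ≤ g0 ∧ g = r * g0 ∧ ∀ l : Fin p, (l : ℕ) < m → g0 ∣ b l)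
    0 ⟨by simp, 0, le_rfl, by simp, fun l hl => absurd hl (Nat.not_lt_zero _)⟩ ?_).mono le_rfl ?_
  · rintro j g ⟨hg, g0, hg0, hgg, hdvd⟩
    have hs := euclid_spec hg (hxs j)
    refine ⟨hs.1, hs.2, (euclid g0 (b j)).val, euclid_nonneg hg0 (hb j), ?_, ?_⟩
    · rw [hgg, hx j]; exact euclid_mul r g0 (b j)
    · intro l hl
      obtain ⟨h1, h2⟩ := euclid_dvd g0 (b j)
      rcases Nat.lt_or_ge l j with h | h
      · exact h1.trans (hdvd l h)
      · rw [Fin.ext (by omega : (l : ℕ) = j)]; exact h2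
  · rintro g ⟨-, g0, hg0, rfl, hdvd⟩
    have := hgcd g0 fun j => hdvd j j.2
    have : g0 = 1 := by omega
    rw [this, mul_one]

end Euclid

/-! ### The lattice of the extended Lagarias-Odlyzko algorithm -/

section Lattice

open Matrix

variable {n p : ℕ} (m : ℤ) (X : Matrix (Fin n) (Fin p) ℤ) (Y : Fin n → ℤ)

/-- The first `n` coordinates of a lattice vector are the errors of the linear equations, multiplied by
the large number `m`. -/
theorem latticeMatrix_mulVec_error (y : Fin (p + n + n) → ℤ) (i : Fin n) :
    (latticeMatrix m X Y *ᵥ y) (Fin.castAdd n (Fin.castAdd p i)) =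
      m * (∑ j, X i j * y (Fin.castAdd n (Fin.castAdd n j)) -
        Y i * y (Fin.castAdd n (Fin.natAdd p i)) + y (Fin.natAdd (p + n) i)) := by
  simp only [mulVec, dotProduct, Fin.sum_univ_add, latticeMatrix, reindex_apply, submatrix_apply,
    Equiv.symm_trans_apply, Equiv.sumCongr_symm, Equiv.refl_symm, finSumFinEquiv_symm_apply_castAdd,
    finSumFinEquiv_symm_apply_natAdd, Equiv.sumCongr_apply, Sum.map_inl, Sum.map_inr,
    fromBlocks_apply₁₁, fromBlocks_apply₁₂, fromRows_apply_inl, Matrix.smul_apply, Matrix.neg_apply, smul_eq_mul,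
    diagonal_apply, one_apply, Equiv.coe_refl, id]
  simp only [mul_ite, mul_zero, neg_mul, ite_mul, zero_mul, mul_one, Finset.sum_neg_distrib,
    Finset.sum_ite_eq, Finset.mem_univ, if_true, mul_add, mul_sub, Finset.mul_sum, mul_assoc]
  ring

theorem latticeMatrix_mulVec_coeff (y : Fin (p + n + n) → ℤ) (j : Fin p) :
    (latticeMatrix m X Y *ᵥ y) (Fin.castAdd n (Fin.natAdd n j)) =
      y (Fin.castAdd n (Fin.castAdd n j)) := by
  simp only [mulVec, dotProduct, Fin.sum_univ_add, latticeMatrix, reindex_apply, submatrix_apply,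
    Equiv.symm_trans_apply, Equiv.sumCongr_symm, Equiv.refl_symm, finSumFinEquiv_symm_apply_castAdd,
    finSumFinEquiv_symm_apply_natAdd, Equiv.sumCongr_apply, Sum.map_inl, Sum.map_inr,
    fromBlocks_apply₁₁, fromBlocks_apply₁₂, fromBlocks_apply₂₁, fromBlocks_apply₂₂,
    fromRows_apply_inr, Matrix.zero_apply, one_apply, Equiv.coe_refl, id]
  simp

theorem latticeMatrix_mulVec_noise (y : Fin (p + n + n) → ℤ) (i : Fin n) :
    (latticeMatrix m X Y *ᵥ y) (Fin.natAdd (n + p) i) = y (Fin.natAdd (p + n) i) := by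
  simp only [mulVec, dotProduct, Fin.sum_univ_add, latticeMatrix, reindex_apply, submatrix_apply,
    Equiv.symm_trans_apply, Equiv.sumCongr_symm, Equiv.refl_symm, finSumFinEquiv_symm_apply_castAdd,
    finSumFinEquiv_symm_apply_natAdd, Equiv.sumCongr_apply, Sum.map_inl, Sum.map_inr,
    fromBlocks_apply₂₁, fromBlocks_apply₂₂, Matrix.zero_apply, one_apply, Equiv.coe_refl, id]
  simp

theorem natAbs_latticeMatrix_le {t : ℕ} (hX : ∀ i j, (m * X i j).natAbs ≤ 2 ^ t)
    (hY : ∀ i, (m * Y i).natAbs ≤ 2 ^ t) (hm : m.natAbs ≤ 2 ^ t) (r : Fin (n + p + n))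
    (c : Fin (p + n + n)) : (latticeMatrix m X Y r c).natAbs ≤ 2 ^ t := by
  have h1 : 1 ≤ 2 ^ t := Nat.one_le_two_pow
  unfold latticeMatrix
  rw [reindex_apply, submatrix_apply]
  generalize Equiv.symm _ r = r'
  generalize Equiv.symm _ c = c'
  rcases r' with (i | j) | i <;> rcases c' with (j' | i') | i'
  · simpa using hX i j'
  · change (-(m * diagonal Y i i')).natAbs ≤ _
    by_cases h : i = i'
    · subst h; simpa using hY i
    · simp [h]
  · change (m * (1 : Matrix (Fin n) (Fin n) ℤ) i i').natAbs ≤ _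
    by_cases h : i = i'
    · subst h; simpa using hm
    · simp [h]
  · by_cases h : j = j'
    · subst h; simpa using h1
    · simp [h]
  · simp
  · simp
  · simp
  · simp
  · by_cases h : i = i'
    · subst h; simpa using h1
    · simp [h]

/-- The index set of the columns decomposes into three parts. -/
theorem col_cases {P : Fin (p + n + n) → Prop} (h1 : ∀ j, P (Fin.castAdd n (Fin.castAdd n j)))
    (h2 : ∀ i, P (Fin.castAdd n (Fin.natAdd p i))) (h3 : ∀ i, P (Fin.natAdd (p + n) i)) (c) : P c :=
  Fin.addCases (fun c => Fin.addCases h1 h2 c) h3 c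

/-- The columns are independent: the lower blocks show the first and the third part of a
coefficient vector, and the diagonal block `m Y` the second. -/
theorem linearIndependent_latticeMatrix {m : ℤ} (hm : m ≠ 0) {Y : Fin n → ℤ} (hY : ∀ i, Y i ≠ 0) :
    LinearIndependent ℚ fun (c : Fin (p + n + n)) (r : Fin (n + p + n)) =>
      (latticeMatrix m X Y r c : ℚ) := by
  rw [← LinearIndependent.iff_fractionRing ℤ ℚ, Fintype.linearIndependent_iff]
  intro y hy
  have h0 : latticeMatrix m X Y *ᵥ y = 0 := by
    ext r
    have h := congrFun hy r
    simp only [Finset.sum_apply, zsmul_eq_mul, Pi.zero_apply] at h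
    have h' : ((∑ c, latticeMatrix m X Y r c * y c : ℤ) : ℚ) = 0 := by
      push_cast
      rw [← h]
      exact Finset.sum_congr rfl fun c _ => mul_comm _ _
    exact_mod_cast h'
  have z1 : ∀ j, y (Fin.castAdd n (Fin.castAdd n j)) = 0 := fun j => by
    rw [← latticeMatrix_mulVec_coeff m X Y y, h0]; rfl
  have z3 : ∀ i, y (Fin.natAdd (p + n) i) = 0 := fun i => by
    rw [← latticeMatrix_mulVec_noise m X Y y, h0]; rfl
  refine col_cases z1 (fun i => ?_) z3
  have h := latticeMatrix_mulVec_error m X Y y i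
  rw [h0] at h
  simp only [z1, z3, mul_zero, Finset.sum_const_zero, zero_sub, add_zero, Pi.zero_apply] at h
  have h' : m * (Y i * y (Fin.castAdd n (Fin.natAdd p i))) = 0 := by linarith
  simpa [hm, hY i] using h'

theorem mem_span_columns {k d : ℕ} (A : Matrix (Fin d) (Fin k) ℤ) (x : Fin d → ℤ) :
    x ∈ Submodule.span ℤ (Set.range fun c r => A r c) ↔ ∃ y, x = A *ᵥ y := by
  rw [Submodule.mem_span_range_iff_exists_fun]
  refine exists_congr fun y => ?_
  rw [eq_comm]
  have : ∑ c, y c • (fun r => A r c) = A *ᵥ y := by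
    ext r
    simp [mulVec, dotProduct, mul_comm]
  rw [this]

end Lattice

end LatticeRegression

namespace LatticeRegression

/-! ### Correctness and cost of ELO and LBR -/

section ELO

open Matrix

variable {n p S : ℕ}

theorem ceilSqrt_le (k : ℕ) : ceilSqrt k ≤ k := by
  unfold ceilSqrt
  split_ifs with h
  · exact Nat.zero_le k
  · have := Nat.sqrt_le_self (k - 1)
    omega

/-- The value that `scale` computes. -/
def scaleVal (n p Rhat What : ℕ) : ℕ :=
  2 ^ (n + (p + 1) / 2 + 3) * p * (Rhat * ceilSqrt p + What * ceilSqrt n)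

/-- A bit operation on numbers of at most `90 * S` bits. -/
theorem smallOp_le {x : ℕ} (hS : 100 ≤ S) (hx : x ≤ 90 * S) : (x + 4) ^ 3 ≤ S ^ 6 := by
  have h := opCost_le (a := 1) hS (by simpa using hx)
  exact (Nat.pow_le_pow_left (by omega) 3).trans h

theorem scaleVal_le {Rhat What : ℕ} (hS : 2 * n + p + 10 ≤ S) (hR : Rhat ≤ 2 ^ S)
    (hW : What ≤ 2 ^ S) : scaleVal n p Rhat What ≤ 2 ^ (5 * S) := by
  have hlt : S ≤ 2 ^ S := Nat.lt_two_pow_self.le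
  have h1 : 2 ^ (n + (p + 1) / 2 + 3) ≤ 2 ^ (S - 1) := Nat.pow_le_pow_right (by norm_num) (by omega)
  calc scaleVal n p Rhat What ≤ 2 ^ (S - 1) * 2 ^ S * (2 ^ S * 2 ^ S + 2 ^ S * 2 ^ S) := by
        unfold scaleVal
        gcongr
        · omega
        · exact (ceilSqrt_le p).trans (by omega)
        · exact (ceilSqrt_le n).trans (by omega)
    _ = 2 ^ (S - 1) * 2 ^ S * 2 ^ (2 * S + 1) := by rw [pow_succ, two_mul S, pow_add]; ring
    _ = 2 ^ (S - 1 + S + (2 * S + 1)) := by rw [← pow_add, ← pow_add]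
    _ ≤ 2 ^ (5 * S) := Nat.pow_le_pow_right (by norm_num) (by omega)

theorem Spec.scale {Rhat What : ℕ} (hS : 100 ≤ S) (hnp : 2 * n + p + 10 ≤ S) (hR : Rhat ≤ 2 ^ S)
    (hW : What ≤ 2 ^ S) :
    Spec (scale n p Rhat What) (S ^ 7) fun m => m = (scaleVal n p Rhat What : ℕ) := by
  have hlt : S ≤ 2 ^ S := Nat.lt_two_pow_self.le
  have op : ∀ x, x ≤ 90 * S → (x + 4) ^ 3 ≤ S ^ 6 := fun x => smallOp_le hS
  have hu : ((2 : ℤ) ^ (n + (p + 1) / 2 + 3)).natAbs ≤ 2 ^ S := by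
    rw [Int.natAbs_pow]
    exact Nat.pow_le_pow_right (by norm_num) (by omega)
  have hR' : (Rhat : ℤ).natAbs ≤ 2 ^ S := by simpa using hR
  have hW' : (What : ℤ).natAbs ≤ 2 ^ S := by simpa using hW
  have hp' : (p : ℤ).natAbs ≤ 2 ^ S := by
    have : p ≤ 2 ^ S := by omega
    simpa using this
  have hsp : (ceilSqrt p : ℤ).natAbs ≤ 2 ^ S := by
    have := ceilSqrt_le p
    have : ceilSqrt p ≤ 2 ^ S := by omega
    simpa using this
  have hsn : (ceilSqrt n : ℤ).natAbs ≤ 2 ^ S := by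
    have := ceilSqrt_le n
    have : ceilSqrt n ≤ 2 ^ S := by omega
    simpa using this
  have hmul : ∀ {a b : ℤ} {s t : ℕ}, a.natAbs ≤ 2 ^ s → b.natAbs ≤ 2 ^ t →
      (a * b).natAbs ≤ 2 ^ (s + t) := fun ha hb => by
    rw [Int.natAbs_mul, pow_add]; exact Nat.mul_le_mul ha hb
  have hadd : ((Rhat : ℤ) * ceilSqrt p + What * ceilSqrt n).natAbs ≤ 2 ^ (3 * S) := by
    refine (Int.natAbs_add_le _ _).trans ?_
    have h1 := hmul hR' hsp
    have h2 := hmul hW' hsn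
    have h3 : 2 ^ (S + S) + 2 ^ (S + S) ≤ 2 ^ (3 * S) := by
      rw [← two_mul, ← pow_succ']; exact Nat.pow_le_pow_right (by norm_num) (by omega)
    omega
  have e : S ^ 7 = S ^ 6 * S := pow_succ _ _
  have hc : S ^ 6 + (S ^ 6 + (S ^ 6 + (S ^ 6 + (S ^ 6 + (S ^ 6 + (S ^ 6 + S ^ 6)))))) ≤ S ^ 7 := by
    rw [e]; nlinarith [Nat.zero_le (S ^ 6)]
  have key : Spec (LatticeRegression.scale n p Rhat What)
      (S ^ 6 + (S ^ 6 + (S ^ 6 + (S ^ 6 + (S ^ 6 + (S ^ 6 + (S ^ 6 + S ^ 6)))))))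
      fun m => m = (scaleVal n p Rhat What : ℕ) := by
    unfold LatticeRegression.scale
    refine (Spec.charge (P := fun u => u = (2 : ℤ) ^ (n + (p + 1) / 2 + 3))
      (op (n + p) (by omega)) rfl).bind ?_
    rintro _ rfl
    refine (Spec.charge (P := fun u => u = (ceilSqrt p : ℤ))
      ((Nat.pow_le_pow_left (by omega) 3).trans (op p (by omega))) rfl).bind ?_
    rintro _ rfl
    refine (Spec.charge (P := fun u => u = (ceilSqrt n : ℤ))
      ((Nat.pow_le_pow_left (by omega) 3).trans (op n (by omega))) rfl).bind ?_
    rintro _ rfl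
    refine ((Spec.imul hR' hsp).mono (op (S + S) (by omega)) fun _ h => h).bind ?_
    rintro _ rfl
    refine ((Spec.imul hW' hsn).mono (op (S + S) (by omega)) fun _ h => h).bind ?_
    rintro _ rfl
    refine ((Spec.iadd (hmul hR' hsp) (hmul hW' hsn)).mono (op (S + S + (S + S)) (by omega))
      fun _ h => h).bind ?_
    rintro _ rfl
    refine ((Spec.imul hu hp').mono (op (S + S) (by omega)) fun _ h => h).bind ?_
    rintro _ rfl
    refine (Spec.imul (hmul hu hp') hadd).mono (op (S + S + 3 * S) (by omega)) ?_
    rintro _ rfl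
    unfold scaleVal
    push_cast
    ring
  exact key.mono hc fun _ h => h

/-- The shifted observation `Y + X Z`. -/
theorem Spec.shift {Y : Fin n → ℤ} {X : Matrix (Fin n) (Fin p) ℤ} {Z : Fin p → ℤ} (hS : 100 ≤ S)
    (hp : p ≤ S) (hY : ∀ i, (Y i).natAbs ≤ 2 ^ S) (hX : ∀ i j, (X i j).natAbs ≤ 2 ^ S)
    (hZ : ∀ j, (Z j).natAbs ≤ 2 ^ S) (i : Fin n) :
    Spec ((List.finRange p).foldlM (fun s j => do
      LatticeRegression.iadd s (← LatticeRegression.imul (X i j) (Z j))) (Y i))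
      (p * (S ^ 6 + S ^ 6)) fun s => s = Y i + (X *ᵥ Z) i ∧ s.natAbs ≤ 2 ^ (4 * S) := by
  have hlt : S ≤ 2 ^ S := Nat.lt_two_pow_self.le
  have op : ∀ x, x ≤ 90 * S → (x + 4) ^ 3 ≤ S ^ 6 := fun x => smallOp_le hS
  have hXZ : ∀ j, (X i j * Z j).natAbs ≤ 2 ^ (S + S) := fun j => by
    rw [Int.natAbs_mul, pow_add]; exact Nat.mul_le_mul (hX i j) (hZ j)
  have h4 : 2 ^ S + p * 2 ^ (S + S) ≤ 2 ^ (4 * S) := by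
    have h1 : p * 2 ^ (S + S) ≤ 2 ^ S * 2 ^ (S + S) := Nat.mul_le_mul_right _ (hp.trans hlt)
    rw [← pow_add] at h1
    have h2 : 2 ^ S ≤ 2 ^ (S + (S + S)) := Nat.pow_le_pow_right (by norm_num) (by omega)
    have h3 : 2 * 2 ^ (S + (S + S)) ≤ 2 ^ (4 * S) := by
      rw [← pow_succ']; exact Nat.pow_le_pow_right (by norm_num) (by omega)
    omega
  refine (Spec.foldlM_finRange (fun j s =>
    s = Y i + ∑ a : Fin p, (if (a : ℕ) < j then X i a * Z a else 0) ∧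
      s.natAbs ≤ 2 ^ S + j * 2 ^ (S + S)) (Y i) ⟨by simp, by simpa using hY i⟩ ?_).mono le_rfl ?_
  · rintro j s ⟨hs, hb⟩
    refine ((Spec.imul (hX i j) (hZ j)).mono (op (S + S) (by omega)) fun _ h => h).bind ?_
    rintro _ rfl
    have hb' : s.natAbs ≤ 2 ^ (4 * S) := by
      have : (j : ℕ) * 2 ^ (S + S) ≤ p * 2 ^ (S + S) := Nat.mul_le_mul_right _ j.2.le
      omega
    refine (Spec.iadd hb' (hXZ j)).mono (op (4 * S + (S + S)) (by omega)) ?_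
    rintro _ rfl
    refine ⟨?_, ?_⟩
    · rw [sum_ite_lt_succ, ← add_assoc, ← hs]
    · have h1 := Int.natAbs_add_le s (X i j * Z j)
      have h2 := hXZ j
      rw [Nat.succ_mul]
      omega
  · rintro s ⟨hs, hb⟩
    refine ⟨?_, hb.trans h4⟩
    rw [hs]
    congr 1
    exact Finset.sum_congr rfl fun a _ => if_pos a.2

theorem abs_le_of_dotProduct_le_sq {d : ℕ} {z : Fin d → ℤ} {D : ℤ} (hD : 0 ≤ D)
    (h : z ⬝ᵥ z ≤ D ^ 2) (r : Fin d) : |z r| ≤ D := by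
  refine abs_le_of_sq_le_sq ?_ hD
  refine le_trans ?_ h
  rw [sq]
  exact Finset.single_le_sum (f := fun a => z a * z a) (fun a _ => mul_self_nonneg _)
    (Finset.mem_univ r)

/-- The extended Lagarias-Odlyzko algorithm recovers `b - Z` in polynomial time if `b` gives a
lattice vector of length at most `D / 2 ^ ((p + 2 n - 1) / 2)` and if all solutions of size at most
`D` are multiples of it. -/
theorem exists_spec_elo {Y : Fin n → ℤ} {X : Matrix (Fin n) (Fin p) ℤ} {Rhat What : ℕ}
    {Z b : Fin p → ℤ} {D : ℤ} (hS : 100 ≤ S) (hnp : 2 * n + p + 10 ≤ S) (hp : 0 < p)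
    (hR : Rhat ≤ 2 ^ S) (hW : What ≤ 2 ^ S) (hY : ∀ i, (Y i).natAbs ≤ 2 ^ S)
    (hX : ∀ i j, (X i j).natAbs ≤ 2 ^ S) (hZ : ∀ j, (Z j).natAbs ≤ 2 ^ S)
    (hb : ∀ j, 1 ≤ b j) (hgcd : ∀ g : ℤ, (∀ j, g ∣ b j) → g.natAbs = 1)
    (hD0 : 0 ≤ D) (hDm : D < scaleVal n p Rhat What)
    (hD : 2 ^ (p + n + n - 1) * (b ⬝ᵥ b + (Y + X *ᵥ Z - X *ᵥ b) ⬝ᵥ (Y + X *ᵥ Z - X *ᵥ b)) ≤ D ^ 2)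
    (hY1 : ∀ i, 3 ≤ ((Y + X *ᵥ Z) i).natAbs)
    (hkey : ∀ (z1 : Fin p → ℤ) (z2 z3 : Fin n → ℤ), (∀ j, |z1 j| ≤ D) → (∀ i, |z3 i| ≤ D) →
      (∀ i, (X *ᵥ z1) i + z3 i = (Y + X *ᵥ Z) i * z2 i) → (z1 ≠ 0 ∨ z2 ≠ 0 ∨ z3 ≠ 0) →
      ∃ r : ℤ, r ≠ 0 ∧ ∀ j, z1 j = r * b j) :
    ∃ fuel, Spec (elo fuel Y X Rhat What Z) (S ^ 47) fun o => o = some fun j => b j - Z j := by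
  have hlt : S ≤ 2 ^ S := Nat.lt_two_pow_self.le
  have op : ∀ x, x ≤ 90 * S → (x + 4) ^ 3 ≤ S ^ 6 := fun x => smallOp_le hS
  have op' : ∀ x, x ≤ 90 * S + 4 → x ^ 3 ≤ S ^ 6 := fun x hx =>
    (Nat.pow_le_pow_left (by omega) 3).trans (op (90 * S) le_rfl)
  set Y1 := Y + X *ᵥ Z with hY1def
  set m : ℤ := ((scaleVal n p Rhat What : ℕ) : ℤ) with hm
  have hm0 : 0 < m := by omega
  have hmS : m.natAbs ≤ 2 ^ (5 * S) := by
    rw [hm, Int.natAbs_natCast]; exact scaleVal_le hnp hR hW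
  have hY1S : ∀ i, (Y1 i).natAbs ≤ 2 ^ (4 * S) := fun i => by
    have h := (Spec.shift hS (by omega) hY hX hZ i).2
    rw [h.1] at h
    exact h.2
  set A := latticeMatrix m X Y1 with hA
  have hAS : ∀ r c, (A r c).natAbs ≤ 2 ^ (9 * S) := by
    refine natAbs_latticeMatrix_le m X Y1 (fun i j => ?_) (fun i => ?_) ?_
    · rw [Int.natAbs_mul]
      refine (Nat.mul_le_mul hmS (hX i j)).trans ?_
      rw [← pow_add]; exact Nat.pow_le_pow_right (by norm_num) (by omega)
    · rw [Int.natAbs_mul]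
      refine (Nat.mul_le_mul hmS (hY1S i)).trans ?_
      rw [← pow_add]; exact Nat.pow_le_pow_right (by norm_num) (by omega)
    · exact hmS.trans (Nat.pow_le_pow_right (by norm_num) (by omega))
  have hG : ∀ c, (fun r => A r c) ⬝ᵥ (fun r => A r c) ≤ 2 ^ (S ^ 2) := by
    intro c
    have h1 : ∀ r, A r c * A r c ≤ 2 ^ (18 * S) := fun r => by
      rw [← Int.natAbs_mul_self' (A r c)]
      have := Nat.mul_le_mul (hAS r c) (hAS r c)
      rw [← pow_add] at this
      have e : 9 * S + 9 * S = 18 * S := by ring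
      rw [e] at this
      exact_mod_cast this
    calc (fun r => A r c) ⬝ᵥ (fun r => A r c) ≤ (n + p + n : ℕ) • (2 : ℤ) ^ (18 * S) := by
          refine (Finset.sum_le_card_nsmul _ _ _ fun r _ => h1 r).trans_eq (by simp)
      _ = ((n + p + n) * 2 ^ (18 * S) : ℕ) := by simp
      _ ≤ (2 ^ S * 2 ^ (18 * S) : ℕ) := by gcongr; omega
      _ ≤ ((2 ^ (S ^ 2) : ℕ) : ℤ) := by
          rw [← pow_add]
          have : S + 18 * S ≤ S ^ 2 := by nlinarith
          exact_mod_cast Nat.pow_le_pow_right (by norm_num) this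
      _ = 2 ^ (S ^ 2) := by push_cast; rfl
  obtain ⟨fuel, hlll⟩ := exists_spec_lll hS (d := n + p + n) (k := p + n + n) (by omega) (by omega)
    (by omega) (fun c r => A r c) (linearIndependent_latticeMatrix X hm0.ne' fun i h => by
      have := hY1 i; rw [h] at this; simp at this) hG
  refine ⟨fuel, ?_⟩
  -- the short lattice vector that encodes the solution has the coefficients `b`, `1` and the residual
  obtain ⟨x, hxA, hx0, hxx⟩ : ∃ x, (∃ y, x = A *ᵥ y) ∧ x ≠ 0 ∧
      x ⬝ᵥ x = b ⬝ᵥ b + (Y1 - X *ᵥ b) ⬝ᵥ (Y1 - X *ᵥ b) := by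
    let y : Fin (p + n + n) → ℤ := Fin.append (Fin.append b 1) (Y1 - X *ᵥ b)
    have e1 : ∀ i, (A *ᵥ y) (Fin.castAdd n (Fin.castAdd p i)) = 0 := fun i => by
      rw [hA, latticeMatrix_mulVec_error]
      simp only [y, Fin.append_left, Fin.append_right, Pi.one_apply, mul_one, Pi.sub_apply]
      have : ∑ j, X i j * b j = (X *ᵥ b) i := rfl
      rw [this]; ring
    have e2 : ∀ j, (A *ᵥ y) (Fin.castAdd n (Fin.natAdd n j)) = b j := fun j => by
      rw [hA, latticeMatrix_mulVec_coeff]; simp [y]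
    have e3 : ∀ i, (A *ᵥ y) (Fin.natAdd (n + p) i) = (Y1 - X *ᵥ b) i := fun i => by
      rw [hA, latticeMatrix_mulVec_noise]; simp only [y, Fin.append_right]
    refine ⟨A *ᵥ y, ⟨y, rfl⟩, fun h0 => ?_, ?_⟩
    · have h1 := e2 ⟨0, hp⟩
      rw [h0] at h1
      have h2 := hb ⟨0, hp⟩
      rw [← h1] at h2
      simp at h2
    · simp only [dotProduct, Fin.sum_univ_add, e1, e2, e3]
      simp
  have hcost : p + p * S ^ 6 + (n + n * (p * (S ^ 6 + S ^ 6)) + (n + n * S ^ 6 + (S ^ 7 +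
      (p + n + n + (p + n + n) * (n + p + n + (n + p + n) * S ^ 6) + (S ^ 46 +
      (p * ((2 * (5 * S) + 2) * (2 * (5 * S) + 4) ^ 3) +
        (p + p * (S ^ 6 + S ^ 6) + 0))))))) ≤ S ^ 47 := by
    have h6 : 1 ≤ S ^ 6 := Nat.one_le_pow _ _ (by omega)
    have hop := op (10 * S) (by omega)
    have e : 2 * (5 * S) = 10 * S := by ring
    rw [e]
    calc _ ≤ S * S ^ 6 + S * S ^ 6 + (S * S ^ 6 + S * (S * (S ^ 6 + S ^ 6)) + (S * S ^ 6 +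
          S * S ^ 6 + (S ^ 7 +
          (S * S ^ 6 + S * (S * S ^ 6 + S * S ^ 6) + (S ^ 46 +
          (S * ((10 * S + 2 * S) * S ^ 6) + (S * S ^ 6 + S * (S ^ 6 + S ^ 6) + 0))))))) := by
          gcongr <;> first | omega | nlinarith
      _ = 10 * S ^ 7 + 16 * S ^ 8 + S ^ 46 := by ring
      _ ≤ 10 * S ^ 46 + 16 * S ^ 46 + S ^ 46 := by
          gcongr <;> omega
      _ ≤ S ^ 47 := by rw [pow_succ S 46]; nlinarith [Nat.zero_le (S ^ 46)]
  refine Spec.mono ?_ hcost fun _ h => h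
  unfold elo
  refine (Spec.fill (C := S ^ 6) (P := fun _ _ => True) fun j =>
    Spec.charge (op' _ ?_) trivial).bind fun _ _ => ?_
  · have := bits_le (hZ j); omega
  refine (Spec.fill fun i => Spec.shift hS (by omega) hY hX hZ i).bind fun Y1' hY1' => ?_
  obtain rfl : Y1' = Y1 := funext fun i => (hY1' i).1
  refine (Spec.fill (C := S ^ 6) (P := fun i v => v = Y1 i) fun i => Spec.charge (op' _ ?_) ?_).bind
    fun Y2 hY2 => ?_
  · have := bits_le (hY1S i); omega
  · rw [if_neg (by have := hY1 i; omega)]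
  obtain rfl : Y2 = Y1 := funext hY2
  refine (Spec.scale hS hnp hR hW).bind ?_
  rintro _ rfl
  refine (Spec.fill (P := fun c v => ∀ r, v r = A r c) fun c =>
    Spec.fill (C := S ^ 6) (P := fun r v => v = A r c) fun r => Spec.charge (op' _ ?_) rfl).bind
      fun B hB => ?_
  · have h1 := bits_le hmS; have h2 := bits_le (hAS r c)
    change bits m + bits (A r c) ≤ _
    omega
  obtain rfl : B = fun c r => A r c := funext fun c => funext fun r => hB c r
  refine hlll.bind ?_
  rintro _ ⟨z, rfl, hz, hz0, hzmin⟩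
  rw [mem_span_columns] at hz
  obtain ⟨y, rfl⟩ := hz
  have hzD : ∀ r, |(A *ᵥ y) r| ≤ D := by
    refine abs_le_of_dotProduct_le_sq hD0 ?_
    refine (hzmin x ((mem_span_columns A x).2 hxA) hx0).trans ?_
    rw [hxx]; exact hD
  -- the errors of the equations are multiples of `m > D`, so they vanish
  have herr : ∀ i, ∑ j, X i j * y (Fin.castAdd n (Fin.castAdd n j)) -
      Y1 i * y (Fin.castAdd n (Fin.natAdd p i)) + y (Fin.natAdd (p + n) i) = 0 := fun i => by
    have h1 := hzD (Fin.castAdd n (Fin.castAdd p i))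
    rw [hA, latticeMatrix_mulVec_error, abs_mul, abs_of_pos hm0] at h1
    by_contra h2
    have h3 := Int.one_le_abs h2
    nlinarith
  obtain ⟨r, hr0, hr⟩ := hkey (fun j => y (Fin.castAdd n (Fin.castAdd n j)))
    (fun i => y (Fin.castAdd n (Fin.natAdd p i))) (fun i => y (Fin.natAdd (p + n) i))
    (fun j => by
      have := hzD (Fin.castAdd n (Fin.natAdd n j))
      rwa [hA, latticeMatrix_mulVec_coeff] at this)
    (fun i => by
      have := hzD (Fin.natAdd (n + p) i)
      rwa [hA, latticeMatrix_mulVec_noise] at this)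
    (fun i => by
      have h1 := herr i
      have h2 : (X *ᵥ fun j => y (Fin.castAdd n (Fin.castAdd n j))) i =
        ∑ j, X i j * y (Fin.castAdd n (Fin.castAdd n j)) := rfl
      rw [h2]
      linarith)
    (by
      by_contra hcon
      push Not at hcon
      obtain ⟨h1, h2, h3⟩ := hcon
      refine hz0 ?_
      have : y = 0 := funext (col_cases (fun j => congrFun h1 j) (fun i => congrFun h2 i)
        fun i => congrFun h3 i)
      rw [this, mulVec_zero])
  have hzr : ∀ j, (A *ᵥ y) (Fin.castAdd n (Fin.natAdd n j)) = r * b j := fun j => by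
    rw [hA, latticeMatrix_mulVec_coeff]; exact hr j
  have hzS : ∀ j, ((A *ᵥ y) (Fin.castAdd n (Fin.natAdd n j))).natAbs ≤ 2 ^ (5 * S) := fun j => by
    have h1 := hzD (Fin.castAdd n (Fin.natAdd n j))
    rw [Int.abs_eq_natAbs] at h1
    have h2 : (m.natAbs : ℤ) = m := Int.natAbs_of_nonneg hm0.le
    omega
  have hrS : r.natAbs ≤ 2 ^ (5 * S) := by
    refine le_trans ?_ (hzS ⟨0, hp⟩)
    rw [hzr, Int.natAbs_mul]
    refine Nat.le_mul_of_pos_right _ ?_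
    have := hb ⟨0, hp⟩
    omega
  refine (Spec.foldlM_euclid hzr (fun j => (by have := hb j; omega)) hgcd hzS).bind ?_
  rintro g hg
  rw [hg, if_neg hr0]
  refine (Spec.fill (C := S ^ 6 + S ^ 6) (P := fun j v => v = b j - Z j) fun j => ?_).bind ?_
  · have hdiv : (A *ᵥ y) (Fin.castAdd n (Fin.natAdd n j)) / r = b j := by
      rw [hzr, Int.mul_ediv_cancel_left _ hr0]
    refine ((Spec.idiv (hzS j) hrS).mono (op (5 * S + 5 * S) (by omega)) fun _ h => h).bind ?_
    rintro _ rfl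
    rw [hdiv]
    refine (Spec.isub (s := 5 * S) ?_ (hZ j)).mono (op (5 * S + S) (by omega)) fun _ h => h
    refine le_trans ?_ (hzS j)
    rw [hzr, Int.natAbs_mul]
    exact Nat.le_mul_of_pos_left _ (Int.natAbs_pos.2 hr0)
  · intro out hout
    obtain rfl : out = fun j => b j - Z j := funext hout
    exact Spec.pure rfl

end ELO

end LatticeRegression

namespace LatticeRegression

section LBR

open Matrix

variable {n p S : ℕ}

theorem abs_truncInt_sub_le (N : ℕ) (x : ℝ) : |(truncInt N x : ℝ) - 2 ^ N * x| ≤ 1 := by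
  have h1 := Int.floor_le ((2 : ℝ) ^ N * |x|)
  have h2 := Int.lt_floor_add_one ((2 : ℝ) ^ N * |x|)
  unfold truncInt
  rw [abs_le]
  rcases lt_trichotomy x 0 with h | h | h
  · have e : (SignType.sign x : ℤ) = -1 := by rw [sign_neg h]; rfl
    rw [abs_of_neg h] at *
    rw [e]
    push_cast
    constructor <;> linarith
  · subst h; simp
  · have e : (SignType.sign x : ℤ) = 1 := by rw [sign_pos h]; rfl
    rw [abs_of_pos h] at *
    rw [e]
    push_cast
    constructor <;> linarith

theorem abs_truncInt_le (N : ℕ) (x : ℝ) : |(truncInt N x : ℝ)| ≤ 2 ^ N * |x| := by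
  have h0 : 0 ≤ (2 : ℝ) ^ N * |x| := by positivity
  have h1 := Int.floor_le ((2 : ℝ) ^ N * |x|)
  have h2 : 0 ≤ ⌊(2 : ℝ) ^ N * |x|⌋ := Int.floor_nonneg.2 h0
  have h3 : |((SignType.sign x : ℤ) : ℝ)| ≤ 1 := by
    rcases lt_trichotomy x 0 with h | h | h
    · simp [sign_neg h]
    · simp [h]
    · simp [sign_pos h]
  unfold truncInt
  rw [Int.cast_mul]
  have h4 : (0 : ℝ) ≤ (⌊(2 : ℝ) ^ N * |x|⌋ : ℝ) := by exact_mod_cast h2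
  rw [abs_mul, abs_of_nonneg h4]
  exact (mul_le_of_le_one_left h4 h3).trans h1

/-- LBR spends only polynomially many bit operations outside of ELO. -/
theorem exists_spec_lbr {Y : Fin n → ℝ} {X : Matrix (Fin n) (Fin p) ℝ} {N Q R : ℕ}
    {Z β1 : Fin p → ℤ} (hS : 100 ≤ S) (hnp : 2 * n + p + 10 ≤ S) (hN : N ≤ S)
    (hQ : Q ≤ 2 ^ S) (hR : R ≤ 2 ^ S)
    (hY : ∀ i, (truncInt N (Y i)).natAbs ≤ 2 ^ S) (hX : ∀ i j, (truncInt N (X i j)).natAbs ≤ 2 ^ S)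
    (hβ : ∀ j, (β1 j).natAbs ≤ 2 ^ S)
    (helo : ∃ fuel, Spec (elo fuel (fun i => Q * truncInt N (Y i)) (fun i j => truncInt N (X i j))
      (Q * R) (2 * Q * (2 ^ N * 1 + R * p)) Z) (S ^ 47) fun o => o = some β1) :
    ∃ fuel, Spec (lbr fuel Y X N Q R 1 Z) (S ^ 48) fun o =>
      o = some fun j => (β1 j : ℚ) / Q := by
  obtain ⟨fuel, helo⟩ := helo
  refine ⟨fuel, ?_⟩
  have op : ∀ x, x ≤ 90 * S + 4 → x ^ 3 ≤ S ^ 6 := fun x hx =>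
    (Nat.pow_le_pow_left (by omega) 3).trans (smallOp_le (x := 90 * S) hS le_rfl)
  have bQ : bits (Q : ℤ) ≤ S + 2 := bits_le (by simpa using hQ)
  have bR : bits (R : ℤ) ≤ S + 2 := bits_le (by simpa using hR)
  have hcost : n + n * (S ^ 6 + S ^ 6) + (n + n * (p + p * S ^ 6) + (S ^ 6 + (S ^ 6 + (S ^ 47 +
      (p + p * S ^ 6 + 0))))) ≤ S ^ 48 := by
    have h6 : 1 ≤ S ^ 6 := Nat.one_le_pow _ _ (by omega)
    calc _ ≤ S * S ^ 6 + S * (S ^ 6 + S ^ 6) + (S * S ^ 6 + S * (S * S ^ 6 + S * S ^ 6) + (S ^ 6 +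
          (S ^ 6 + (S ^ 47 + (S * S ^ 6 + S * S ^ 6 + 0))))) := by
          gcongr <;> first | omega | nlinarith
      _ = 2 * S ^ 6 + 6 * S ^ 7 + 2 * S ^ 8 + S ^ 47 := by ring
      _ ≤ 2 * S ^ 47 + 6 * S ^ 47 + 2 * S ^ 47 + S ^ 47 := by gcongr <;> omega
      _ ≤ S ^ 48 := by rw [pow_succ S 47]; nlinarith [Nat.zero_le (S ^ 47)]
  refine Spec.mono ?_ hcost fun _ h => h
  unfold lbr
  refine (Spec.fill (P := fun i v => v = Q * truncInt N (Y i)) fun i => ?_).bind fun YN hYN => ?_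
  · refine (Spec.charge (C := S ^ 6) (P := fun v => v = truncInt N (Y i)) (op _ ?_) rfl).bind ?_
    · have := bits_le (hY i); omega
    rintro _ rfl
    refine (Spec.imul (s := S) (by simpa using hQ) (hY i)).mono (op _ ?_) fun _ h => h
    omega
  obtain rfl : YN = fun i => Q * truncInt N (Y i) := funext hYN
  refine (Spec.fill (P := fun i v => ∀ j, v j = truncInt N (X i j)) fun i =>
    Spec.fill (P := fun j v => v = truncInt N (X i j)) fun j =>
      Spec.charge (C := S ^ 6) (op _ ?_) rfl).bind fun XN hXN => ?_
  · have := bits_le (hX i j); omega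
  obtain rfl : XN = fun i j => truncInt N (X i j) := funext fun i => funext fun j => hXN i j
  refine (Spec.charge (C := S ^ 6) (P := fun v => v = Q * R) (op _ (by omega)) rfl).bind ?_
  rintro _ rfl
  refine (Spec.charge (C := S ^ 6) (P := fun v => v = 2 * Q * (2 ^ N * 1 + R * p)) (op _ ?_)
    rfl).bind ?_
  · have b1 : bits ((1 : ℕ) : ℤ) = 2 := by decide
    rw [b1]; omega
  rintro _ rfl
  refine helo.bind ?_
  rintro _ rfl
  refine (Spec.fill (C := S ^ 6) (P := fun j v => v = (β1 j : ℚ) / Q) fun j => ?_).bind ?_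
  · have sb : Small S (β1 j : ℚ) := Small.intCast (hβ j)
    have sq : Small S (Q : ℚ) := by
      have := Small.intCast (z := (Q : ℤ)) (t := S) (by simpa using hQ)
      simpa using this
    exact (Spec.rdiv sb sq).mono (op _ (by omega)) fun _ h => h
  · intro out hout
    obtain rfl : out = fun j => (β1 j : ℚ) / Q := funext hout
    exact Spec.pure rfl

theorem LBRTerminates.of_spec {Y : Fin n → ℝ} {X : Matrix (Fin n) (Fin p) ℝ} {N Q R C : ℕ}
    {Z : Fin p → ℤ} {out : Fin p → ℚ}
    (h : ∃ fuel, Spec (lbr fuel Y X N Q R 1 Z) C fun o => o = some out) :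
    ∃ t ≤ C, LBRTerminates Y X N Q R 1 Z out t := by
  obtain ⟨fuel, h1, h2⟩ := h
  refine ⟨_, h1, fuel, ?_⟩
  rw [← h2]

end LBR

/-! ### Success of LBR on typical inputs -/

section Good

open Matrix

variable {n p N Q R : ℕ}

/-- Bound for the entries of the vector found by LLL: the factor `2 ^ ((p + 2 n) / 2)` of LLL times a
bound for the length of the lattice vector that encodes the solution. -/
def lengthBound (n p Q R : ℕ) : ℕ :=
  2 ^ ((p + 2 * n + 1) / 2) * (Q * R) * (p + 2 * n) ^ 3

/-- Typical inputs for the vector of shifts `ζ`, with `B` the integral vector `Q β`: the entries of `X`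
and the noise are not large, no observation of the shifted solution `B + ζ` is close to zero, the
coordinates of `B + ζ` are coprime, and only the multiples of `B + ζ` satisfy, up to rounding, the
linear equations that short lattice vectors satisfy. -/
structure Good (N Q R : ℕ) (X : Matrix (Fin n) (Fin p) ℝ) (W : Fin n → ℝ) (B ζ : Fin p → ℤ) :
    Prop where
  entry_le : ∀ i j, |X i j| ≤ ((p + 2 * n : ℕ) : ℝ) ^ 4
  noise_le : ∀ i, 2 ^ N * |W i| ≤ (n : ℝ) * p
  le_obs : ∀ i, 2 / ((p + 2 * n : ℕ) : ℝ) ^ 4 ≤ |∑ j, X i j * ((B j + ζ j : ℤ) : ℝ) + Q * W i|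
  gcd_eq : ∀ g : ℤ, (∀ j, g ∣ B j + ζ j) → g.natAbs = 1
  unique : ∀ (z1 : Fin p → ℤ) (z2 : Fin n → ℤ), (∀ j, |z1 j| ≤ lengthBound n p Q R) →
    (∀ i, |z2 i| ≤ ((p + 2 * n) ^ 10 * lengthBound n p Q R : ℕ)) →
    (∀ i, |2 ^ N * ∑ j, X i j * ((z1 j - z2 i * (B j + ζ j) : ℤ) : ℝ) - z2 i * (2 ^ N * Q * W i)| ≤
      ((p + 2 * n : ℕ) : ℝ) * lengthBound n p Q R +
        |(z2 i : ℝ)| * (Q * R * ((p + 2 * n : ℕ) : ℝ) ^ 2)) →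
    ∃ r : ℤ, ∀ j, z1 j = r * (B j + ζ j)

/-- The integral matrix of the truncated entries. -/
noncomputable def truncMatrix (N : ℕ) (X : Matrix (Fin n) (Fin p) ℝ) : Matrix (Fin n) (Fin p) ℤ :=
  fun i j => truncInt N (X i j)

theorem abs_truncInt_mulVec_sub_le (X : Matrix (Fin n) (Fin p) ℝ) (i : Fin n) {v : Fin p → ℤ}
    {K : ℝ} (hv : ∀ j, |(v j : ℝ)| ≤ K) :
    |((truncMatrix N X *ᵥ v) i : ℝ) - 2 ^ N * ∑ j, X i j * v j| ≤ p * K := by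
  have h1 : ((truncMatrix N X *ᵥ v) i : ℝ) - 2 ^ N * ∑ j, X i j * v j =
      ∑ j, ((truncMatrix N X i j : ℝ) - 2 ^ N * X i j) * v j := by
    simp only [mulVec, dotProduct, Int.cast_sum, Int.cast_mul, Finset.mul_sum, sub_mul,
      Finset.sum_sub_distrib, mul_assoc]
  rw [h1]
  refine (Finset.abs_sum_le_sum_abs _ _).trans ?_
  refine (Finset.sum_le_card_nsmul _ _ K fun j _ => ?_).trans_eq (by simp)
  rw [abs_mul]
  have h2 := abs_truncInt_sub_le N (X i j)
  exact (mul_le_of_le_one_left (abs_nonneg _) h2).trans (hv j)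

/-- The multiplier of a large observation in a lattice vector is bounded. -/
theorem Good.abs_le_of_eq {X : Matrix (Fin n) (Fin p) ℝ} {W : Fin n → ℝ} {B ζ : Fin p → ℤ}
    (h : Good N Q R X W B ζ) (hn : 0 < n) {k D : ℕ} (hk : k = p + 2 * n) {z1 : Fin p → ℤ}
    {z2 z3 Y1 : Fin n → ℤ} (r1 : ∀ j, |(z1 j : ℝ)| ≤ D) (r3 : ∀ i, |(z3 i : ℝ)| ≤ D)
    (hY1 : ∀ i, 2 ^ N / (k : ℝ) ^ 4 ≤ |(Y1 i : ℝ)|)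
    (req : ∀ i, ((truncMatrix N X *ᵥ z1) i : ℝ) + z3 i = (Y1 i : ℝ) * (z2 i : ℝ)) (i : Fin n) :
    |z2 i| ≤ (k ^ 10 * D : ℕ) := by
  have kpos : (0 : ℝ) < k := by exact_mod_cast (by omega : 0 < k)
  have r2N : (0 : ℝ) < 2 ^ N := by positivity
  have hXhle : ∀ i j, |(truncMatrix N X i j : ℝ)| ≤ 2 ^ N * (k : ℝ) ^ 4 := fun i j => by
    rw [hk]
    exact (abs_truncInt_le N (X i j)).trans (mul_le_mul_of_nonneg_left (h.entry_le i j) r2N.le)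
  have e1 : |((truncMatrix N X *ᵥ z1) i : ℝ)| ≤ p * (2 ^ N * (k : ℝ) ^ 4 * D) := by
    simp only [mulVec, dotProduct, Int.cast_sum, Int.cast_mul]
    refine (Finset.abs_sum_le_sum_abs _ _).trans ?_
    refine (Finset.sum_le_card_nsmul _ _ (2 ^ N * (k : ℝ) ^ 4 * D) fun j _ => ?_).trans_eq
      (by simp)
    rw [abs_mul]
    exact mul_le_mul (hXhle i j) (r1 j) (abs_nonneg _) (by positivity)
  have e2 : 2 ^ N / (k : ℝ) ^ 4 * |(z2 i : ℝ)| ≤ p * (2 ^ N * (k : ℝ) ^ 4 * D) + D := by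
    refine (mul_le_mul_of_nonneg_right (hY1 i) (abs_nonneg _)).trans ?_
    rw [← abs_mul, ← req i]
    exact (abs_add_le _ _).trans (add_le_add e1 (r3 i))
  have e3 : (1 : ℝ) ≤ 2 ^ N := one_le_pow₀ (by norm_num)
  have e4 : (p : ℝ) * (k : ℝ) ^ 4 + 1 ≤ (k : ℝ) ^ 6 := by
    have : p * k ^ 4 + 1 ≤ k ^ 6 := by
      have : 1 ≤ k ^ 4 := Nat.one_le_pow _ _ (by omega)
      calc p * k ^ 4 + 1 ≤ p * k ^ 4 + k ^ 4 := by omega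
        _ = (p + 1) * k ^ 4 := by ring
        _ ≤ k ^ 2 * k ^ 4 := by gcongr; nlinarith
        _ = k ^ 6 := by ring
    exact_mod_cast this
  have e5 : |(z2 i : ℝ)| ≤ (k : ℝ) ^ 4 * ((p * (k : ℝ) ^ 4 + 1) * D) := by
    have : 2 ^ N * |(z2 i : ℝ)| ≤ 2 ^ N * ((k : ℝ) ^ 4 * ((p * (k : ℝ) ^ 4 + 1) * D)) := by
      rw [div_mul_eq_mul_div, div_le_iff₀ (by positivity)] at e2
      have : (D : ℝ) ≤ 2 ^ N * D := le_mul_of_one_le_left (by positivity) e3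
      have : (D : ℝ) * (k : ℝ) ^ 4 ≤ 2 ^ N * D * (k : ℝ) ^ 4 :=
        mul_le_mul_of_nonneg_right this (by positivity)
      nlinarith
    exact le_of_mul_le_mul_left this r2N
  have e6 : |(z2 i : ℝ)| ≤ (k : ℝ) ^ 10 * D := by
    refine e5.trans ?_
    have : (k : ℝ) ^ 10 * D = (k : ℝ) ^ 4 * ((k : ℝ) ^ 6 * D) := by ring
    rw [this]
    gcongr
  exact_mod_cast e6

/-- A lattice vector satisfies the linear equations up to rounding errors. -/
theorem abs_equation_le {X : Matrix (Fin n) (Fin p) ℝ} {W : Fin n → ℝ} {B ζ : Fin p → ℤ}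
    (hn : 0 < n) {k D : ℕ} (hk : k = p + 2 * n) {z1 : Fin p → ℤ}
    {z2 z3 Y1 : Fin n → ℤ} (r1 : ∀ j, |(z1 j : ℝ)| ≤ D) (r3 : ∀ i, |(z3 i : ℝ)| ≤ D)
    (hobs : ∀ i, |(Y1 i : ℝ) - 2 ^ N * (∑ j, X i j * ((B j + ζ j : ℤ) : ℝ) + Q * W i)| ≤
      Q * R * (k : ℝ) ^ 2)
    (req : ∀ i, ((truncMatrix N X *ᵥ z1) i : ℝ) + z3 i = (Y1 i : ℝ) * (z2 i : ℝ)) (i : Fin n) :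
    |2 ^ N * ∑ j, X i j * ((z1 j - z2 i * (B j + ζ j) : ℤ) : ℝ) - z2 i * (2 ^ N * Q * W i)| ≤
      (k : ℝ) * D + |(z2 i : ℝ)| * (Q * R * (k : ℝ) ^ 2) := by
  have e1 := abs_truncInt_mulVec_sub_le (N := N) X i r1
  have e2 : 2 ^ N * ∑ j, X i j * ((z1 j - z2 i * (B j + ζ j) : ℤ) : ℝ) -
      z2 i * (2 ^ N * Q * W i) =
      -(((truncMatrix N X *ᵥ z1) i : ℝ) - 2 ^ N * ∑ j, X i j * (z1 j : ℝ)) - z3 i +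
      z2 i * ((Y1 i : ℝ) - 2 ^ N * (∑ j, X i j * ((B j + ζ j : ℤ) : ℝ) + Q * W i)) := by
    have e3 : ∑ j, X i j * ((z1 j - z2 i * (B j + ζ j) : ℤ) : ℝ) =
        ∑ j, X i j * (z1 j : ℝ) - z2 i * ∑ j, X i j * ((B j + ζ j : ℤ) : ℝ) := by
      rw [Finset.mul_sum, ← Finset.sum_sub_distrib]
      refine Finset.sum_congr rfl fun j _ => ?_
      push_cast; ring
    rw [e3]
    have := req i
    linear_combination this
  rw [e2]
  have e4 := abs_add_le (-(((truncMatrix N X *ᵥ z1) i : ℝ) - 2 ^ N * ∑ j, X i j * (z1 j : ℝ)) - z3 i)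
    (z2 i * ((Y1 i : ℝ) - 2 ^ N * (∑ j, X i j * ((B j + ζ j : ℤ) : ℝ) + Q * W i)))
  have e5 := abs_sub (-(((truncMatrix N X *ᵥ z1) i : ℝ) - 2 ^ N * ∑ j, X i j * (z1 j : ℝ))) (z3 i : ℝ)
  rw [abs_neg] at e5
  rw [abs_mul] at e4
  have e6 := mul_le_mul_of_nonneg_left (hobs i) (abs_nonneg (z2 i : ℝ))
  have e7 : (p : ℝ) + 1 ≤ k := by exact_mod_cast (by omega : p + 1 ≤ k)
  have e8 : ((p : ℝ) + 1) * D ≤ k * D := mul_le_mul_of_nonneg_right e7 (by positivity)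
  have := r3 i
  linarith

/-- The equations of a lattice vector determine it up to a factor. -/
theorem Good.exists_multiple {X : Matrix (Fin n) (Fin p) ℝ} {W : Fin n → ℝ} {B ζ : Fin p → ℤ}
    (h : Good N Q R X W B ζ) (hn : 0 < n) {z1 : Fin p → ℤ} {z2 z3 Y1 : Fin n → ℤ}
    (hY1 : ∀ i, 2 ^ N / ((p + 2 * n : ℕ) : ℝ) ^ 4 ≤ |(Y1 i : ℝ)|)
    (hY1' : ∀ i, (lengthBound n p Q R : ℤ) < |Y1 i|)
    (hobs : ∀ i, |(Y1 i : ℝ) - 2 ^ N * (∑ j, X i j * ((B j + ζ j : ℤ) : ℝ) + Q * W i)| ≤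
      Q * R * ((p + 2 * n : ℕ) : ℝ) ^ 2)
    (h1 : ∀ j, |z1 j| ≤ lengthBound n p Q R) (h3 : ∀ i, |z3 i| ≤ lengthBound n p Q R)
    (heq : ∀ i, (truncMatrix N X *ᵥ z1) i + z3 i = Y1 i * z2 i) (hne : z1 ≠ 0 ∨ z2 ≠ 0 ∨ z3 ≠ 0) :
    ∃ r : ℤ, r ≠ 0 ∧ ∀ j, z1 j = r * (B j + ζ j) := by
  have r1 : ∀ j, |(z1 j : ℝ)| ≤ lengthBound n p Q R := fun j => by exact_mod_cast h1 j
  have r3 : ∀ i, |(z3 i : ℝ)| ≤ lengthBound n p Q R := fun i => by exact_mod_cast h3 i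
  have req : ∀ i, ((truncMatrix N X *ᵥ z1) i : ℝ) + z3 i = (Y1 i : ℝ) * (z2 i : ℝ) :=
    fun i => by exact_mod_cast heq i
  obtain ⟨r, hr⟩ := h.unique z1 z2 h1 (h.abs_le_of_eq hn rfl r1 r3 hY1 req)
    (abs_equation_le hn rfl r1 r3 hobs req)
  refine ⟨r, fun hr0 => ?_, hr⟩
  have hz1 : z1 = 0 := funext fun j => by rw [hr j, hr0, zero_mul]; rfl
  have hz2 : z2 = 0 := funext fun i => by
    by_contra hz
    have e1 := heq i
    rw [hz1, mulVec_zero, Pi.zero_apply, zero_add] at e1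
    have e2 := h3 i
    rw [e1, abs_mul] at e2
    have e3 := hY1' i
    have e4 : 1 ≤ |z2 i| := Int.one_le_abs hz
    nlinarith
  have hz3 : z3 = 0 := funext fun i => by
    have e1 := heq i
    rw [hz1, hz2, mulVec_zero, Pi.zero_apply, zero_add] at e1
    simpa using e1
  exact hne.elim (fun h => h hz1) fun h => h.elim (fun h => h hz2) fun h => h hz3

/-- The length of the lattice vector that encodes the solution, multiplied by the approximation factor
of LLL. -/
theorem length_sq_le {b : Fin p → ℤ} {w : Fin n → ℤ} (hn : 0 < n)
    (hb : ∀ j, |b j| ≤ (Q * R * (p + 2 * n) ^ 2 : ℕ))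
    (hw : ∀ i, |w i| ≤ (Q * R * (p + 2 * n) ^ 2 : ℕ)) :
    2 ^ (p + n + n - 1) * (b ⬝ᵥ b + w ⬝ᵥ w) ≤ (lengthBound n p Q R : ℤ) ^ 2 := by
  set k := p + 2 * n with hk
  set L := Q * R * k ^ 2 with hL
  have sq : ∀ {d : ℕ} (v : Fin d → ℤ), (∀ a, |v a| ≤ (L : ℕ)) → v ⬝ᵥ v ≤ d * (L : ℤ) ^ 2 :=
    fun v hv => (Finset.sum_le_card_nsmul _ _ ((L : ℤ) ^ 2) fun a _ => by
      rw [← abs_mul_abs_self, sq]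
      exact mul_le_mul (hv a) (hv a) (abs_nonneg _) (Nat.cast_nonneg _)).trans_eq (by simp)
  have h1 : (2 : ℤ) ^ (p + n + n - 1) ≤ 2 ^ (2 * ((k + 1) / 2)) :=
    pow_le_pow_right₀ (by norm_num) (by omega)
  have h2 : b ⬝ᵥ b + w ⬝ᵥ w ≤ (k : ℤ) * (L : ℤ) ^ 2 := by
    refine (add_le_add (sq b hb) (sq w hw)).trans ?_
    rw [← add_mul]
    exact mul_le_mul_of_nonneg_right (by rw [hk]; push_cast; linarith) (sq_nonneg _)
  have h3 : (k : ℤ) ≤ k ^ 2 := by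
    have : k ≤ k ^ 2 := Nat.le_self_pow (by norm_num) k
    exact_mod_cast this
  calc 2 ^ (p + n + n - 1) * (b ⬝ᵥ b + w ⬝ᵥ w)
      ≤ 2 ^ (2 * ((k + 1) / 2)) * ((k : ℤ) ^ 2 * (L : ℤ) ^ 2) := by
        refine mul_le_mul h1 (h2.trans (mul_le_mul_of_nonneg_right h3 (sq_nonneg _))) ?_
          (by positivity)
        exact add_nonneg (Finset.sum_nonneg fun a _ => mul_self_nonneg _)
          (Finset.sum_nonneg fun a _ => mul_self_nonneg _)
    _ = (lengthBound n p Q R : ℤ) ^ 2 := by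
        rw [lengthBound, ← hk, hL, pow_mul']
        push_cast
        ring

theorem natAbs_truncInt_le {x : ℝ} {t : ℕ} (h : |x| ≤ 2 ^ t) :
    (truncInt N x).natAbs ≤ 2 ^ (N + t) := by
  have h1 := (abs_truncInt_le N x).trans (mul_le_mul_of_nonneg_left h (by positivity))
  rw [← pow_add, ← Int.cast_abs, Int.abs_eq_natAbs] at h1
  exact_mod_cast h1

/-- The observations are not large. -/
theorem Good.abs_obs_le {X : Matrix (Fin n) (Fin p) ℝ} {W : Fin n → ℝ} {B ζ : Fin p → ℤ}
    {β : Fin p → ℝ} (h : Good N Q R X W B ζ) (hp : 0 < p) (hR : 0 < R) (hβ : ∀ j, |β j| ≤ R)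
    (i : Fin n) : |X.mulVec β i + W i| ≤ 2 ^ (1 + 5 * (p + 2 * n) + Nat.size R) := by
  set k := p + 2 * n with hk
  have hk2 : (k : ℝ) ≤ 2 ^ k := by exact_mod_cast Nat.lt_two_pow_self.le
  have hR2 : (R : ℝ) ≤ 2 ^ Nat.size R := by exact_mod_cast (Nat.lt_size_self R).le
  have hR1 : (1 : ℝ) ≤ R := by exact_mod_cast hR
  have k1 : (1 : ℝ) ≤ k := by exact_mod_cast (by omega : 1 ≤ k)
  have h1 : |X.mulVec β i| ≤ p * ((k : ℝ) ^ 4 * R) := by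
    simp only [mulVec, dotProduct]
    refine (Finset.abs_sum_le_sum_abs _ _).trans ?_
    refine (Finset.sum_le_card_nsmul _ _ ((k : ℝ) ^ 4 * R) fun j _ => ?_).trans_eq (by simp)
    rw [abs_mul]
    exact mul_le_mul (h.entry_le i j) (hβ j) (abs_nonneg _) (by positivity)
  have h2 : |W i| ≤ (k : ℝ) ^ 5 := by
    have h3 : |W i| ≤ 2 ^ N * |W i| :=
      le_mul_of_one_le_left (abs_nonneg _) (one_le_pow₀ (by norm_num))
    have h4 : (n : ℝ) * p ≤ k ^ 5 := by
      have : n * p ≤ k ^ 5 := by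
        calc n * p ≤ k * k := Nat.mul_le_mul (by omega) (by omega)
          _ = k ^ 2 := (sq k).symm
          _ ≤ k ^ 5 := Nat.pow_le_pow_right (by omega) (by norm_num)
      exact_mod_cast this
    exact h3.trans ((h.noise_le i).trans h4)
  have hpk : (p : ℝ) ≤ k := by exact_mod_cast (by omega : p ≤ k)
  calc |X.mulVec β i + W i| ≤ p * ((k : ℝ) ^ 4 * R) + (k : ℝ) ^ 5 :=
        (abs_add_le _ _).trans (add_le_add h1 h2)
    _ ≤ k * ((k : ℝ) ^ 4 * R) + (k : ℝ) ^ 5 * R := by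
        gcongr
        exact le_mul_of_one_le_right (by positivity) hR1
    _ = 2 * (k : ℝ) ^ 5 * R := by ring
    _ ≤ 2 * (2 ^ k) ^ 5 * 2 ^ Nat.size R := by gcongr
    _ = 2 ^ (1 + 5 * k + Nat.size R) := by
        rw [← pow_mul, ← pow_succ', ← pow_add]
        congr 1
        omega

theorem two_mul_add_le_two_pow {q x p k : ℕ} (hq : q ≤ 2 ^ x) (hp : p ≤ k) :
    2 * q + p ≤ 2 ^ (x + k + 2) := by
  have e : 2 ^ (x + k + 2) = 4 * (2 ^ x * 2 ^ k) := by rw [pow_add, pow_add]; ring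
  have h1 : p ≤ 2 ^ k := hp.trans Nat.lt_two_pow_self.le
  have h2 : 2 ^ x ≤ 2 ^ x * 2 ^ k := Nat.le_mul_of_pos_right _ (by positivity)
  have h3 : 2 ^ k ≤ 2 ^ x * 2 ^ k := Nat.le_mul_of_pos_left _ (by positivity)
  omega

theorem three_mul_add_le {q p k : ℕ} (hq : 1 ≤ q) (hp : p + 2 ≤ k) : 3 * q + p ≤ q * k ^ 2 := by
  have h1 : (p + 2) ^ 2 ≤ k ^ 2 := Nat.pow_le_pow_left hp 2
  have h2 : 3 + p ≤ k ^ 2 := by nlinarith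
  nlinarith

theorem noiseBound_le_two_pow {Q R q r p k : ℕ} (hQ : Q ≤ 2 ^ q) (hR : R ≤ 2 ^ r) (hp : p ≤ k) :
    2 * Q * (2 ^ N * 1 + R * p) ≤ 2 ^ (1 + q + (N + r + k + 1)) := by
  have e : 2 ^ (1 + q + (N + r + k + 1)) = 2 * 2 ^ q * (2 * (2 ^ N * 2 ^ r * 2 ^ k)) := by
    simp only [pow_add]; ring
  rw [e]
  refine Nat.mul_le_mul (Nat.mul_le_mul_left _ hQ) ?_
  have h1 : 1 ≤ 2 ^ N := Nat.one_le_two_pow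
  have h2 : 1 ≤ 2 ^ r := Nat.one_le_two_pow
  have h3 : 1 ≤ 2 ^ k := Nat.one_le_two_pow
  have h4 : 2 ^ N * 1 ≤ 2 ^ N * 2 ^ r * 2 ^ k := by
    rw [mul_assoc]; exact Nat.mul_le_mul_left _ (Nat.mul_pos h2 h3)
  have h5 : R * p ≤ 2 ^ N * 2 ^ r * 2 ^ k :=
    Nat.mul_le_mul (hR.trans (Nat.le_mul_of_pos_left _ h1)) (hp.trans Nat.lt_two_pow_self.le)
  omega

theorem two_pow_le_scaleVal (hn : 0 < n) (hp : 0 < p) (hQ : 0 < Q) :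
    2 ^ N ≤ scaleVal n p (Q * R) (2 * Q * (2 ^ N * 1 + R * p)) := by
  have hc : 1 ≤ ceilSqrt n := by unfold ceilSqrt; rw [if_neg hn.ne']; omega
  have h0 : 2 ^ N ≤ 2 ^ N * 1 + R * p := by omega
  have h1 : 2 ^ N ≤ 2 * Q * (2 ^ N * 1 + R * p) * ceilSqrt n := by
    rw [mul_right_comm]
    exact h0.trans (Nat.le_mul_of_pos_left _ (by positivity))
  unfold scaleVal
  refine (h1.trans (Nat.le_add_left _ _)).trans (Nat.le_mul_of_pos_left _ (by positivity))

set_option maxHeartbeats 1000000 in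
/-- On typical inputs LBR recovers `B / Q` in polynomial time. -/
theorem Good.exists_lbrTerminates {X : Matrix (Fin n) (Fin p) ℝ} {W : Fin n → ℝ} {B ζ : Fin p → ℤ}
    {β : Fin p → ℝ} {S : ℕ} (h : Good N Q R X W B ζ) (hn : 0 < n) (hp : 0 < p) (hQ : 0 < Q)
    (hR : 0 < R) (hB : ∀ j, |B j| ≤ Q * R) (hζ : ∀ j, ζ j ∈ shiftRange p (Q * R))
    (hN : (p + 2 * n) ^ 4 * lengthBound n p Q R < 2 ^ N) (hβ : ∀ j, β j = B j / Q)
    (hS : 100 + N + 10 * (p + 2 * n) + Nat.size Q + Nat.size R ≤ S) :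
    ∃ t ≤ S ^ 48, LBRTerminates (fun i => X.mulVec β i + W i) X N Q R 1 ζ
      (fun j => (B j : ℚ) / Q) t := by
  set k := p + 2 * n with hk
  set D := lengthBound n p Q R with hD
  have hk3 : 3 ≤ k := by omega
  have hQR : 1 ≤ Q * R := Nat.mul_pos hQ hR
  have hlog : Nat.log 2 p ≤ p := Nat.log_le_self 2 p
  have hζ1 : ∀ j, Q * R + 1 ≤ ζ j := fun j => by
    have := (Finset.mem_Icc.1 (hζ j)).1
    push_cast at this; exact this
  have hζ2 : ∀ j, ζ j ≤ 2 * (Q * R) + p := fun j => by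
    have := (Finset.mem_Icc.1 (hζ j)).2
    push_cast at this
    have h2 : (Nat.log 2 p : ℤ) ≤ p := by exact_mod_cast hlog
    linarith
  have hb1 : ∀ j, 1 ≤ B j + ζ j := fun j => by
    have := (abs_le.1 (hB j)).1; have := hζ1 j; linarith
  have hb2 : ∀ j, B j + ζ j ≤ 3 * (Q * R) + p := fun j => by
    have := (abs_le.1 (hB j)).2; have := hζ2 j; linarith
  have hk2 : 1 + p + n * p ≤ k ^ 2 := by rw [hk]; nlinarith
  have hk2' : (p + 1) ^ 2 ≤ k ^ 2 := Nat.pow_le_pow_left (by omega) 2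
  have hqD : Q * R * k ^ 3 ≤ D := by
    rw [hD, lengthBound, ← hk, mul_assoc (2 ^ _)]
    exact Nat.le_mul_of_pos_left _ (by positivity)
  have hq2D : Q * R * k ^ 2 ≤ D :=
    (Nat.mul_le_mul_left _ (Nat.pow_le_pow_right (by omega) (by norm_num))).trans hqD
  have hD9 : 9 ≤ D := by
    have : 1 * 3 ^ 2 ≤ Q * R * k ^ 2 := Nat.mul_le_mul hQR (Nat.pow_le_pow_left hk3 2)
    omega
  have hDN : D < 2 ^ N := lt_of_le_of_lt (Nat.le_mul_of_pos_left _ (by positivity)) hN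
  have kpos : (0 : ℝ) < k := by exact_mod_cast (by omega : 0 < k)
  have rN : (k : ℝ) ^ 4 * D < 2 ^ N := by exact_mod_cast hN
  have rq2D : (Q : ℝ) * R * k ^ 2 ≤ D := by exact_mod_cast hq2D
  have r2N : (0 : ℝ) < 2 ^ N := by positivity
  have rQ : (1 : ℝ) ≤ Q := by exact_mod_cast hQ
  have rR : (1 : ℝ) ≤ R := by exact_mod_cast hR
  set Y : Fin n → ℝ := fun i => X.mulVec β i + W i with hY
  set Yh : Fin n → ℤ := fun i => Q * truncInt N (Y i) with hYh
  set Xh : Matrix (Fin n) (Fin p) ℤ := truncMatrix N X with hXh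
  set b : Fin p → ℤ := fun j => B j + ζ j with hb
  have hQY : ∀ i, (Q : ℝ) * Y i = ∑ j, X i j * B j + Q * W i := fun i => by
    have hQ0 : (Q : ℝ) ≠ 0 := by positivity
    rw [hY]
    simp only [mulVec, dotProduct, mul_add, Finset.mul_sum]
    congr 1
    refine Finset.sum_congr rfl fun j _ => ?_
    rw [hβ j]; field_simp
  have hYhe : ∀ i, |(Yh i : ℝ) - 2 ^ N * (Q * Y i)| ≤ Q := fun i => by
    have h1 := abs_truncInt_sub_le N (Y i)
    have h2 : (Yh i : ℝ) - 2 ^ N * (Q * Y i) = Q * (truncInt N (Y i) - 2 ^ N * Y i) := by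
      rw [hYh]; push_cast; ring
    rw [h2, abs_mul, Nat.abs_cast]
    exact mul_le_of_le_one_right (by positivity) h1
  have hXe : ∀ i (v : Fin p → ℤ) (K : ℝ), (∀ j, |(v j : ℝ)| ≤ K) →
      |((Xh *ᵥ v) i : ℝ) - 2 ^ N * ∑ j, X i j * v j| ≤ p * K := fun i v K hv =>
    abs_truncInt_mulVec_sub_le X i hv
  have rB : ∀ j, |(B j : ℝ)| ≤ Q * R := fun j => by exact_mod_cast hB j
  have rζ : ∀ j, |(ζ j : ℝ)| ≤ 2 * (Q * R) + p := fun j => by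
    have h1 : |ζ j| ≤ 2 * (Q * R) + p := by
      have := hζ1 j
      rw [abs_of_nonneg (by nlinarith)]
      exact hζ2 j
    exact_mod_cast h1
  have rk2 : (1 : ℝ) + p + n * p ≤ k ^ 2 := by exact_mod_cast hk2
  have rk2' : ((p : ℝ) + 1) ^ 2 ≤ k ^ 2 := by exact_mod_cast hk2'
  have rQR : (1 : ℝ) ≤ Q * R := by nlinarith
  have hQQR : (Q : ℝ) ≤ Q * R := by nlinarith
  -- the residual of the solution
  have herr : ∀ i, |((Yh + Xh *ᵥ ζ - Xh *ᵥ b) i : ℝ)| ≤ Q * R * k ^ 2 := fun i => by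
    have e1 : ((Yh + Xh *ᵥ ζ - Xh *ᵥ b) i : ℤ) = Yh i - (Xh *ᵥ B) i := by
      have : b = B + ζ := rfl
      rw [this, mulVec_add]
      simp
    have h1 := hYhe i
    have h2 := hXe i B _ rB
    have h3 : |2 ^ N * ((Q : ℝ) * W i)| ≤ Q * (n * p) := by
      rw [← mul_assoc, mul_comm ((2 : ℝ) ^ N), mul_assoc, abs_mul, abs_mul, Nat.abs_cast,
        abs_of_pos r2N]
      exact mul_le_mul_of_nonneg_left (h.noise_le i) (by positivity)
    rw [e1]
    have e2 : (((Yh i - (Xh *ᵥ B) i : ℤ)) : ℝ) = (Yh i - 2 ^ N * (Q * Y i)) -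
        ((Xh *ᵥ B) i - 2 ^ N * ∑ j, X i j * B j) + 2 ^ N * (Q * W i) := by
      rw [hQY]; push_cast; ring
    rw [e2]
    have h4 := abs_add_le ((Yh i - 2 ^ N * (Q * Y i)) -
        ((Xh *ᵥ B) i - 2 ^ N * ∑ j, X i j * (B j : ℝ))) (2 ^ N * (Q * W i))
    have h5 := abs_sub ((Yh i : ℝ) - 2 ^ N * (Q * Y i))
        ((Xh *ᵥ B) i - 2 ^ N * ∑ j, X i j * (B j : ℝ))
    have h6 : (Q : ℝ) * (n * p) ≤ Q * R * (n * p) :=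
      mul_le_mul_of_nonneg_right hQQR (by positivity)
    nlinarith
  -- the shifted observation and its real counterpart
  have hobs : ∀ i, |((Yh + Xh *ᵥ ζ) i : ℝ) - 2 ^ N * (∑ j, X i j * (b j : ℝ) + Q * W i)| ≤
      Q * R * k ^ 2 := fun i => by
    have h1 := hYhe i
    have h2 := hXe i ζ _ rζ
    have e2 : (((Yh + Xh *ᵥ ζ) i : ℤ) : ℝ) - 2 ^ N * (∑ j, X i j * (b j : ℝ) + Q * W i) =
        (Yh i - 2 ^ N * (Q * Y i)) + ((Xh *ᵥ ζ) i - 2 ^ N * ∑ j, X i j * (ζ j : ℝ)) := by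
      have e3 : ∑ j, X i j * (b j : ℝ) = ∑ j, X i j * (B j : ℝ) + ∑ j, X i j * (ζ j : ℝ) := by
        rw [← Finset.sum_add_distrib]
        refine Finset.sum_congr rfl fun j _ => ?_
        rw [hb]; push_cast; ring
      rw [hQY, e3, Pi.add_apply]; push_cast; ring
    rw [e2]
    refine (abs_add_le _ _).trans ((add_le_add h1 h2).trans ?_)
    have h3 : (p : ℝ) * p ≤ Q * R * (p * p) := le_mul_of_one_le_left (by positivity) rQR
    nlinarith
  have hY1 : ∀ i, 2 ^ N / (k : ℝ) ^ 4 ≤ |((Yh + Xh *ᵥ ζ) i : ℝ)| ∧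
      (D : ℝ) < |((Yh + Xh *ᵥ ζ) i : ℝ)| := fun i => by
    have h1 := hobs i
    have h2 := h.le_obs i
    have h3 : 2 ^ N * (2 / (k : ℝ) ^ 4) ≤ |2 ^ N * (∑ j, X i j * (b j : ℝ) + Q * W i)| := by
      rw [abs_mul, abs_of_pos r2N]
      exact mul_le_mul_of_nonneg_left h2 r2N.le
    have h4 := abs_sub_abs_le_abs_sub (2 ^ N * (∑ j, X i j * (b j : ℝ) + Q * W i))
      ((Yh + Xh *ᵥ ζ) i : ℝ)
    rw [abs_sub_comm] at h4
    have h5 : (D : ℝ) < 2 ^ N / (k : ℝ) ^ 4 := by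
      rw [lt_div_iff₀ (by positivity)]; linarith
    have h6 : 2 ^ N * (2 / (k : ℝ) ^ 4) = 2 * (2 ^ N / (k : ℝ) ^ 4) := by ring
    constructor <;> linarith
  have hkey : ∀ (z1 : Fin p → ℤ) (z2 z3 : Fin n → ℤ), (∀ j, |z1 j| ≤ D) → (∀ i, |z3 i| ≤ D) →
      (∀ i, (Xh *ᵥ z1) i + z3 i = (Yh + Xh *ᵥ ζ) i * z2 i) → (z1 ≠ 0 ∨ z2 ≠ 0 ∨ z3 ≠ 0) →
      ∃ r : ℤ, r ≠ 0 ∧ ∀ j, z1 j = r * b j := fun z1 z2 z3 h1 h3 heq hne =>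
    h.exists_multiple hn (fun i => (hY1 i).1) (fun i => by exact_mod_cast (hY1 i).2) hobs h1 h3 heq
      hne
  have hQs : Q ≤ 2 ^ Nat.size Q := (Nat.lt_size_self Q).le
  have hRs : R ≤ 2 ^ Nat.size R := (Nat.lt_size_self R).le
  have hks : k ≤ 2 ^ k := Nat.lt_two_pow_self.le
  have mono : ∀ {x a : ℕ}, x ≤ 2 ^ a → a ≤ S → x ≤ 2 ^ S := fun h1 h2 =>
    h1.trans (Nat.pow_le_pow_right (by norm_num) h2)
  have hQRs : Q * R ≤ 2 ^ (Nat.size Q + Nat.size R) := by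
    rw [pow_add]; exact Nat.mul_le_mul hQs hRs
  have hβR : ∀ j, |β j| ≤ R := fun j => by
    rw [hβ j, abs_div, Nat.abs_cast, div_le_iff₀ (by positivity), mul_comm]
    exact rB j
  have hYs : ∀ i, (truncInt N (Y i)).natAbs ≤
      2 ^ (N + (1 + 5 * k + Nat.size R)) := fun i =>
    natAbs_truncInt_le (h.abs_obs_le hp hR hβR i)
  have hXs : ∀ i j, (truncInt N (X i j)).natAbs ≤ 2 ^ (N + k * 4) := fun i j => by
    refine natAbs_truncInt_le ((h.entry_le i j).trans ?_)
    rw [pow_mul]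
    exact pow_le_pow_left₀ (by positivity) (by exact_mod_cast hks) 4
  have hζs : ∀ j, (ζ j).natAbs ≤ 2 ^ S := fun j =>
    mono ((by have := hζ1 j; have := hζ2 j; omega : (ζ j).natAbs ≤ 2 * (Q * R) + p).trans
      (two_mul_add_le_two_pow hQRs (by omega : p ≤ k))) (by omega)
  have hBs : ∀ j, (B j).natAbs ≤ 2 ^ S := fun j => by
    refine mono (le_trans ?_ hQRs) (by omega)
    have := hB j
    zify
    exact this
  have hWs : 2 * Q * (2 ^ N * 1 + R * p) ≤ 2 ^ S :=
    mono (a := 1 + Nat.size Q + (N + Nat.size R + k + 1))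
      (noiseBound_le_two_pow hQs hRs (by omega : p ≤ k)) (by omega)
  have hscale : D < scaleVal n p (Q * R) (2 * Q * (2 ^ N * 1 + R * p)) :=
    hDN.trans_le (two_pow_le_scaleVal hn hp hQ)
  have hlen : 2 ^ (p + n + n - 1) * (b ⬝ᵥ b + (Yh + Xh *ᵥ ζ - Xh *ᵥ b) ⬝ᵥ
      (Yh + Xh *ᵥ ζ - Xh *ᵥ b)) ≤ (D : ℤ) ^ 2 := by
    refine length_sq_le hn (fun j => ?_) fun i => ?_
    · rw [abs_of_nonneg (zero_le_one.trans (hb1 j))]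
      refine (hb2 j).trans ?_
      have : 3 * (Q * R) + p ≤ Q * R * k ^ 2 := three_mul_add_le hQR (by omega)
      exact_mod_cast this
    · have := herr i
      rw [← hk]
      exact_mod_cast this
  have helo := exists_spec_elo (S := S) (Y := Yh) (X := Xh) (Rhat := Q * R)
    (What := 2 * Q * (2 ^ N * 1 + R * p)) (Z := ζ) (b := b) (D := D) (by omega) (by omega) hp
    (mono hQRs (by omega)) hWs (fun i => ?_) (fun i j => mono (hXs i j) (by omega)) hζs hb1 h.gcd_eq
    (by positivity) (by exact_mod_cast hscale) hlen (fun i => ?_) hkey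
  · have hout : (fun j => b j - ζ j) = B := funext fun j => by simp [hb]
    rw [hout] at helo
    exact LBRTerminates.of_spec (exists_spec_lbr (by omega) (by omega) (by omega)
      (mono hQs (by omega)) (mono hRs (by omega)) (fun i => mono (hYs i) (by omega))
      (fun i j => mono (hXs i j) (by omega)) hBs helo)
  · refine mono (a := Nat.size Q + (N + (1 + 5 * k + Nat.size R))) ?_ (by omega)
    rw [hYh, Int.natAbs_mul, pow_add]
    exact Nat.mul_le_mul (by simpa using hQs) (hYs i)
  · have h1 : (D : ℤ) < |(Yh + Xh *ᵥ ζ) i| := by exact_mod_cast (hY1 i).2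
    rw [Int.abs_eq_natAbs] at h1
    omega

end Good

end LatticeRegression

namespace LatticeRegression

/-! ### Anti-concentration of the rows of the measurement matrix -/

section AntiConcentration

open scoped ENNReal
open MeasureTheory ProbabilityTheory

theorem volume_abs_mul_sub_le {a : ℝ} (ha : a ≠ 0) (t δ : ℝ) :
    volume {x : ℝ | |x * a - t| ≤ δ} ≤ ENNReal.ofReal (2 * (δ / |a|)) := by
  rw [← Real.volume_closedBall (t / a)]
  refine measure_mono fun x hx => ?_
  rw [Set.mem_ofPred_eq] at hx
  rw [Metric.mem_closedBall, Real.dist_eq, le_div_iff₀ (abs_pos.2 ha), ← abs_mul, sub_mul,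
    div_mul_cancel₀ _ ha]
  exact hx

/-- A nonzero linear form in independent variables with density at most `c` is anti-concentrated:
integrating out a variable with coefficient `v j` first shows that an interval of length `2 δ` has
probability at most `2 c δ / |v j|`. -/
theorem measure_pi_abs_sum_sub_le {ι : Type*} [Fintype ι] {μ : Measure ℝ} [IsProbabilityMeasure μ]
    {c : ℝ} (hc : 0 ≤ c) (hμ : μ ≤ ENNReal.ofReal c • volume) (v : ι → ℝ) (t δ : ℝ) {j : ι}
    (hv : v j ≠ 0) :
    Measure.pi (fun _ : ι => μ) {x | |∑ i, x i * v i - t| ≤ δ} ≤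
      ENNReal.ofReal (2 * c * δ / |v j|) := by
  classical
  set A : Set (ι → ℝ) := {x | |∑ i, x i * v i - t| ≤ δ} with hA
  have mA : MeasurableSet A := measurableSet_le (by fun_prop) measurable_const
  have mf : Measurable (A.indicator (1 : (ι → ℝ) → ℝ≥0∞)) := measurable_one.indicator mA
  rw [← lintegral_indicator_one mA, lintegral_eq_lmarginal_univ (0 : ι → ℝ),
    lmarginal_erase' _ mf (Finset.mem_univ j)]
  have key : ∀ x : ι → ℝ,
      ∫⁻ y, A.indicator 1 (Function.update x j y) ∂μ ≤ ENNReal.ofReal (2 * c * δ / |v j|) := by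
    intro x
    have h1 : ∀ y, A.indicator (1 : (ι → ℝ) → ℝ≥0∞) (Function.update x j y) =
        ({y : ℝ | |y * v j - (t - ∑ i ∈ Finset.univ.erase j, x i * v i)| ≤ δ}).indicator 1 y := by
      intro y
      have h2 : ∑ i, Function.update x j y i * v i =
          y * v j + ∑ i ∈ Finset.univ.erase j, x i * v i := by
        rw [← Finset.add_sum_erase _ _ (Finset.mem_univ j), Function.update_self]
        congr 1
        refine Finset.sum_congr rfl fun i hi => ?_
        rw [Function.update_of_ne (Finset.ne_of_mem_erase hi)]
      simp only [Set.indicator_apply, hA, Set.mem_ofPred_eq, h2, Pi.one_apply]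
      congr 2
      ring_nf
    simp only [h1]
    rw [lintegral_indicator_one (measurableSet_le (by fun_prop) measurable_const)]
    refine (hμ _).trans ?_
    rw [Measure.smul_apply, smul_eq_mul]
    refine (mul_le_mul_right (volume_abs_mul_sub_le hv _ _) _).trans_eq ?_
    rw [← ENNReal.ofReal_mul hc]
    congr 1
    ring
  refine (lmarginal_mono (g := fun _ => ENNReal.ofReal (2 * c * δ / |v j|)) key 0).trans_eq ?_
  simp [lmarginal]

variable {Ω : Type*} [MeasurableSpace Ω] {P : Measure Ω} {n p : ℕ}
  {X : Ω → Fin n → Fin p → ℝ} {W : Ω → Fin n → ℝ} {μ : Measure ℝ} [IsProbabilityMeasure μ]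

theorem map_eq_pi_pi (hXm : ∀ i j, Measurable fun ω => X ω i j)
    (hXl : ∀ i j, P.map (fun ω => X ω i j) = μ)
    (hXi : iIndepFun (fun (ij : Fin n × Fin p) ω => X ω ij.1 ij.2) P) :
    P.map X = Measure.pi fun _ => Measure.pi fun _ => μ := by
  have h1 := hXi.map_fun_eq_infinitePi_map fun ij : Fin n × Fin p => hXm ij.1 ij.2
  simp only [hXl] at h1
  have h2 := Measure.infinitePi_map_curry (fun (_ : Fin n) (_ : Fin p) => μ)
  rw [← h1, Measure.map_map (MeasurableEquiv.measurable _) (by fun_prop)] at h2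
  simp only [Measure.infinitePi_eq_pi] at h2
  exact h2

variable [IsProbabilityMeasure P]

/-- Given the noise, the rows of the measurement matrix are independent. -/
theorem measure_forall_row_mem_le (hXm : ∀ i j, Measurable fun ω => X ω i j)
    (hXl : ∀ i j, P.map (fun ω => X ω i j) = μ)
    (hXi : iIndepFun (fun (ij : Fin n × Fin p) ω => X ω ij.1 ij.2) P)
    (hWm : Measurable W) (hXW : IndepFun X W P)
    {A : Fin n → Set ((Fin p → ℝ) × (Fin n → ℝ))} (hA : ∀ i, MeasurableSet (A i))
    {r : Fin n → ℝ≥0∞}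
    (hr : ∀ i w, Measure.pi (fun _ : Fin p => μ) {x | (x, w) ∈ A i} ≤ r i) :
    P {ω | ∀ i, (X ω i, W ω) ∈ A i} ≤ ∏ i, r i := by
  have mX : Measurable X := by
    refine measurable_pi_iff.2 fun i => measurable_pi_iff.2 fun j => hXm i j
  have h1 := (indepFun_iff_map_prod_eq_prod_map_map mX.aemeasurable hWm.aemeasurable).1 hXW
  have hWp : IsProbabilityMeasure (P.map W) := Measure.isProbabilityMeasure_map hWm.aemeasurable
  set E : Set ((Fin n → Fin p → ℝ) × (Fin n → ℝ)) := {q | ∀ i, (q.1 i, q.2) ∈ A i} with hE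
  have mE : MeasurableSet E := by
    rw [hE, Set.ofPred_forall]
    refine MeasurableSet.iInter fun i => ?_
    exact (((measurable_pi_apply i).comp measurable_fst).prodMk measurable_snd) (hA i)
  have h2 : P {ω | ∀ i, (X ω i, W ω) ∈ A i} = (P.map fun ω => (X ω, W ω)) E := by
    rw [Measure.map_apply (mX.prodMk hWm) mE]
    rfl
  rw [h2, h1, map_eq_pi_pi hXm hXl hXi, Measure.prod_apply_symm mE]
  refine (lintegral_mono (g := fun _ => ∏ i, r i) fun w => ?_).trans_eq (by simp)
  have h3 : (fun x => (x, w)) ⁻¹' E = Set.univ.pi fun i => {x : Fin p → ℝ | (x, w) ∈ A i} := by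
    ext x
    simp [hE]
  rw [h3, Measure.pi_pi]
  exact Finset.prod_le_prod' fun i _ => hr i w

/-- A union bound over the values of an independent variable `Z`. -/
theorem measure_mem_of_indepFun_le {α β : Type*} [MeasurableSpace α] [MeasurableSpace β]
    [MeasurableSingletonClass β] {U : Ω → α} {Z : Ω → β} (hUZ : IndepFun U Z P)
    (hZ : Measurable Z) {E : β → Set α} {F : Finset β} (hE : ∀ z ∈ F, MeasurableSet (E z)) {r : ℝ≥0∞}
    (hr : ∀ z ∈ F, P {ω | U ω ∈ E z} ≤ r) : P {ω | Z ω ∈ F ∧ U ω ∈ E (Z ω)} ≤ r := by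
  classical
  have h1 : {ω | Z ω ∈ F ∧ U ω ∈ E (Z ω)} ⊆ ⋃ z ∈ F, U ⁻¹' E z ∩ Z ⁻¹' {z} := by
    rintro ω ⟨hω, hu⟩
    simp only [Set.mem_iUnion]
    exact ⟨Z ω, hω, hu, rfl⟩
  refine (measure_mono h1).trans ((measure_biUnion_finset_le _ _).trans ?_)
  calc ∑ z ∈ F, P (U ⁻¹' E z ∩ Z ⁻¹' {z}) ≤ ∑ z ∈ F, r * P (Z ⁻¹' {z}) := by
        refine Finset.sum_le_sum fun z hz => ?_
        rw [hUZ.measure_inter_preimage_eq_mul _ _ (hE z hz) (measurableSet_singleton z)]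
        exact mul_le_mul_left (hr z hz) _
    _ = r * ∑ z ∈ F, P (Z ⁻¹' {z}) := (Finset.mul_sum _ _ _).symm
    _ ≤ r * 1 := by
        gcongr
        rw [← measure_biUnion_finset (fun a _ b _ hab => ?_) fun z _ => hZ (measurableSet_singleton z)]
        · exact prob_le_one
        · exact Disjoint.preimage _ (by simpa using hab)
    _ = r := mul_one r

end AntiConcentration

end LatticeRegression

namespace LatticeRegression

/-! ### The random shift -/

section Shift

open scoped ENNReal
open MeasureTheory ProbabilityTheory

theorem mul_card_filter_dvd_lt (a B : ℤ) (L : ℕ) {q : ℕ} (hq : 0 < q) :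
    q * ((Finset.Ioc a (a + L)).filter fun z => (q : ℤ) ∣ B + z).card < L + q := by
  have h1 := Int.Ioc_filter_modEq_card a (a + L) (r := q) (by exact_mod_cast hq) (-B)
  have h2 : (Finset.Ioc a (a + L)).filter (fun z => (q : ℤ) ∣ B + z) =
      (Finset.Ioc a (a + L)).filter fun z => z ≡ -B [ZMOD q] := by
    refine Finset.filter_congr fun z _ => ?_
    rw [Int.modEq_comm, Int.modEq_iff_dvd, sub_neg_eq_add, add_comm]
  rw [h2]
  set C := ((Finset.Ioc a (a + L)).filter fun z => z ≡ -B [ZMOD q]).card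
  have e : ∀ x : ℤ, ⌊((x : ℚ) - ((-B : ℤ) : ℚ)) / ((q : ℤ) : ℚ)⌋ = (x + B) / q := fun x => by
    rw [← Int.cast_sub, sub_neg_eq_add, Int.cast_natCast, Rat.floor_intCast_div_natCast]
  rw [e, e] at h1
  have hq' : (0 : ℤ) < q := by exact_mod_cast hq
  have h3 := Int.mul_ediv_add_emod (a + L + B) q
  have h4 := Int.mul_ediv_add_emod (a + B) q
  have h5 := Int.emod_nonneg (a + L + B) hq'.ne'
  have h6 := Int.emod_lt_of_pos (a + B) hq'
  zify
  rcases le_total ((a + L + B) / q - (a + B) / q) 0 with h | h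
  · rw [h1, max_eq_right h, mul_zero]
    positivity
  · rw [h1, max_eq_left h, mul_sub]
    linarith

theorem shiftRange_eq_Ioc (p r : ℕ) :
    shiftRange p r = Finset.Ioc (r : ℤ) (r + (r + Nat.log 2 p : ℕ)) := by
  ext z
  simp only [shiftRange, Finset.mem_Icc, Finset.mem_Ioc]
  push_cast
  omega

theorem card_shiftRange (p r : ℕ) : (shiftRange p r).card = r + Nat.log 2 p := by
  rw [shiftRange_eq_Ioc, Int.card_Ioc]
  omega

variable {Ω : Type*} [MeasurableSpace Ω] {P : Measure Ω} {p r : ℕ}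
  {Z : Ω → Fin p → ℤ}

theorem measure_shift_notMem (hZm : ∀ j, Measurable fun ω => Z ω j)
    (hZl : ∀ j, P.map (fun ω => Z ω j) = uniformOn (shiftRange p r : Set ℤ)) :
    P.real {ω | ∃ j, Z ω j ∉ shiftRange p r} = 0 := by
  have h : P {ω | ∃ j, Z ω j ∉ shiftRange p r} = 0 := by
    rw [Set.ofPred_exists]
    refine measure_iUnion_null fun j => ?_
    have h1 : {ω | Z ω j ∉ shiftRange p r} = (fun ω => Z ω j) ⁻¹' (shiftRange p r : Set ℤ)ᶜ := by
      ext ω; simp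
    rw [h1, ← Measure.map_apply (hZm j) MeasurableSet.of_discrete, hZl j,
      ← uniformOn_inter_self (Finset.finite_toSet _)]
    simp
  rw [measureReal_def, h]; rfl

theorem measure_forall_shift_le (hr : 0 < r) (hZm : ∀ j, Measurable fun ω => Z ω j)
    (hZl : ∀ j, P.map (fun ω => Z ω j) = uniformOn (shiftRange p r : Set ℤ))
    (hZi : iIndepFun (fun j ω => Z ω j) P) {T : Fin p → ℤ → Prop} [∀ j, DecidablePred (T j)] {ρ : ℝ}
    (hT : ∀ j, (((shiftRange p r).filter (T j)).card : ℝ) ≤ ρ * (r + Nat.log 2 p : ℕ)) :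
    P.real {ω | ∀ j, T j (Z ω j)} ≤ ρ ^ p := by
  have h1 := hZi.measure_inter_preimage_eq_mul Finset.univ (sets := fun j => {z | T j z})
    fun j _ => MeasurableSet.of_discrete
  have h2 : {ω | ∀ j, T j (Z ω j)} = ⋂ j ∈ Finset.univ, (fun ω => Z ω j) ⁻¹' {z | T j z} := by
    ext ω; simp
  have hL : (0 : ℝ) < (r + Nat.log 2 p : ℕ) := by exact_mod_cast (by omega)
  rw [measureReal_def, h2, h1, ENNReal.toReal_prod]
  refine (Finset.prod_le_prod (g := fun _ => ρ) (fun j _ => ENNReal.toReal_nonneg)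
    fun j _ => ?_).trans_eq (by simp)
  rw [← Measure.map_apply (hZm j) MeasurableSet.of_discrete, hZl j,
    ← uniformOn_inter_self (Finset.finite_toSet _)]
  have h3 : (shiftRange p r : Set ℤ) ∩ {z | T j z} = ((shiftRange p r).filter (T j) : Finset ℤ) := by
    ext z; simp
  rw [h3, uniformOn_apply_finset, ENNReal.toReal_div, ENNReal.toReal_natCast, ENNReal.toReal_natCast,
    card_shiftRange, div_le_iff₀ hL, Finset.inter_eq_right.2 (Finset.filter_subset _ _)]
  exact hT j

/-- The probability that `q` divides all coordinates of the shifted solution. -/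
theorem measure_forall_dvd_le (hr : 0 < r) (hZm : ∀ j, Measurable fun ω => Z ω j)
    (hZl : ∀ j, P.map (fun ω => Z ω j) = uniformOn (shiftRange p r : Set ℤ))
    (hZi : iIndepFun (fun j ω => Z ω j) P) (B : Fin p → ℤ) {q : ℕ} (hq : 2 ≤ q) :
    P.real {ω | ∀ j, (q : ℤ) ∣ B j + Z ω j} ≤
      (2 / (q + 1 : ℝ)) ^ p + (1 / (r + Nat.log 2 p : ℕ) : ℝ) ^ p := by
  set L := r + Nat.log 2 p with hL
  have hLpos : (0 : ℝ) < L := by exact_mod_cast (by omega : 0 < L)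
  have hqpos : (0 : ℝ) < q := by exact_mod_cast (by omega : 0 < q)
  have hcard : ∀ j, q * ((shiftRange p r).filter fun z => (q : ℤ) ∣ B j + z).card < L + q :=
    fun j => by
      rw [shiftRange_eq_Ioc]
      exact mul_card_filter_dvd_lt _ _ _ (by omega)
  rcases lt_or_ge q L with h | h
  · refine (measure_forall_shift_le hr hZm hZl hZi (T := fun j z => (q : ℤ) ∣ B j + z)
      (ρ := 2 / (q + 1 : ℝ)) fun j => ?_).trans (le_add_of_nonneg_right (by positivity))
    set C := ((shiftRange p r).filter fun z => (q : ℤ) ∣ B j + z).card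
    have h1 : (q : ℝ) * C + 1 ≤ L + q := by exact_mod_cast hcard j
    have h2 : (q : ℝ) + 1 ≤ L := by exact_mod_cast h
    rw [div_mul_eq_mul_div, le_div_iff₀ (by positivity)]
    have h3 : (q : ℝ) * (C * (q + 1)) ≤ q * (2 * L) := by
      have h4 : (2 : ℝ) ≤ q := by exact_mod_cast hq
      nlinarith [mul_nonneg (sub_nonneg.2 h2) (by linarith : (0 : ℝ) ≤ q - 1),
        mul_le_mul_of_nonneg_right h1 (by linarith : (0 : ℝ) ≤ q + 1)]
    exact le_of_mul_le_mul_left h3 hqpos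
  · refine (measure_forall_shift_le hr hZm hZl hZi (T := fun j z => (q : ℤ) ∣ B j + z)
      (ρ := 1 / (L : ℝ)) fun j => ?_).trans (le_add_of_nonneg_left (by positivity))
    rw [one_div_mul_cancel hLpos.ne']
    have h1 := hcard j
    have : ((shiftRange p r).filter fun z => (q : ℤ) ∣ B j + z).card ≤ 1 := by
      by_contra h2
      push Not at h2
      nlinarith
    exact_mod_cast this

theorem sum_two_div_pow_le {p : ℕ} (hp : 2 ≤ p) (K : ℕ) :
    ∑ q ∈ Finset.Icc 2 K, (2 / (q + 1 : ℝ)) ^ p ≤ 5 * (2 / 3) ^ p := by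
  have h1 : ∀ K : ℕ, ∑ q ∈ Finset.Icc 2 (K + 1), 1 / (q + 1 : ℝ) ^ 2 ≤ 1 / 2 - 1 / (K + 2 : ℝ) := by
    intro K
    induction K with
    | zero => norm_num
    | succ K ih =>
      rw [← Finset.insert_Icc_right_eq_Icc_add_one (by omega), Finset.sum_insert (by simp)]
      have h2 : 1 / (((K + 1 + 1 : ℕ) : ℝ) + 1) ^ 2 ≤ 1 / (K + 2) - 1 / ((K + 1 : ℕ) + 2) := by
        push_cast
        rw [div_sub_div _ _ (by positivity) (by positivity), div_le_div_iff₀ (by positivity)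
          (by positivity)]
        nlinarith [(Nat.cast_nonneg K : (0 : ℝ) ≤ K)]
      linarith
  have h2 : ∀ q ∈ Finset.Icc 2 (K + 1),
      (2 / (q + 1 : ℝ)) ^ p ≤ (2 / 3) ^ p * 9 * (1 / (q + 1 : ℝ) ^ 2) := fun q hq => by
    have h3 : (2 : ℝ) ≤ q := by exact_mod_cast (Finset.mem_Icc.1 hq).1
    have h4 : (2 / (q + 1 : ℝ)) = 2 / 3 * (3 / (q + 1)) := by field_simp
    have h5 : (3 / (q + 1 : ℝ)) ^ p ≤ (3 / (q + 1 : ℝ)) ^ 2 :=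
      pow_le_pow_of_le_one (by positivity) (by rw [div_le_one (by positivity)]; linarith) hp
    rw [h4, mul_pow, mul_assoc]
    refine mul_le_mul_of_nonneg_left (h5.trans_eq ?_) (by positivity)
    rw [div_pow]; ring
  calc ∑ q ∈ Finset.Icc 2 K, (2 / (q + 1 : ℝ)) ^ p
      ≤ ∑ q ∈ Finset.Icc 2 (K + 1), (2 / (q + 1 : ℝ)) ^ p :=
        Finset.sum_le_sum_of_subset_of_nonneg (Finset.Icc_subset_Icc_right (by omega))
          fun _ _ _ => by positivity
    _ ≤ (2 / 3) ^ p * 9 * (1 / 2 - 1 / (K + 2)) := by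
        refine (Finset.sum_le_sum h2).trans ?_
        rw [← Finset.mul_sum]
        exact mul_le_mul_of_nonneg_left (h1 K) (by positivity)
    _ ≤ 5 * (2 / 3) ^ p := by
        have h3 : (0 : ℝ) < 1 / (K + 2) := by positivity
        have h4 : (0 : ℝ) < (2 / 3) ^ p := by positivity
        nlinarith

/-- A common divisor `q ≥ 2` is unlikely: small `q` divide each coordinate with probability at most
`2 / (q + 1)`, and large `q` divide at most one number in the range of the shift. -/
theorem measure_exists_dvd_le [IsProbabilityMeasure P] (hr : 0 < r) (hp : 0 < p) (hZm : ∀ j, Measurable fun ω => Z ω j)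
    (hZl : ∀ j, P.map (fun ω => Z ω j) = uniformOn (shiftRange p r : Set ℤ))
    (hZi : iIndepFun (fun j ω => Z ω j) P) (B : Fin p → ℤ) :
    P.real {ω | ∃ q ∈ Finset.Icc 2 (3 * (r + Nat.log 2 p)), ∀ j, (q : ℤ) ∣ B j + Z ω j} ≤
      12 * (2 / 3) ^ p := by
  set L := r + Nat.log 2 p with hL
  rcases (by omega : p = 1 ∨ 2 ≤ p) with rfl | hp2
  · exact measureReal_le_one.trans (by norm_num)
  have hL2 : (2 : ℝ) ≤ L := by
    have : 0 < Nat.log 2 p := Nat.log_pos (by norm_num) hp2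
    exact_mod_cast (by omega : 2 ≤ L)
  have h1 : {ω | ∃ q ∈ Finset.Icc 2 (3 * L), ∀ j, (q : ℤ) ∣ B j + Z ω j} =
      ⋃ q ∈ Finset.Icc 2 (3 * L), {ω | ∀ j, (q : ℤ) ∣ B j + Z ω j} := by
    ext ω; simp
  rw [h1]
  refine (measureReal_biUnion_finset_le _ _).trans ((Finset.sum_le_sum fun q hq =>
    measure_forall_dvd_le hr hZm hZl hZi B (Finset.mem_Icc.1 hq).1).trans ?_)
  rw [← hL, Finset.sum_add_distrib, Finset.sum_const, nsmul_eq_mul, Nat.card_Icc]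
  have h2 : ((3 * L + 1 - 2 : ℕ) : ℝ) * (1 / (L : ℝ)) ^ p ≤ 6 * (2 / 3) ^ p := by
    obtain ⟨s, rfl⟩ : ∃ s, p = s + 1 := ⟨p - 1, by omega⟩
    have h3 : ((3 * L + 1 - 2 : ℕ) : ℝ) ≤ 3 * L := by exact_mod_cast (by omega)
    have h4 : (1 / (L : ℝ)) ^ s ≤ (1 / 2) ^ s := by gcongr
    have h5 : (1 / 2 : ℝ) ^ s ≤ (2 / 3) ^ s :=
      pow_le_pow_left₀ (by norm_num) (by norm_num) s
    calc ((3 * L + 1 - 2 : ℕ) : ℝ) * (1 / (L : ℝ)) ^ (s + 1)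
        ≤ 3 * L * (1 / (L : ℝ)) ^ (s + 1) := by gcongr
      _ = 3 * (1 / (L : ℝ)) ^ s := by rw [pow_succ]; field_simp
      _ ≤ 3 * (2 / 3) ^ s := by linarith
      _ ≤ 6 * (2 / 3) ^ (s + 1) := by
        rw [pow_succ]
        have : (0 : ℝ) < (2 / 3) ^ s := by positivity
        linarith
  have := sum_two_div_pow_le hp2 (3 * L)
  have : (0 : ℝ) < (2 / 3) ^ p := by positivity
  linarith

/-- Some coordinate of the shifted solution is at least `r / 4`, except with exponentially small
probability. -/
theorem measure_forall_lt_le (hr : 0 < r) (hZm : ∀ j, Measurable fun ω => Z ω j)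
    (hZl : ∀ j, P.map (fun ω => Z ω j) = uniformOn (shiftRange p r : Set ℤ))
    (hZi : iIndepFun (fun j ω => Z ω j) P) {B : Fin p → ℤ} (hB : ∀ j, |B j| ≤ r) :
    P.real {ω | ∀ j, 4 * (B j + Z ω j) < r} ≤ (2 / 3) ^ p := by
  refine (measure_forall_shift_le hr hZm hZl hZi (T := fun j z => 4 * (B j + z) < r)
    (ρ := 1 / 4) fun j => ?_).trans (pow_le_pow_left₀ (by norm_num) (by norm_num) p)
  have h1 : (shiftRange p r).filter (fun z => 4 * (B j + z) < r) ⊆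
      Finset.Ioc (r : ℤ) (r + (r / 4 : ℕ)) := fun z hz => by
    rw [Finset.mem_filter, shiftRange_eq_Ioc, Finset.mem_Ioc] at hz
    have := (abs_le.1 (hB j)).1
    rw [Finset.mem_Ioc]
    omega
  have h2 := Finset.card_le_card h1
  rw [Int.card_Ioc] at h2
  have h3 : 4 * ((shiftRange p r).filter (fun z => 4 * (B j + z) < r)).card ≤ r + Nat.log 2 p := by
    omega
  have h4 : (4 : ℝ) * ((shiftRange p r).filter (fun z => 4 * (B j + z) < r)).card ≤
    (r + Nat.log 2 p : ℕ) := by exact_mod_cast h3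
  linarith

end Shift

end LatticeRegression

namespace LatticeRegression

/-! ### Typical inputs are likely -/

section Typical

open scoped ENNReal
open MeasureTheory ProbabilityTheory

variable {Ω : Type*} [MeasurableSpace Ω] {P : Measure Ω} {n p N Q R : ℕ}
  {X : Ω → Fin n → Fin p → ℝ} {W : Ω → Fin n → ℝ} {Z : Ω → Fin p → ℤ} {μ ν : Measure ℝ} {c : ℝ}

theorem measureReal_exists_lt_abs_entry_le (hXm : ∀ i j, Measurable fun ω => X ω i j)
    (hXl : ∀ i j, P.map (fun ω => X ω i j) = μ) (hμ : Integrable (fun x => x) μ) {t M : ℝ}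
    (ht : 0 < t) (hM : ∫ x, |x| ∂μ ≤ M) :
    P.real {ω | ∃ i j, t < |X ω i j|} ≤ n * (p * (M / t)) := by
  have h1 : ∀ i j, P.real {ω | t < |X ω i j|} ≤ M / t := fun i j => by
    have e : P.real {ω | t < |X ω i j|} = μ.real {x | t < |x|} := by
      rw [← hXl i j, map_measureReal_apply (hXm i j) (measurableSet_lt measurable_const (by fun_prop))]
      rfl
    have hfin : μ {x | t ≤ |x|} ≠ ⊤ := by
      have := hμ.abs.measure_ge_lt_top ht
      exact this.ne
    have h2 : t * μ.real {x | t ≤ |x|} ≤ ∫ x, |x| ∂μ :=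
      mul_meas_ge_le_integral_of_nonneg (Filter.Eventually.of_forall fun x => abs_nonneg x) hμ.abs t
    rw [e, le_div_iff₀' ht]
    have h3 : μ.real {x | t < |x|} ≤ μ.real {x | t ≤ |x|} :=
      measureReal_mono (Set.ofPred_subset_ofPred.2 fun x hx => le_of_lt hx) hfin
    exact (mul_le_mul_of_nonneg_left h3 ht.le).trans (h2.trans hM)
  have e : {ω | ∃ i j, t < |X ω i j|} = ⋃ i, ⋃ j, {ω | t < |X ω i j|} := by ext ω; simp
  rw [e]
  refine (measureReal_iUnion_fintype_le _).trans ?_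
  refine (Finset.sum_le_card_nsmul _ _ (p * (M / t)) fun i _ => ?_).trans_eq (by simp)
  refine (measureReal_iUnion_fintype_le _).trans ?_
  exact (Finset.sum_le_card_nsmul _ _ (M / t) fun j _ => h1 i j).trans_eq (by simp)

theorem measureReal_exists_lt_abs_noise_le [IsProbabilityMeasure P]
    (hWm : ∀ i, Measurable fun ω => W ω i)
    (hWl : ∀ i, P.map (fun ω => W ω i) = ν) (hν : MemLp (fun x => x) 2 ν) {t σ : ℝ}
    (h0 : ∫ x, x ∂ν = 0) (hσ : variance (fun x => x) ν ≤ σ ^ 2) (ht : 0 < t) :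
    P.real {ω | ∃ i, t < |W ω i|} ≤ n * (σ ^ 2 / t ^ 2) := by
  have h1 : ∀ i, P.real {ω | t < |W ω i|} ≤ σ ^ 2 / t ^ 2 := fun i => by
    have hp : IsProbabilityMeasure ν := by
      rw [← hWl i]
      exact Measure.isProbabilityMeasure_map (hWm i).aemeasurable
    have e : P.real {ω | t < |W ω i|} = ν.real {x | t < |x|} := by
      rw [← hWl i, map_measureReal_apply (hWm i) (measurableSet_lt measurable_const (by fun_prop))]
      rfl
    have h2 := meas_ge_le_variance_div_sq hν ht
    rw [h0] at h2
    simp only [sub_zero] at h2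
    rw [e]
    have h3 : ν.real {x | t < |x|} ≤ ν.real {x | t ≤ |x|} :=
      measureReal_mono (Set.ofPred_subset_ofPred.2 fun x hx => le_of_lt hx)
    refine h3.trans ?_
    refine (ENNReal.toReal_le_of_le_ofReal (div_nonneg (variance_nonneg _ _) (sq_nonneg t)) h2).trans ?_
    gcongr
  rw [Set.ofPred_exists]
  refine (measureReal_iUnion_fintype_le _).trans ?_
  exact (Finset.sum_le_card_nsmul _ _ _ fun i _ => h1 i).trans_eq (by simp)

variable [IsProbabilityMeasure P] [IsProbabilityMeasure μ]

/-- An observation is close to zero only with small probability. -/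
theorem measure_abs_obs_lt_le (hXm : ∀ i j, Measurable fun ω => X ω i j)
    (hXl : ∀ i j, P.map (fun ω => X ω i j) = μ)
    (hXi : iIndepFun (fun (ij : Fin n × Fin p) ω => X ω ij.1 ij.2) P)
    (hWm : Measurable W) (hXW : IndepFun X W P) (hc : 0 ≤ c) (hμ : μ ≤ ENNReal.ofReal c • volume)
    (v : Fin p → ℝ) {j : Fin p} (hv : 1 ≤ |v j|) (a : ℝ) {δ : ℝ} (hδ : 0 ≤ δ) (i : Fin n) :
    P {ω | |∑ j, X ω i j * v j + a * W ω i| < δ} ≤ ENNReal.ofReal (2 * c * δ) := by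
  classical
  set A : Fin n → Set ((Fin p → ℝ) × (Fin n → ℝ)) := fun i' =>
    if i' = i then {q | |∑ j, q.1 j * v j - -(a * q.2 i)| ≤ δ} else Set.univ with hA
  have h1 := measure_forall_row_mem_le hXm hXl hXi hWm hXW (A := A)
    (r := fun i' => if i' = i then ENNReal.ofReal (2 * c * δ) else 1) (fun i' => ?_) fun i' w => ?_
  · rw [Finset.prod_ite_eq' Finset.univ i, if_pos (Finset.mem_univ i)] at h1
    refine (measure_mono fun ω hω i' => ?_).trans h1
    by_cases hi : i' = i
    · subst hi
      simp only [hA, if_true, Set.mem_ofPred_eq, sub_neg_eq_add]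
      exact le_of_lt hω
    · simp [hA, hi]
  · by_cases hi : i' = i
    · simp only [hA, hi, if_true]
      exact measurableSet_le (by fun_prop) measurable_const
    · simp [hA, hi]
  · by_cases hi : i' = i
    · simp only [hA, hi, if_true, Set.mem_ofPred_eq]
      refine (measure_pi_abs_sum_sub_le hc hμ v _ δ (abs_pos.1 (by linarith) : v j ≠ 0)).trans ?_
      exact ENNReal.ofReal_le_ofReal (div_le_self (by positivity) hv)
    · simp only [hA, if_neg hi]
      exact prob_le_one

/-- The probability that `n` independent approximate equations hold, when the coefficient vector `v i`
of each is large compared to the error `Δ i` that is allowed. -/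
theorem measure_forall_abs_le (hXm : ∀ i j, Measurable fun ω => X ω i j)
    (hXl : ∀ i j, P.map (fun ω => X ω i j) = μ)
    (hXi : iIndepFun (fun (ij : Fin n × Fin p) ω => X ω ij.1 ij.2) P)
    (hWm : Measurable W) (hXW : IndepFun X W P) (hc : 0 ≤ c) (hμ : μ ≤ ENNReal.ofReal c • volume)
    {s ρ : ℝ} (hs : 0 < s) (v : Fin n → Fin p → ℝ) (a Δ : Fin n → ℝ)
    (hv : ∀ i, ∃ j, v i j ≠ 0 ∧ 2 * c * Δ i ≤ ρ * s * |v i j|) :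
    P {ω | ∀ i, |s * ∑ j, X ω i j * v i j - a i * W ω i| ≤ Δ i} ≤ ENNReal.ofReal ρ ^ n := by
  have h1 := measure_forall_row_mem_le hXm hXl hXi hWm hXW
    (A := fun i => {q | |∑ j, q.1 j * v i j - a i * q.2 i / s| ≤ Δ i / s})
    (r := fun _ => ENNReal.ofReal ρ) (fun i => ?_) fun i w => ?_
  · refine (measure_mono fun ω hω i => ?_).trans (h1.trans_eq (by simp))
    have h2 := hω i
    rw [Set.mem_ofPred_eq, le_div_iff₀ hs, ← abs_of_pos hs, ← abs_mul, sub_mul, abs_of_pos hs,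
      div_mul_cancel₀ _ hs.ne', mul_comm]
    exact h2
  · exact measurableSet_le (by fun_prop) measurable_const
  · obtain ⟨j, hj, hj2⟩ := hv i
    simp only [Set.mem_ofPred_eq]
    refine (measure_pi_abs_sum_sub_le hc hμ (v i) _ _ hj).trans (ENNReal.ofReal_le_ofReal ?_)
    rw [div_le_iff₀ (abs_pos.2 hj), mul_div_assoc', div_le_iff₀ hs]
    linarith

/-- The coefficient vector `z1 - z2 * b` of an equation is large compared to its error. If `|z2| * q` is
at most `8 D`, this holds as a nonzero integer is at least `1`. Otherwise `z2 * b` dominates `z1` in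
the coordinate where `b` is at least `q / 4`. -/
theorem exists_le_abs_sub_mul {k D q : ℕ} (hc : 0 ≤ c) (hk : 3 ≤ k) (hD : 2 ≤ D) {z1 b : Fin p → ℤ}
    {z2 : ℤ} (hz1 : ∀ j, |z1 j| ≤ D) (hb : ∃ j, (q : ℤ) ≤ 4 * b j)
    (hne : ∃ j, z1 j ≠ z2 * b j) :
    ∃ j, ((z1 j - z2 * b j : ℤ) : ℝ) ≠ 0 ∧
      2 * c * (k * D + |(z2 : ℝ)| * (q * (k : ℝ) ^ 2)) ≤
        2 * c * k ^ 4 * D * |((z1 j - z2 * b j : ℤ) : ℝ)| := by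
  have rk : (3 : ℝ) ≤ k := by exact_mod_cast hk
  have rD : (2 : ℝ) ≤ D := by exact_mod_cast hD
  have k2 : 9 ≤ (k : ℝ) ^ 2 := by nlinarith
  have k12 : (k : ℝ) ≤ (k : ℝ) ^ 2 := by nlinarith
  have k4 : (k : ℝ) ^ 4 = (k : ℝ) ^ 2 * (k : ℝ) ^ 2 := by ring
  set T : ℝ := |(z2 : ℝ)| * q with hT
  have hT0 : 0 ≤ T := by positivity
  have e : |(z2 : ℝ)| * (q * (k : ℝ) ^ 2) = T * (k : ℝ) ^ 2 := by rw [hT]; ring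
  rw [e]
  have main : ∀ y : ℝ, k * D + T * (k : ℝ) ^ 2 ≤ (k : ℝ) ^ 4 * D * y →
      2 * c * (k * D + T * (k : ℝ) ^ 2) ≤ 2 * c * k ^ 4 * D * y := fun y hy => by
    refine (mul_le_mul_of_nonneg_left hy (by positivity)).trans_eq (by ring)
  rcases le_total T (8 * D) with h | h
  · obtain ⟨j, hj⟩ := hne
    have h1 : z1 j - z2 * b j ≠ 0 := sub_ne_zero.2 hj
    refine ⟨j, by exact_mod_cast h1, main _ ?_⟩
    have h2 : (1 : ℝ) ≤ |((z1 j - z2 * b j : ℤ) : ℝ)| := by exact_mod_cast Int.one_le_abs h1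
    calc k * D + T * (k : ℝ) ^ 2 ≤ (k : ℝ) ^ 2 * D + 8 * D * (k : ℝ) ^ 2 := by gcongr
      _ = 9 * (k : ℝ) ^ 2 * D := by ring
      _ ≤ (k : ℝ) ^ 4 * D := by rw [k4]; gcongr
      _ ≤ _ := le_mul_of_one_le_right (by positivity) h2
  · obtain ⟨j, hj⟩ := hb
    have h1 : T / 4 ≤ |(z2 : ℝ) * b j| := by
      have : (q : ℝ) ≤ 4 * b j := by exact_mod_cast hj
      rw [abs_mul, abs_of_nonneg (by linarith [(Nat.cast_nonneg q : (0 : ℝ) ≤ q)] : (0 : ℝ) ≤ b j)]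
      rw [hT]
      nlinarith [abs_nonneg (z2 : ℝ)]
    have h2 : |(z1 j : ℝ)| ≤ D := by exact_mod_cast hz1 j
    have h3 : T / 8 ≤ |((z1 j - z2 * b j : ℤ) : ℝ)| := by
      have := abs_sub_abs_le_abs_sub ((z2 : ℝ) * b j) (z1 j : ℝ)
      rw [abs_sub_comm] at this
      push_cast
      linarith
    have h4 : (0 : ℝ) < |((z1 j - z2 * b j : ℤ) : ℝ)| := by linarith
    refine ⟨j, abs_pos.1 h4, main _ ?_⟩
    calc k * D + T * (k : ℝ) ^ 2 ≤ (k : ℝ) ^ 2 * (T / 8) + T * (k : ℝ) ^ 2 := by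
          gcongr; linarith
      _ = 9 * (k : ℝ) ^ 2 * (T / 8) := by ring
      _ ≤ (k : ℝ) ^ 2 * (k : ℝ) ^ 2 * (T / 8) := by gcongr
      _ ≤ (k : ℝ) ^ 4 * D * (T / 8) := by
        rw [k4]
        exact mul_le_mul_of_nonneg_right (le_mul_of_one_le_right (by positivity) (by linarith))
          (by positivity)
      _ ≤ _ := by gcongr

end Typical

end LatticeRegression

namespace LatticeRegression

section Atypical

open scoped ENNReal
open MeasureTheory ProbabilityTheory

variable {n p : ℕ}

open Classical in
/-- The pairs of integral vectors within the bounds for lattice vectors whose first component is not a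
multiple of `b`. -/
noncomputable def wrongPairs (n : ℕ) (k D : ℕ) (b : Fin p → ℤ) :
    Finset ((Fin p → ℤ) × (Fin n → ℤ)) :=
  (Fintype.piFinset (fun _ => Finset.Icc (-(D : ℤ)) D) ×ˢ
    Fintype.piFinset fun _ => Finset.Icc (-((k ^ 10 * D : ℕ) : ℤ)) (k ^ 10 * D : ℕ)).filter
      fun z => ¬∃ r : ℤ, ∀ j, z.1 j = r * b j

theorem mem_wrongPairs {k D : ℕ} {b : Fin p → ℤ} {z : (Fin p → ℤ) × (Fin n → ℤ)} :
    z ∈ wrongPairs n k D b ↔ (∀ j, |z.1 j| ≤ D) ∧ (∀ i, |z.2 i| ≤ (k ^ 10 * D : ℕ)) ∧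
      ¬∃ r : ℤ, ∀ j, z.1 j = r * b j := by
  simp only [wrongPairs, Finset.mem_filter, Finset.mem_product, Fintype.mem_piFinset, Finset.mem_Icc,
    abs_le, and_assoc]

theorem card_wrongPairs_le (k D : ℕ) (b : Fin p → ℤ) :
    (wrongPairs n k D b).card ≤ (2 * D + 1) ^ p * (2 * (k ^ 10 * D) + 1) ^ n := by
  classical
  refine (Finset.card_filter_le _ _).trans ?_
  rw [Finset.card_product, Fintype.card_piFinset, Fintype.card_piFinset]
  simp only [Int.card_Icc, Finset.prod_const, Finset.card_univ, Fintype.card_fin]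
  refine Nat.mul_le_mul (Nat.pow_le_pow_left (by omega) _) (Nat.pow_le_pow_left (by omega) _)

/-- The matrices and noise vectors for which the pair `z` satisfies the approximate linear equations of
short lattice vectors. -/
def wrongSet (N Q R k D : ℕ) (b : Fin p → ℤ) (z : (Fin p → ℤ) × (Fin n → ℤ)) :
    Set ((Fin n → Fin p → ℝ) × (Fin n → ℝ)) :=
  {q | ∀ i, |2 ^ N * ∑ j, q.1 i j * ((z.1 j - z.2 i * b j : ℤ) : ℝ) - z.2 i * (2 ^ N * Q) * q.2 i| ≤
    k * D + |(z.2 i : ℝ)| * (((Q * R : ℕ) : ℝ) * (k : ℝ) ^ 2)}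

/-- The matrices and noise vectors that are atypical for the shifted solution `b`. -/
def atypicalSet (N Q R k D : ℕ) (b : Fin p → ℤ) : Set ((Fin n → Fin p → ℝ) × (Fin n → ℝ)) :=
  (⋃ i, {q | |∑ j, q.1 i j * (b j : ℝ) + Q * q.2 i| < 2 / (k : ℝ) ^ 4}) ∪
    ⋃ z ∈ wrongPairs n k D b, wrongSet N Q R k D b z

theorem measurableSet_atypicalSet (N Q R k D : ℕ) (b : Fin p → ℤ) :
    MeasurableSet (atypicalSet (n := n) N Q R k D b) := by
  refine (MeasurableSet.iUnion fun i => ?_).union (Finset.measurableSet_biUnion _ fun z _ => ?_)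
  · exact measurableSet_lt (by fun_prop) measurable_const
  · rw [wrongSet, Set.ofPred_forall]
    exact MeasurableSet.iInter fun i => measurableSet_le (by fun_prop) measurable_const

variable {Ω : Type*} [MeasurableSpace Ω] {P : Measure Ω} [IsProbabilityMeasure P]
  {X : Ω → Fin n → Fin p → ℝ} {W : Ω → Fin n → ℝ} {μ : Measure ℝ} [IsProbabilityMeasure μ] {c : ℝ}

/-- For each pair all `n` independent equations hold with probability at most
`(2 c k ^ 4 D / 2 ^ N) ^ n`. The union bound over the pairs multiplies this by their number. -/
theorem measure_atypicalSet_le (hXm : ∀ i j, Measurable fun ω => X ω i j)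
    (hXl : ∀ i j, P.map (fun ω => X ω i j) = μ)
    (hXi : iIndepFun (fun (ij : Fin n × Fin p) ω => X ω ij.1 ij.2) P)
    (hWm : Measurable W) (hXW : IndepFun X W P) (hc : 0 ≤ c) (hμ : μ ≤ ENNReal.ofReal c • volume)
    (N Q R : ℕ) {k D : ℕ} (hk : 3 ≤ k) (hD : 2 ≤ D) {b : Fin p → ℤ}
    (hb : ∃ j, ((Q * R : ℕ) : ℤ) ≤ 4 * b j) (hQR : 0 < Q * R) :
    P {ω | (X ω, W ω) ∈ atypicalSet N Q R k D b} ≤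
      ENNReal.ofReal (n * (4 * c / (k : ℝ) ^ 4) +
        (2 * D + 1) ^ p * (2 * ((k : ℝ) ^ 10 * D) + 1) ^ n * (2 * c * k ^ 4 * D / 2 ^ N) ^ n) := by
  have e : {ω | (X ω, W ω) ∈ atypicalSet N Q R k D b} =
      (⋃ i, {ω | |∑ j, X ω i j * (b j : ℝ) + Q * W ω i| < 2 / (k : ℝ) ^ 4}) ∪
        ⋃ z ∈ wrongPairs n k D b, {ω | (X ω, W ω) ∈ wrongSet N Q R k D b z} := by
    ext ω
    simp [atypicalSet]
  rw [e, ENNReal.ofReal_add (by positivity) (by positivity)]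
  refine (measure_union_le _ _).trans (add_le_add ?_ ?_)
  · obtain ⟨j, hj⟩ := hb
    have h1 : 1 ≤ |(b j : ℝ)| := by
      have : 1 ≤ b j := by omega
      have : (1 : ℝ) ≤ b j := by exact_mod_cast this
      exact this.trans (le_abs_self _)
    refine (measure_iUnion_fintype_le _ _).trans ?_
    refine (Finset.sum_le_card_nsmul _ _ (ENNReal.ofReal (4 * c / (k : ℝ) ^ 4)) fun i _ => ?_).trans ?_
    · refine (measure_abs_obs_lt_le hXm hXl hXi hWm hXW hc hμ _ h1 _ (by positivity) i).trans_eq ?_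
      congr 1
      ring
    · rw [ENNReal.ofReal_mul (by positivity)]
      simp
  · refine (measure_biUnion_finset_le _ _).trans ?_
    refine (Finset.sum_le_card_nsmul _ _
      (ENNReal.ofReal (2 * c * k ^ 4 * D / 2 ^ N) ^ n) fun z hz => ?_).trans ?_
    · rw [mem_wrongPairs] at hz
      refine measure_forall_abs_le hXm hXl hXi hWm hXW hc hμ (s := 2 ^ N) (by positivity)
        (fun i j => ((z.1 j - z.2 i * b j : ℤ) : ℝ)) (fun i => z.2 i * (2 ^ N * Q)) _ fun i => ?_
      rw [div_mul_cancel₀ _ (by positivity)]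
      refine exists_le_abs_sub_mul hc hk hD hz.1 hb ?_
      by_contra h
      push Not at h
      exact hz.2.2 ⟨_, h⟩
    · rw [nsmul_eq_mul, ENNReal.ofReal_mul (by positivity), ENNReal.ofReal_pow (by positivity)]
      gcongr
      rw [← ENNReal.ofReal_natCast]
      refine ENNReal.ofReal_le_ofReal ?_
      exact_mod_cast card_wrongPairs_le k D b

/-- Shifts in the range of the algorithm for which the shifted solution `B + ζ` has coprime coordinates
and a coordinate of at least `r / 4`. -/
def GoodShift (r : ℕ) (B ζ : Fin p → ℤ) : Prop :=
  (∀ j, ζ j ∈ shiftRange p r) ∧ (∀ g : ℤ, (∀ j, g ∣ B j + ζ j) → g.natAbs = 1) ∧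
    ∃ j, (r : ℤ) ≤ 4 * (B j + ζ j)

theorem measure_not_GoodShift_le {Z : Ω → Fin p → ℤ} {r : ℕ} (hr : 0 < r) (hp : 0 < p)
    (hZm : ∀ j, Measurable fun ω => Z ω j)
    (hZl : ∀ j, P.map (fun ω => Z ω j) = uniformOn (shiftRange p r : Set ℤ))
    (hZi : iIndepFun (fun j ω => Z ω j) P) {B : Fin p → ℤ} (hB : ∀ j, |B j| ≤ r) :
    P.real {ω | ¬GoodShift r B (Z ω)} ≤ 13 * (2 / 3) ^ p := by
  have h1 : {ω | ¬GoodShift r B (Z ω)} ⊆ {ω | ∃ j, Z ω j ∉ shiftRange p r} ∪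
      ({ω | ∃ q ∈ Finset.Icc 2 (3 * (r + Nat.log 2 p)), ∀ j, (q : ℤ) ∣ B j + Z ω j} ∪
        {ω | ∀ j, 4 * (B j + Z ω j) < r}) := by
    intro ω hω
    by_contra h
    simp only [Set.mem_union, Set.mem_ofPred_eq, not_or, not_exists, not_not, not_forall,
      not_and] at h
    obtain ⟨ha, hb, j, hj⟩ := h
    refine hω ⟨ha, fun g hg => ?_, j, not_lt.1 hj⟩
    by_contra hg1
    have h2 := ha ⟨0, hp⟩
    rw [shiftRange_eq_Ioc, Finset.mem_Ioc] at h2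
    have h3 := abs_le.1 (hB ⟨0, hp⟩)
    have h4 : 0 < B ⟨0, hp⟩ + Z ω ⟨0, hp⟩ := by omega
    have h5 := Int.le_of_dvd h4 ((Int.natAbs_dvd).2 (hg ⟨0, hp⟩))
    have h6 : g.natAbs ≠ 0 := fun h => by
      rw [Int.natAbs_eq_zero.1 h] at hg
      have := zero_dvd_iff.1 (hg ⟨0, hp⟩)
      omega
    obtain ⟨j', hj'⟩ := hb g.natAbs (by rw [Finset.mem_Icc]; omega)
    exact hj' (Int.natAbs_dvd.2 (hg j'))
  have h2 := measure_shift_notMem hZm hZl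
  have h3 := measure_exists_dvd_le hr hp hZm hZl hZi B
  have h4 := measure_forall_lt_le hr hZm hZl hZi hB
  have h5 := (measureReal_mono (μ := P) h1).trans ((measureReal_union_le _ _).trans
    (add_le_add_right (measureReal_union_le _ _) _))
  linarith

/-- The failure probability of LBR. The shift is conditioned on, since the atypical set depends on it. -/
theorem measure_not_good_le {Z : Ω → Fin p → ℤ} {ν : Measure ℝ} {N Q R : ℕ} {M σ : ℝ}
    (hn : 0 < n) (hp : 0 < p) (hQ : 0 < Q) (hR : 0 < R)
    (hXm : ∀ i j, Measurable fun ω => X ω i j)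
    (hXl : ∀ i j, P.map (fun ω => X ω i j) = μ)
    (hXi : iIndepFun (fun (ij : Fin n × Fin p) ω => X ω ij.1 ij.2) P)
    (hc : 0 ≤ c) (hμ : μ ≤ ENNReal.ofReal c • volume)
    (hμi : Integrable (fun x => x) μ) (hM : ∫ x, |x| ∂μ ≤ M)
    (hWm : ∀ i, Measurable fun ω => W ω i) (hXW : IndepFun X W P)
    (hWl : ∀ i, P.map (fun ω => W ω i) = ν) (hν : MemLp (fun x => x) 2 ν)
    (h0 : ∫ x, x ∂ν = 0) (hσ : variance (fun x => x) ν ≤ σ ^ 2)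
    (hZm : ∀ j, Measurable fun ω => Z ω j)
    (hZl : ∀ j, P.map (fun ω => Z ω j) = uniformOn (shiftRange p (Q * R) : Set ℤ))
    (hZi : iIndepFun (fun j ω => Z ω j) P) (hUZ : IndepFun (fun ω => (X ω, W ω)) Z P)
    {B : Fin p → ℤ} (hB : ∀ j, |B j| ≤ (Q * R : ℕ)) {k D : ℕ} (hk : k = p + 2 * n)
    (hD : D = lengthBound n p Q R) :
    P.real {ω | ¬(Good N Q R (X ω) (W ω) B (Z ω) ∧ ∀ j, Z ω j ∈ shiftRange p (Q * R))} ≤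
      n * (p * (M / (k : ℝ) ^ 4)) + n * (σ ^ 2 / ((n * p : ℝ) / 2 ^ N) ^ 2) + 13 * (2 / 3) ^ p +
      (n * (4 * c / (k : ℝ) ^ 4) +
        (2 * D + 1) ^ p * (2 * ((k : ℝ) ^ 10 * D) + 1) ^ n * (2 * c * k ^ 4 * D / 2 ^ N) ^ n) := by
  classical
  have hk3 : 3 ≤ k := by omega
  have hQR : 0 < Q * R := Nat.mul_pos hQ hR
  have hD2 : 2 ≤ D := by
    rw [hD, lengthBound, ← hk]
    have h1 : 1 ≤ 2 ^ ((k + 1) / 2) * (Q * R) := Nat.mul_pos (by positivity) hQR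
    have h2 : 3 ^ 3 ≤ k ^ 3 := Nat.pow_le_pow_left hk3 3
    nlinarith
  have rk : (0 : ℝ) < k := by exact_mod_cast (by omega : 0 < k)
  have rn : (0 : ℝ) < n := by exact_mod_cast hn
  have rp : (0 : ℝ) < p := by exact_mod_cast hp
  set F : Finset (Fin p → ℤ) :=
    (Fintype.piFinset fun _ => shiftRange p (Q * R)).filter (GoodShift (Q * R) B) with hF
  have hsub : {ω | ¬(Good N Q R (X ω) (W ω) B (Z ω) ∧ ∀ j, Z ω j ∈ shiftRange p (Q * R))} ⊆
      (({ω | ∃ i j, (k : ℝ) ^ 4 < |X ω i j|} ∪ {ω | ∃ i, (n * p : ℝ) / 2 ^ N < |W ω i|}) ∪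
        {ω | ¬GoodShift (Q * R) B (Z ω)}) ∪
        {ω | Z ω ∈ F ∧ (X ω, W ω) ∈ atypicalSet N Q R k D (fun j => B j + Z ω j)} := by
    intro ω hω
    by_contra h
    simp only [Set.mem_union, Set.mem_ofPred_eq, not_or, not_exists, not_not, not_lt] at h
    obtain ⟨⟨⟨hX, hW⟩, hZ⟩, hU⟩ := h
    have hU' : (X ω, W ω) ∉ atypicalSet N Q R k D (fun j => B j + Z ω j) := fun h => hU
      ⟨by rw [hF, Finset.mem_filter, Fintype.mem_piFinset]; exact ⟨hZ.1, hZ⟩, h⟩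
    simp only [atypicalSet, Set.mem_union, not_or, Set.mem_iUnion, Set.mem_ofPred_eq, not_exists,
      not_lt] at hU'
    refine hω ⟨⟨fun i j => ?_, fun i => ?_, fun i => ?_, hZ.2.1, fun z1 z2 h1 h2 h3 => ?_⟩, hZ.1⟩
    · rw [← hk]; exact hX i j
    · have := hW i
      rwa [le_div_iff₀ (by positivity), mul_comm] at this
    · rw [← hk]; exact hU'.1 i
    · by_contra hr
      rw [← hk, ← hD] at h2
      rw [← hD] at h1
      refine hU'.2 (z1, z2) (mem_wrongPairs.2 ⟨h1, h2, hr⟩) fun i => ?_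
      have := h3 i
      rw [← hk, ← hD] at this
      simp only [Nat.cast_mul]
      convert this using 3
      ring
  have hlast : P {ω | Z ω ∈ F ∧ (X ω, W ω) ∈ atypicalSet N Q R k D (fun j => B j + Z ω j)} ≤ _ :=
    measure_mem_of_indepFun_le hUZ (measurable_pi_iff.2 hZm)
      (E := fun ζ => atypicalSet N Q R k D (fun j => B j + ζ j))
      (fun ζ _ => measurableSet_atypicalSet _ _ _ _ _ _) fun ζ hζ =>
        measure_atypicalSet_le hXm hXl hXi (measurable_pi_iff.2 hWm) hXW hc hμ N Q R hk3 hD2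
          (Finset.mem_filter.1 hζ).2.2.2 hQR
  have h1 := measureReal_exists_lt_abs_entry_le hXm hXl hμi (t := (k : ℝ) ^ 4) (by positivity) hM
  have h2 := measureReal_exists_lt_abs_noise_le hWm hWl hν h0 hσ
    (t := (n * p : ℝ) / 2 ^ N) (by positivity)
  have h3 := measure_not_GoodShift_le hQR hp hZm hZl hZi hB
  have h4 := ENNReal.toReal_le_of_le_ofReal (by positivity) hlast
  refine (measureReal_mono hsub).trans ((measureReal_union_le _ _).trans (add_le_add ?_ h4))
  refine (measureReal_union_le _ _).trans (add_le_add ?_ h3)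
  exact (measureReal_union_le _ _).trans (add_le_add h1 h2)

end Atypical

end LatticeRegression

namespace LatticeRegression

/-! ### Estimates for the parameters -/

section Parameters

open Filter Topology

theorem eventually_pow_mul_le_two_rpow {c : ℝ} (hc : 0 < c) :
    ∀ᶠ k : ℕ in atTop, (k : ℝ) ^ 13 * (1 + c) ≤ 2 ^ (√(k : ℝ) / 2) := by
  have hl : 0 < Real.log 2 / 2 := by have := Real.log_pos (by norm_num : (1 : ℝ) < 2); linarith
  have h1 : Tendsto (fun k : ℕ => √(k : ℝ) * (Real.log 2 / 2)) atTop atTop :=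
    (Real.tendsto_sqrt_atTop.comp tendsto_natCast_atTop_atTop).atTop_mul_const hl
  have h2 := (Real.isLittleO_pow_exp_atTop (n := 26)).bound
    (show 0 < (Real.log 2 / 2) ^ 26 / (1 + c) by positivity)
  filter_upwards [h1.eventually h2] with k hk
  rw [Real.norm_of_nonneg (by positivity), Real.norm_of_nonneg (by positivity), mul_pow,
    div_mul_eq_mul_div, le_div_iff₀ (by positivity)] at hk
  have e1 : √(k : ℝ) ^ 26 = (k : ℝ) ^ 13 := by
    rw [show 26 = 2 * 13 by norm_num, pow_mul, Real.sq_sqrt (by positivity)]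
  have e2 : (2 : ℝ) ^ (√(k : ℝ) / 2) = Real.exp (√(k : ℝ) * (Real.log 2 / 2)) := by
    rw [Real.rpow_def_of_pos (by norm_num)]
    congr 1; ring
  rw [e1] at hk
  rw [e2]
  refine le_of_mul_le_mul_left ?_ (pow_pos hl 26)
  linarith

/-- The two lower bounds for `k = p + 2 n` that depend only on the density bound. -/
theorem exists_forall_large {c : ℝ} (hc : 0 < c) :
    ∃ k0 : ℕ, ∀ k ≥ k0, 6 ≤ k ∧ (k : ℝ) ^ 13 * (1 + c) ≤ 2 ^ (√(k : ℝ) / 2) ∧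
      (1 + c) ≤ (k : ℝ) ^ (1 / 4 : ℝ) := by
  have h3 : ∀ᶠ k : ℕ in atTop, (1 + c) ≤ (k : ℝ) ^ (1 / 4 : ℝ) :=
    ((tendsto_rpow_atTop (by norm_num : (0 : ℝ) < 1 / 4)).comp
      tendsto_natCast_atTop_atTop).eventually_ge_atTop _
  exact eventually_atTop.1 ((eventually_ge_atTop 6).and ((eventually_pow_mul_le_two_rpow hc).and h3))

/-- The lower bound for `p` makes the gain `2 ^ (ε k / 2)` larger than any polynomial loss: if `ε` is
not small this holds for all large `k`, otherwise `ε p` is at least a large multiple of `log k`. -/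
theorem pow_mul_le_two_rpow {c ε : ℝ} {p k : ℕ} (hc : 0 < c) (hε : 0 < ε) (hk : 6 ≤ k)
    (h1 : (k : ℝ) ^ 13 * (1 + c) ≤ 2 ^ (√(k : ℝ) / 2)) (h2 : (1 + c) ≤ (k : ℝ) ^ (1 / 4 : ℝ))
    (hpk : p ≤ k) (hp : 300 / ε * Real.logb 2 (300 / ((1 + c) * ε)) ≤ p) :
    (k : ℝ) ^ 13 * (1 + c) ≤ 2 ^ (ε * k / 2) := by
  have rk : (6 : ℝ) ≤ k := by exact_mod_cast hk
  have rpk : (p : ℝ) ≤ k := by exact_mod_cast hpk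
  have k0 : (0 : ℝ) < k := by linarith
  have hs : 0 < √(k : ℝ) := Real.sqrt_pos.2 k0
  have hss : √(k : ℝ) * √(k : ℝ) = k := Real.mul_self_sqrt k0.le
  rcases le_total 1 (ε * √(k : ℝ)) with h | h
  · refine h1.trans (Real.rpow_le_rpow_of_exponent_le (by norm_num) ?_)
    have : √(k : ℝ) ≤ ε * k := by nlinarith
    linarith
  · have h3 : (k : ℝ) ^ (1 / 4 : ℝ) ≤ 300 / ((1 + c) * ε) := by
      rw [le_div_iff₀ (by positivity)]
      have e : (k : ℝ) ^ (1 / 4 : ℝ) * (k : ℝ) ^ (1 / 4 : ℝ) = √(k : ℝ) := by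
        rw [← Real.rpow_add k0, Real.sqrt_eq_rpow]; norm_num
      calc (k : ℝ) ^ (1 / 4 : ℝ) * ((1 + c) * ε) ≤
            (k : ℝ) ^ (1 / 4 : ℝ) * ((k : ℝ) ^ (1 / 4 : ℝ) * ε) := by gcongr
        _ = ε * √(k : ℝ) := by rw [← mul_assoc, e, mul_comm]
        _ ≤ 300 := by linarith
    have h4 : 1 / 4 * Real.logb 2 k ≤ Real.logb 2 (300 / ((1 + c) * ε)) := by
      rw [← Real.logb_rpow_eq_mul_logb_of_pos k0]
      exact Real.logb_le_logb_of_le (by norm_num) (by positivity) h3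
    have h5 : 75 * Real.logb 2 k ≤ ε * k := by
      rw [div_mul_eq_mul_div, div_le_iff₀ hε] at hp
      have : (p : ℝ) * ε ≤ k * ε := mul_le_mul_of_nonneg_right rpk hε.le
      linarith
    have h6 : (k : ℝ) ^ (14 : ℕ) = 2 ^ (14 * Real.logb 2 k) := by
      rw [mul_comm, Real.rpow_mul (by norm_num), Real.rpow_logb (by norm_num) (by norm_num) k0]
      norm_cast
    have h7 : 0 ≤ Real.logb 2 k := Real.logb_nonneg (by norm_num) (by linarith)
    have h8 : (k : ℝ) ^ (1 / 4 : ℝ) ≤ k := by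
      conv_rhs => rw [← Real.rpow_one (k : ℝ)]
      exact Real.rpow_le_rpow_of_exponent_le (by linarith) (by norm_num)
    calc (k : ℝ) ^ 13 * (1 + c) ≤ (k : ℝ) ^ 13 * k := by gcongr; linarith
      _ = (k : ℝ) ^ (14 : ℕ) := by ring
      _ ≤ 2 ^ (ε * k / 2) := by
        rw [h6]
        exact Real.rpow_le_rpow_of_exponent_le (by norm_num) (by linarith)

variable {n p Q R N k : ℕ} {ε c : ℝ}

theorem lengthBound_le (hk : k = p + 2 * n) (hQ : 0 < Q) (hR : 0 < R) :
    (lengthBound n p Q R : ℝ) ≤ 2 ^ ((k : ℝ) / 2 + Real.logb 2 (R * Q)) * (2 * (k : ℝ) ^ 3) := by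
  have hq : (0 : ℝ) < R * Q := by positivity
  have e : (lengthBound n p Q R : ℝ) = 2 ^ ((k + 1) / 2) * (R * Q) * (k : ℝ) ^ 3 := by
    rw [lengthBound, ← hk]; push_cast; ring
  rw [e, Real.rpow_add (by norm_num), Real.rpow_logb (by norm_num) (by norm_num) hq]
  have h1 : (2 : ℝ) ^ ((k + 1) / 2) ≤ 2 ^ ((k : ℝ) / 2) * 2 := by
    have h2 : (((k + 1) / 2 : ℕ) : ℝ) ≤ (k : ℝ) / 2 + 1 := by
      refine Nat.cast_div_le.trans ?_
      push_cast; linarith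
    calc (2 : ℝ) ^ ((k + 1) / 2) = 2 ^ (((k + 1) / 2 : ℕ) : ℝ) := (Real.rpow_natCast _ _).symm
      _ ≤ 2 ^ ((k : ℝ) / 2 + 1) := Real.rpow_le_rpow_of_exponent_le (by norm_num) h2
      _ = _ := by rw [Real.rpow_add (by norm_num), Real.rpow_one]
  calc _ ≤ 2 ^ ((k : ℝ) / 2) * 2 * (R * Q) * (k : ℝ) ^ 3 := by gcongr
    _ = _ := by ring

/-- The hypothesis on `N` in terms of `k = p + 2 n`. -/
theorem mul_le_of_le_truncation (hn : 0 < n) (hk : k = p + 2 * n)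
    (hN : (1 + ε) * (((p : ℝ) + 2 * n) ^ 2 / (2 * n) + (2 + (p : ℝ) / n) * Real.logb 2 (R * Q)) ≤ N) :
    (1 + ε) * ((k : ℝ) / 2 + Real.logb 2 (R * Q)) * k ≤ N * n := by
  have rn : (0 : ℝ) < n := by exact_mod_cast hn
  have rk : (k : ℝ) = p + 2 * n := by rw [hk]; push_cast; ring
  have e : (1 + ε) * (((p : ℝ) + 2 * n) ^ 2 / (2 * n) + (2 + (p : ℝ) / n) * Real.logb 2 (R * Q)) * n =
      (1 + ε) * ((k : ℝ) / 2 + Real.logb 2 (R * Q)) * k := by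
    rw [rk]; field_simp; ring
  rw [← e]
  exact mul_le_mul_of_nonneg_right hN rn.le

theorem logb_mul_nonneg (hQ : 0 < Q) (hR : 0 < R) : 0 ≤ Real.logb 2 ((R : ℝ) * Q) := by
  have : (1 : ℝ) ≤ R * Q := by exact_mod_cast Nat.mul_pos hR hQ
  exact Real.logb_nonneg (by norm_num) this

/-- Since `N n / k` is at least `(1 + ε) (k / 2 + log (R Q))`, the number of wrong pairs and all factors
polynomial in `k` are absorbed by `2 ^ (N n)`. -/
theorem lengthBound_mul_pow_le (hn : 0 < n) (hQ : 0 < Q) (hR : 0 < R) (hε : 0 < ε) (hc : 0 < c)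
    (hk : k = p + 2 * n)
    (hN : (1 + ε) * (((p : ℝ) + 2 * n) ^ 2 / (2 * n) + (2 + (p : ℝ) / n) * Real.logb 2 (R * Q)) ≤ N)
    (hkε : (k : ℝ) ^ 13 * (1 + c) ≤ 2 ^ (ε * k / 2)) :
    ((lengthBound n p Q R : ℝ) * (k : ℝ) ^ 9 * (1 + c)) ^ k ≤ 2 ^ (N * n) := by
  have hk2 : (2 : ℝ) ≤ k := by exact_mod_cast (by omega : 2 ≤ k)
  have k0 : (0 : ℝ) < k := by linarith
  have hl := logb_mul_nonneg hQ hR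
  have h1 := mul_le_of_le_truncation hn hk hN
  rw [← le_div_iff₀ k0] at h1
  have h2 : (lengthBound n p Q R : ℝ) * (k : ℝ) ^ 9 * (1 + c) ≤ 2 ^ ((N : ℝ) * n / k) := by
    have h3 : (lengthBound n p Q R : ℝ) * (k : ℝ) ^ 9 * (1 + c) * (k : ℝ) ^ 4 ≤
        2 ^ ((N : ℝ) * n / k) * (k : ℝ) ^ 4 := by
      calc (lengthBound n p Q R : ℝ) * (k : ℝ) ^ 9 * (1 + c) * (k : ℝ) ^ 4
          = lengthBound n p Q R * ((k : ℝ) ^ 13 * (1 + c)) := by ring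
        _ ≤ 2 ^ ((k : ℝ) / 2 + Real.logb 2 (R * Q)) * (2 * (k : ℝ) ^ 3) * 2 ^ (ε * k / 2) :=
          mul_le_mul (lengthBound_le hk hQ hR) hkε (by positivity) (by positivity)
        _ = 2 ^ ((k : ℝ) / 2 + Real.logb 2 (R * Q) + ε * k / 2) * (2 * (k : ℝ) ^ 3) := by
          rw [Real.rpow_add (by norm_num) _ (ε * k / 2)]; ring
        _ ≤ 2 ^ ((N : ℝ) * n / k) * (k : ℝ) ^ 4 := by
          refine mul_le_mul (Real.rpow_le_rpow_of_exponent_le (by norm_num) ?_) ?_ (by positivity)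
            (by positivity)
          · have := mul_nonneg hε.le hl
            nlinarith
          · rw [pow_succ' (k : ℝ) 3]; gcongr
    exact le_of_mul_le_mul_right h3 (by positivity)
  calc ((lengthBound n p Q R : ℝ) * (k : ℝ) ^ 9 * (1 + c)) ^ k
      ≤ (2 ^ ((N : ℝ) * n / k)) ^ k := pow_le_pow_left₀ (by positivity) h2 k
    _ = 2 ^ (N * n) := by
      rw [← Real.rpow_natCast, ← Real.rpow_mul (by norm_num), div_mul_cancel₀ _ k0.ne',
        ← Real.rpow_natCast]
      push_cast; rfl

/-- The union bound over the wrong pairs. -/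
theorem union_bound_le (hn : 0 < n) (hp : 0 < p) (hQ : 0 < Q) (hR : 0 < R) (hε : 0 < ε) (hc : 0 < c)
    (hk : k = p + 2 * n) (hk6 : 6 ≤ k) {D : ℕ} (hD : D = lengthBound n p Q R)
    (hN : (1 + ε) * (((p : ℝ) + 2 * n) ^ 2 / (2 * n) + (2 + (p : ℝ) / n) * Real.logb 2 (R * Q)) ≤ N)
    (hkε : (k : ℝ) ^ 13 * (1 + c) ≤ 2 ^ (ε * k / 2)) :
    (2 * D + 1 : ℝ) ^ p * (2 * ((k : ℝ) ^ 10 * D) + 1) ^ n * (2 * c * k ^ 4 * D / 2 ^ N) ^ n ≤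
      1 / (n * p) := by
  have h1 := lengthBound_mul_pow_le hn hQ hR hε hc hk hN hkε
  rw [← hD] at h1
  have rk : (6 : ℝ) ≤ k := by exact_mod_cast hk6
  have rD : (1 : ℝ) ≤ D := by
    have : 0 < lengthBound n p Q R := by
      rw [lengthBound]
      have := Nat.mul_pos hQ hR
      have : 0 < p + 2 * n := by omega
      positivity
    rw [hD]; exact_mod_cast this
  have k1 : 1 ≤ (k : ℝ) := by linarith
  have rn : (0 : ℝ) < n := by exact_mod_cast hn
  have rp : (0 : ℝ) < p := by exact_mod_cast hp
  have hnp : (n : ℝ) * p ≤ (k : ℝ) ^ 2 := by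
    have : n * p ≤ k ^ 2 := by rw [sq]; exact Nat.mul_le_mul (by omega) (by omega)
    exact_mod_cast this
  rw [div_pow, ← pow_mul, mul_div_assoc', div_le_div_iff₀ (by positivity) (by positivity), one_mul]
  refine le_trans ?_ h1
  have a1 : (2 * D + 1 : ℝ) ≤ k * D := by nlinarith
  have a2 : (2 * ((k : ℝ) ^ 10 * D) + 1) * (2 * c * k ^ 4 * D) ≤ (k : ℝ) ^ 16 * (1 + c) * D ^ 2 := by
    have b1 : 1 ≤ (k : ℝ) ^ 10 * D := one_le_mul_of_one_le_of_one_le (one_le_pow₀ k1) rD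
    have b2 : 2 * ((k : ℝ) ^ 10 * D) + 1 ≤ 3 * ((k : ℝ) ^ 10 * D) := by linarith
    calc (2 * ((k : ℝ) ^ 10 * D) + 1) * (2 * c * k ^ 4 * D)
        ≤ 3 * ((k : ℝ) ^ 10 * D) * (2 * (1 + c) * k ^ 4 * D) := by gcongr; linarith
      _ = 6 * 1 * ((k : ℝ) ^ 14 * (1 + c) * D ^ 2) := by ring
      _ ≤ k * k * ((k : ℝ) ^ 14 * (1 + c) * D ^ 2) := by gcongr
      _ = _ := by ring
  calc (2 * D + 1 : ℝ) ^ p * (2 * ((k : ℝ) ^ 10 * D) + 1) ^ n * (2 * c * k ^ 4 * D) ^ n * (n * p)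
      = (2 * D + 1 : ℝ) ^ p * ((2 * ((k : ℝ) ^ 10 * D) + 1) * (2 * c * k ^ 4 * D)) ^ n * (n * p) := by
        rw [mul_pow _ (2 * c * k ^ 4 * D : ℝ) n, mul_assoc ((2 * D + 1 : ℝ) ^ p)]
    _ ≤ (k * D : ℝ) ^ p * ((k : ℝ) ^ 16 * (1 + c) * D ^ 2) ^ n * ((k : ℝ) ^ 2) ^ n := by
        gcongr
        exact hnp.trans (le_self_pow₀ (one_le_pow₀ k1) hn.ne')
    _ = (k : ℝ) ^ (p + 18 * n) * (1 + c) ^ n * (D : ℝ) ^ k := by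
        have e : (D : ℝ) ^ k = D ^ p * (D ^ 2) ^ n := by rw [hk, pow_add, pow_mul]
        rw [e, mul_pow (k : ℝ) D p, mul_pow _ ((D : ℝ) ^ 2) n, mul_pow _ (1 + c) n]
        ring
    _ ≤ (k : ℝ) ^ (9 * k) * (1 + c) ^ k * (D : ℝ) ^ k := by
        have e1 : (k : ℝ) ^ (p + 18 * n) ≤ (k : ℝ) ^ (9 * k) := pow_le_pow_right₀ k1 (by omega)
        have e2 : (1 + c) ^ n ≤ (1 + c) ^ k := pow_le_pow_right₀ (by linarith) (by omega)
        gcongr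
    _ = ((D : ℝ) * (k : ℝ) ^ 9 * (1 + c)) ^ k := by
        rw [mul_pow, mul_pow, ← pow_mul]; ring

/-- The truncation level is so large that nonzero observations exceed the vectors found by LLL. -/
theorem pow_mul_lengthBound_lt (hn : 0 < n) (hQ : 0 < Q) (hR : 0 < R) (hε : 0 < ε) (hc : 0 < c)
    (hk : k = p + 2 * n) (hk6 : 6 ≤ k)
    (hN : (1 + ε) * (((p : ℝ) + 2 * n) ^ 2 / (2 * n) + (2 + (p : ℝ) / n) * Real.logb 2 (R * Q)) ≤ N)
    (h1 : (k : ℝ) ^ 13 * (1 + c) ≤ 2 ^ (√(k : ℝ) / 2)) :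
    k ^ 4 * lengthBound n p Q R < 2 ^ N := by
  have rk : (6 : ℝ) ≤ k := by exact_mod_cast hk6
  have k0 : (0 : ℝ) < k := by linarith
  have rn : (0 : ℝ) < n := by exact_mod_cast hn
  have hl := logb_mul_nonneg hQ hR
  have h2 := mul_le_of_le_truncation hn hk hN
  have h3 : (k : ℝ) + Real.logb 2 (R * Q) ≤ N := by
    have hkn : 2 * (n : ℝ) ≤ k := by exact_mod_cast (by omega : 2 * n ≤ k)
    have h4 : ((k : ℝ) / 2 + Real.logb 2 (R * Q)) * (2 * n) ≤ N * n := by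
      have h5 : ((k : ℝ) / 2 + Real.logb 2 (R * Q)) * (2 * n) ≤
          ((k : ℝ) / 2 + Real.logb 2 (R * Q)) * k := mul_le_mul_of_nonneg_left hkn (by positivity)
      have h6 : 0 ≤ ε * (((k : ℝ) / 2 + Real.logb 2 (R * Q)) * k) := by positivity
      nlinarith
    have h5 : ((k : ℝ) / 2 + Real.logb 2 (R * Q)) * 2 ≤ N := by
      refine le_of_mul_le_mul_right ?_ rn
      linarith
    linarith
  have hs : √(k : ℝ) ≤ k / 2 := by
    rw [Real.sqrt_le_left (by positivity)]
    nlinarith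
  have h7 : (k : ℝ) ^ 7 * 2 < 2 ^ ((k : ℝ) / 2) := by
    calc (k : ℝ) ^ 7 * 2 < (k : ℝ) ^ 7 * (k : ℝ) ^ 6 := by
          gcongr
          calc (2 : ℝ) < 6 ^ 6 := by norm_num
            _ ≤ (k : ℝ) ^ 6 := by gcongr
      _ = (k : ℝ) ^ 13 := by ring
      _ ≤ (k : ℝ) ^ 13 * (1 + c) := le_mul_of_one_le_right (by positivity) (by linarith)
      _ ≤ 2 ^ (√(k : ℝ) / 2) := h1
      _ ≤ 2 ^ ((k : ℝ) / 2) := Real.rpow_le_rpow_of_exponent_le (by norm_num) (by linarith)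
  have h8 : (k : ℝ) ^ 4 * lengthBound n p Q R < 2 ^ N := by
    calc (k : ℝ) ^ 4 * lengthBound n p Q R
        ≤ (k : ℝ) ^ 4 * (2 ^ ((k : ℝ) / 2 + Real.logb 2 (R * Q)) * (2 * (k : ℝ) ^ 3)) := by
          gcongr; exact lengthBound_le hk hQ hR
      _ = 2 ^ ((k : ℝ) / 2 + Real.logb 2 (R * Q)) * ((k : ℝ) ^ 7 * 2) := by ring
      _ < 2 ^ ((k : ℝ) / 2 + Real.logb 2 (R * Q)) * 2 ^ ((k : ℝ) / 2) := by gcongr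
      _ = 2 ^ ((k : ℝ) + Real.logb 2 (R * Q)) := by
          rw [← Real.rpow_add (by norm_num)]; congr 1; ring
      _ ≤ 2 ^ (N : ℝ) := Real.rpow_le_rpow_of_exponent_le (by norm_num) h3
      _ = 2 ^ N := Real.rpow_natCast _ _
  exact_mod_cast h8

theorem size_le_logb_add_one (hQ : 0 < Q) : (Nat.size Q : ℝ) ≤ Real.logb 2 Q + 1 := by
  have h1 : Nat.size Q = Nat.log 2 Q + 1 := by
    refine le_antisymm (Nat.size_le.2 (Nat.lt_pow_succ_log_self (by norm_num) Q)) ?_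
    exact Nat.lt_size.2 (Nat.pow_log_le_self 2 hQ.ne')
  rw [h1]
  push_cast
  have := Real.natLog_le_logb Q 2
  push_cast at this
  linarith

end Parameters

end LatticeRegression

namespace LatticeRegression

section Conclusion

open MeasureTheory ProbabilityTheory

theorem sizeSum_le {n p Q R N : ℕ} (hn : 0 < n) (hp : 0 < p) (hQ : 0 < Q) (hR : 0 < R) :
    ((100 + N + 10 * (p + 2 * n) + Nat.size Q + Nat.size R : ℕ) : ℝ) ≤
      100 * ((n : ℝ) + p + N + Real.logb 2 R + Real.logb 2 Q) := by
  have h1 := size_le_logb_add_one hQ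
  have h2 := size_le_logb_add_one hR
  have h3 : 0 ≤ Real.logb 2 (Q : ℝ) := Real.logb_nonneg (by norm_num) (by exact_mod_cast hQ)
  have h4 : 0 ≤ Real.logb 2 (R : ℝ) := Real.logb_nonneg (by norm_num) (by exact_mod_cast hR)
  have h5 : (1 : ℝ) ≤ n := by exact_mod_cast hn
  have h6 : (1 : ℝ) ≤ p := by exact_mod_cast hp
  have h7 : (0 : ℝ) ≤ N := Nat.cast_nonneg N
  push_cast
  linarith

/-- The noise level is at most the truncation error `2 ^ (-N)`. -/
theorem mul_two_pow_le_one {σ : ℝ} {N : ℕ} (hσ : 0 ≤ σ)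
    (h : 0 < σ → (N : ℝ) ≤ Real.logb 2 (1 / σ)) : σ * 2 ^ N ≤ 1 := by
  rcases hσ.eq_or_lt with rfl | hpos
  · simp
  · have h1 := (Real.le_logb_iff_rpow_le (by norm_num) (by positivity)).1 (h hpos)
    rw [Real.rpow_natCast, le_div_iff₀ hpos] at h1
    linarith

/-- All contributions to the failure probability are of the order `1 / (n p)` or `(2 / 3) ^ p`, as
`k ^ 4` is at least `(n p) ^ 2`. -/
theorem failure_le {n p k N D : ℕ} {c M σ : ℝ} (hn : 0 < n) (hp : 0 < p) (hk : k = p + 2 * n)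
    (hc : 0 < c) (hσ0 : 0 ≤ σ) (hσ : σ * 2 ^ N ≤ 1)
    (hD : (2 * D + 1 : ℝ) ^ p * (2 * ((k : ℝ) ^ 10 * D) + 1) ^ n * (2 * c * k ^ 4 * D / 2 ^ N) ^ n ≤
      1 / (n * p)) :
    n * (p * (M / (k : ℝ) ^ 4)) + n * (σ ^ 2 / ((n * p : ℝ) / 2 ^ N) ^ 2) + 13 * (2 / 3) ^ p +
      (n * (4 * c / (k : ℝ) ^ 4) +
        (2 * D + 1 : ℝ) ^ p * (2 * ((k : ℝ) ^ 10 * D) + 1) ^ n * (2 * c * k ^ 4 * D / 2 ^ N) ^ n) ≤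
      (|M| + 4 * c + 15) * (1 / ((n : ℝ) * p) + (2 / 3) ^ p) := by
  have rn : (1 : ℝ) ≤ n := by exact_mod_cast hn
  have rp : (1 : ℝ) ≤ p := by exact_mod_cast hp
  have k0 : (0 : ℝ) < k := by exact_mod_cast (by omega : 0 < k)
  have hnp : (n : ℝ) * p ≤ (k : ℝ) ^ 2 := by
    have : n * p ≤ k ^ 2 := by rw [sq]; exact Nat.mul_le_mul (by omega) (by omega)
    exact_mod_cast this
  have hnp0 : (0 : ℝ) < n * p := by positivity
  have hk4 : ((n : ℝ) * p) * (n * p) ≤ (k : ℝ) ^ 4 := by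
    calc ((n : ℝ) * p) * (n * p) ≤ (k : ℝ) ^ 2 * (k : ℝ) ^ 2 := by gcongr
      _ = (k : ℝ) ^ 4 := by ring
  have h0 : ((n : ℝ) * p) / (k : ℝ) ^ 4 ≤ 1 / (n * p) := by
    rw [div_le_div_iff₀ (by positivity) hnp0, one_mul]
    exact hk4
  have h1 : n * (p * (M / (k : ℝ) ^ 4)) ≤ |M| * (1 / (n * p)) := by
    calc n * (p * (M / (k : ℝ) ^ 4)) = M * ((n * p) / (k : ℝ) ^ 4) := by ring
      _ ≤ |M| * ((n * p) / (k : ℝ) ^ 4) := by gcongr; exact le_abs_self M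
      _ ≤ _ := by gcongr
  have h2 : n * (σ ^ 2 / ((n * p : ℝ) / 2 ^ N) ^ 2) ≤ 1 / (n * p) := by
    have e : n * (σ ^ 2 / ((n * p : ℝ) / 2 ^ N) ^ 2) = (σ * 2 ^ N) ^ 2 * (1 / (n * p)) * (1 / p) := by
      field_simp
    have h3 : (σ * 2 ^ N) ^ 2 ≤ 1 := pow_le_one₀ (by positivity) hσ
    have h4 : 1 / (p : ℝ) ≤ 1 := by rw [div_le_one (by positivity)]; exact rp
    rw [e]
    calc (σ * 2 ^ N) ^ 2 * (1 / (n * p)) * (1 / p) ≤ 1 * (1 / ((n : ℝ) * p)) * 1 := by gcongr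
      _ = _ := by ring
  have h3 : n * (4 * c / (k : ℝ) ^ 4) ≤ 4 * c * (1 / (n * p)) := by
    calc n * (4 * c / (k : ℝ) ^ 4) = 4 * c * ((n * 1) / (k : ℝ) ^ 4) := by ring
      _ ≤ 4 * c * ((n * p) / (k : ℝ) ^ 4) := by gcongr
      _ ≤ _ := by gcongr
  have h5 : (0 : ℝ) < 1 / (n * p) := by positivity
  have h6 : (0 : ℝ) < (2 / 3) ^ p := by positivity
  have h7 : 0 ≤ (|M| + 4 * c) * (2 / 3) ^ p := by positivity
  linarith

theorem exp_neg_log_mul (p : ℕ) : Real.exp (-Real.log (3 / 2) * p) = (2 / 3 : ℝ) ^ p := by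
  rw [mul_comm, Real.exp_nat_mul, ← Real.log_inv, Real.exp_log (by norm_num)]
  norm_num

end Conclusion

end LatticeRegression

theorem mainTheorem4 :
    -- absolute constants
    ∃ κ : ℝ, 0 < κ ∧ ∃ A a : ℕ,
    ∀ c M : ℝ, 0 < c →
    -- a constant that depends only on the density bound and on the first moment bound
    ∃ K : ℝ, ∀ (ε : ℝ) (n p Q R N : ℕ) (σ : ℝ),
      0 < ε → 0 < n → 0 < p → 0 < Q → 0 < R → 0 < N → 0 ≤ σ →
    ∀ (Ω : Type*) [MeasurableSpace Ω] (P : Measure Ω) [IsProbabilityMeasure P]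
      (X : Ω → Matrix (Fin n) (Fin p) ℝ) (W : Ω → Fin n → ℝ) (Z : Ω → Fin p → ℤ)
      (lawX lawW : Measure ℝ) (f : ℝ → ENNReal) (β : Fin p → ℝ),
      -- the measurement matrix has iid entries with density at most `c` and finite mean
      Measurable f → (∀ᵐ x, f x ≤ ENNReal.ofReal c) → lawX = volume.withDensity f →
      Integrable (fun x => x) lawX → ∫ x, |x| ∂lawX ≤ M →
      (∀ i j, Measurable fun ω => X ω i j) → (∀ i j, P.map (fun ω => X ω i j) = lawX) →
      iIndepFun (fun (ij : Fin n × Fin p) ω => X ω ij.1 ij.2) P →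
      -- the noise is iid with mean zero and variance at most `σ ^ 2`, independent of `X`
      MemLp (fun x => x) 2 lawW → ∫ x, x ∂lawW = 0 → variance (fun x => x) lawW ≤ σ ^ 2 →
      (∀ i, Measurable fun ω => W ω i) → (∀ i, P.map (fun ω => W ω i) = lawW) →
      iIndepFun (fun i ω => W ω i) P →
      IndepFun (fun ω i j => X ω i j) W P →
      -- the internal randomness of the algorithm
      (∀ j, Measurable fun ω => Z ω j) →
      (∀ j, P.map (fun ω => Z ω j) = uniformOn (shiftRange p (Q * R) : Set ℤ)) →
      iIndepFun (fun j ω => Z ω j) P →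
      IndepFun (fun ω => ((fun i j => X ω i j : Fin n → Fin p → ℝ), W ω)) Z P →
      -- the ground truth is bounded by `R` and has denominator `Q`
      (∀ j, |β j| ≤ R) → (∀ j, ∃ k : ℤ, β j = k / Q) →
      -- the parameters
      300 / ε * Real.logb 2 (300 / ((1 + c) * ε)) ≤ p →
      σ ≤ (2 : ℝ) ^ (-((1 + ε) *
        (((p : ℝ) + 2 * n) ^ 2 / (2 * n) + (2 + (p : ℝ) / n) * Real.logb 2 (R * Q)))) →
      (1 + ε) * (((p : ℝ) + 2 * n) ^ 2 / (2 * n) + (2 + (p : ℝ) / n) * Real.logb 2 (R * Q)) ≤ N →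
      (0 < σ → (N : ℝ) ≤ Real.logb 2 (1 / σ)) →
      1 - K * (1 / ((n : ℝ) * p) + Real.exp (-κ * p)) ≤
        P.real {ω | ∃ (out : Fin p → ℚ) (t : ℕ),
          LBRTerminates (fun i => (X ω).mulVec β i + W ω i) (X ω) N Q R 1 (Z ω) out t ∧
          (∀ j, (out j : ℝ) = β j) ∧
          (t : ℝ) ≤ A * ((n : ℝ) + p + N + Real.logb 2 R + Real.logb 2 Q) ^ a} := by
  refine ⟨Real.log (3 / 2), Real.log_pos (by norm_num), 100 ^ 48, 48, fun c M hc => ?_⟩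
  obtain ⟨k0, hk0⟩ := exists_forall_large hc
  refine ⟨|M| + 4 * c + 15 + Real.exp (Real.log (3 / 2) * k0), ?_⟩
  intro ε n p Q R N σ hε hn hp hQ hR hN hσ Ω _ P _ X W Z lawX lawW f β hf hfc hlawX hXint hXM hXm hXl
    hXi hν hν0 hνσ hWm hWl hWi hXW hZm hZl hZi hUZ hβR hβQ hpε hσε hNε hNσ
  rw [exp_neg_log_mul]
  have hnp : (0 : ℝ) < 1 / ((n : ℝ) * p) := by positivity
  have hlog : 0 < Real.log (3 / 2) := Real.log_pos (by norm_num)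
  rcases lt_or_ge (p + 2 * n) k0 with hlt | hge
  · -- the constant makes the bound trivial
    refine le_trans ?_ measureReal_nonneg
    have h1 : 1 ≤ Real.exp (Real.log (3 / 2) * k0) * (2 / 3) ^ p := by
      rw [← exp_neg_log_mul, ← Real.exp_add]
      refine Real.one_le_exp ?_
      have : (p : ℝ) ≤ k0 := by exact_mod_cast (by omega : p ≤ k0)
      nlinarith
    have h2 : 0 ≤ (|M| + 4 * c + 15) * (1 / ((n : ℝ) * p) + (2 / 3) ^ p) := by positivity
    have h3 : 0 ≤ Real.exp (Real.log (3 / 2) * k0) * (1 / ((n : ℝ) * p)) := by positivity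
    linarith
  · obtain ⟨hk6, hks, hkc⟩ := hk0 _ hge
    have hkε := pow_mul_le_two_rpow hc hε hk6 hks hkc (by omega : p ≤ p + 2 * n) hpε
    choose B hB using hβQ
    have rQ : (0 : ℝ) < Q := by exact_mod_cast hQ
    have hBQR : ∀ j, |B j| ≤ (Q * R : ℕ) := fun j => by
      have h1 := hβR j
      rw [hB j, abs_div, Nat.abs_cast, div_le_iff₀ rQ, mul_comm] at h1
      exact_mod_cast h1
    have hlawXp : IsProbabilityMeasure lawX := by
      rw [← hXl ⟨0, hn⟩ ⟨0, hp⟩]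
      exact Measure.isProbabilityMeasure_map (hXm _ _).aemeasurable
    have hdens : lawX ≤ ENNReal.ofReal c • volume := by
      rw [hlawX, ← withDensity_const]
      exact withDensity_mono hfc
    have hbad := measure_not_good_le (X := fun ω i j => X ω i j) (N := N) hn hp hQ hR hXm hXl hXi hc.le
      hdens hXint hXM hWm hXW hWl hν hν0 hνσ hZm hZl hZi hUZ hBQR rfl rfl
    have hfail := hbad.trans (failure_le hn hp rfl hc hσ (mul_two_pow_le_one hσ hNσ)
      (union_bound_le hn hp hQ hR hε hc rfl hk6 rfl hNε hkε))
    have hlen := pow_mul_lengthBound_lt hn hQ hR hε hc rfl hk6 hNε hks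
    set good := {ω | ∃ (out : Fin p → ℚ) (t : ℕ),
          LBRTerminates (fun i => (X ω).mulVec β i + W ω i) (X ω) N Q R 1 (Z ω) out t ∧
          (∀ j, (out j : ℝ) = β j) ∧
          (t : ℝ) ≤ (100 ^ 48 : ℕ) * ((n : ℝ) + p + N + Real.logb 2 R + Real.logb 2 Q) ^ 48}
      with hgood
    have hcover : Set.univ ⊆ good ∪ {ω | ¬(Good N Q R (fun i j => X ω i j) (W ω) B (Z ω) ∧
        ∀ j, Z ω j ∈ shiftRange p (Q * R))} := by
      intro ω _
      by_cases h : Good N Q R (fun i j => X ω i j) (W ω) B (Z ω) ∧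
        ∀ j, Z ω j ∈ shiftRange p (Q * R)
      · left
        obtain ⟨t, ht, hrun⟩ := h.1.exists_lbrTerminates hn hp hQ hR
          (fun j => by have := hBQR j; push_cast at this; exact this) h.2 hlen hB le_rfl
        refine ⟨_, t, hrun, fun j => ?_, ?_⟩
        · rw [hB j]; push_cast; rfl
        · have h1 : (t : ℝ) ≤
              ((100 + N + 10 * (p + 2 * n) + Nat.size Q + Nat.size R : ℕ) : ℝ) ^ 48 := by
            exact_mod_cast ht
          have h2 := pow_le_pow_left₀ (Nat.cast_nonneg _) (sizeSum_le (N := N) hn hp hQ hR) 48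
          rw [mul_pow] at h2
          rw [Nat.cast_pow]
          exact h1.trans h2
      · right; exact h
    have h1 := (measureReal_mono (μ := P) hcover).trans (measureReal_union_le _ _)
    rw [probReal_univ] at h1
    have h2 : 0 ≤ Real.exp (Real.log (3 / 2) * k0) * (1 / ((n : ℝ) * p) + (2 / 3) ^ p) := by
      positivity
    linarith
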